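/- Let $p$ be a prime. A pointed valued field $(K,v,t)$ is a field $K$ with a valuation $v$ (valuation ring $\mathcal O_v$) and an element $t\in K$, regarded as a structure in the language of rings with a unary predicate for $\mathcal O_v$ and a constant for $t$. A class of such structures is elementary if it is the class of all models of some set of first-order sentences in this language. A valued field of characteristic $p$ is deeply ramified if for all $x$ with $0<v(x)<\infty$ the Frobenius map of $\mathcal O_v/(x)$ is surjective. A henselian valued field of residue characteristic $p$ is separably tame if every finite separable extension $(L,w)/(K,v)$ satisfies $p\nmid (wL:vK)$, $Lw/Kv$ is separable, and $[L:K]=(wL:vK)\,[Lw:Kv]$; it is separably defectless if every finite separable extension satisfies this last equality. A valued field is separable-algebraically maximal if it has no proper immediate separable algebraic extension. For $0<v(t)<\infty$ let $v_{t^+}$ be the coarsening of $v$ with valuation ring $\mathcal O_v[1/t]$. For $\alpha$ separable algebraic over $K$ with minimal polynomial $m_\alpha$ put $\delta(\alpha)=m_\alpha'(\alpha)$. (1) The class $\mathcal C_p$ of pointed deeply ramified henselian valued fields $(K,v,t)$ of characteristic $p$ with $0<v(t)<\infty$ such that $(K,v_{t^+})$ is separably tame is elementary. (2) For every $e\in\mathbb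 N\cup\{\infty\}$, the subclass $\mathcal C_{p,e}$ of those $(K,v,t)\in\mathcal C_p$ for which $K$ has degree of imperfection $e$, i.e. $[K:K^p]=p^e$ ($=\infty$ if $e=\infty$), is elementary. (3) For every pointed deeply ramified henselian valued field $(K,v,t)$ of characteristic $p$ with $0<v(t)<\infty$ the following are equivalent: (i) $(K,v_{t^+})$ is separably defectless; (ii) for every finite separable extension $(K',v')/(K,v)$ with $e(v'/v)=(v'K':vK)=1$ there is $\alpha\in\mathcal O_{v'}$ with $K'=K(\alpha)$ and $0\le v'(\delta(\alpha))\le v(t)$; (iii) $(K,v_{t^+})$ is separable-algebraically maximal. (4) Condition (ii) is first-order: there is a set $T$ of first-order sentences such that a field $(K,v,t)$ as in (3) is a model of $T$ if and only if it satisfies (ii). -/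

import Mathlib

open FirstOrder IsLocalRing
open scoped IntermediateField

universe u

namespace PointedVF

/-! ### Valued fields and their extensions

A valued field `(K, v)` is a field `K` with a valuation subring `A = O_v`. -/

section Extensions

variable {K L : Type*} [Field K] [Field L] [Algebra K L]

/-- `(L, B)` is an extension of the valued field `(K, A)`: `B ∩ K = A`. -/
def Extends (A : ValuationSubring K) (B : ValuationSubring L) : Prop :=
  B.comap (algebraMap K L) = A

variable {A : ValuationSubring K} {B : ValuationSubring L}

/-- The inclusion `O_v → O_w` of valuation rings of an extension of valued fields. -/
def Extends.ringMap (h : Extends A B) : A →+* B :=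
  ((algebraMap K L).comp A.subtype).codRestrict B.toSubring fun x => by
    have hx : (x : K) ∈ B.comap (algebraMap K L) := by rw [h]; exact x.2
    exact hx

theorem Extends.isLocalHom_ringMap (h : Extends A B) : IsLocalHom h.ringMap := by
  constructor
  intro a ha
  obtain ⟨b, hb⟩ := ha.exists_right_inv
  have hb' : algebraMap K L (a : K) * (b : L) = 1 := congrArg Subtype.val hb
  have ha0 : (a : K) ≠ 0 := by
    intro h0
    simp [h0] at hb'
  have hinv : (a : K)⁻¹ ∈ A := by
    have hmem : (a : K)⁻¹ ∈ B.comap (algebraMap K L) := by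
      rw [ValuationSubring.mem_comap, map_inv₀, ← eq_inv_of_mul_eq_one_right hb']
      exact b.2
    rwa [show B.comap (algebraMap K L) = A from h] at hmem
  exact IsUnit.of_mul_eq_one ⟨(a : K)⁻¹, hinv⟩ (Subtype.ext (mul_inv_cancel₀ ha0))

/-- The induced embedding `Kv → Lw` of residue fields. -/
noncomputable def Extends.residueMap (h : Extends A B) : ResidueField A →+* ResidueField B :=
  haveI := h.isLocalHom_ringMap
  ResidueField.map h.ringMap

/-- The residue field extension `Lw / Kv` is separable. -/
def Extends.ResidueSeparable (h : Extends A B) : Prop :=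
  letI : Algebra (ResidueField A) (ResidueField B) := h.residueMap.toAlgebra
  Algebra.IsSeparable (ResidueField A) (ResidueField B)

/-- The inertia degree `f(w/v) = [Lw : Kv]`. -/
noncomputable def Extends.inertiaDegree (h : Extends A B) : ℕ :=
  letI : Algebra (ResidueField A) (ResidueField B) := h.residueMap.toAlgebra
  Module.finrank (ResidueField A) (ResidueField B)

variable (K) in
/-- The value group `w(Kˣ)` of the restriction of `w` to `K`, as a subgroup of `wL`. -/
noncomputable def valueSubgroup (B : ValuationSubring L) : Subgroup (B.ValueGroup)ˣ :=
  ((Units.map (B.valuation.toMonoidWithZeroHom : L →* B.ValueGroup)).comp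
    (Units.map (algebraMap K L : K →* L))).range

variable (K) in
/-- The ramification index `e(w/v) = (wL : vK)`, where `v` is the restriction of `w` to `K`. -/
noncomputable def ramificationIndex (B : ValuationSubring L) : ℕ :=
  (valueSubgroup K B).index

/-- An immediate extension: the embeddings of value groups and of residue fields are onto. -/
def Extends.Immediate (h : Extends A B) : Prop :=
  valueSubgroup K B = ⊤ ∧ Function.Surjective h.residueMap

variable (K) in
/-- The different `δ(α) = m_α'(α)`, where `m_α` is the minimal polynomial of `α` over `K`. -/
noncomputable def different (α : L) : L :=
  Polynomial.aeval α (Polynomial.derivative (minpoly K α))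

end Extensions

section Fields

variable {K : Type u} [Field K]

/-- A henselian valued field is separably defectless if `[L : K] = e(w/v) f(w/v)` for every finite
separable extension `(L, w)` of `(K, v)`. -/
def SeparablyDefectless (A : ValuationSubring K) : Prop :=
  ∀ (L : Type u) [Field L] [Algebra K L] [FiniteDimensional K L] [Algebra.IsSeparable K L]
    (B : ValuationSubring L) (h : Extends A B),
    Module.finrank K L = ramificationIndex K B * h.inertiaDegree

/-- No proper separable algebraic extension of `(K, v)` is immediate. -/
def SeparableAlgebraicallyMaximal (A : ValuationSubring K) : Prop :=
  ∀ (L : Type u) [Field L] [Algebra K L] [Algebra.IsSeparable K L]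
    (B : ValuationSubring L) (h : Extends A B),
    h.Immediate → Function.Surjective (algebraMap K L)

/-- `(K, v)`, of residue characteristic `p`, is henselian and all of its finite separable
extensions `(L, w)` are tame: `p ∤ (wL : vK)`, `Lw / Kv` is separable, and
`[L : K] = e(w/v) f(w/v)`. -/
def SeparablyTame (p : ℕ) (A : ValuationSubring K) : Prop :=
  HenselianLocalRing A ∧
  ∀ (L : Type u) [Field L] [Algebra K L] [FiniteDimensional K L] [Algebra.IsSeparable K L]
    (B : ValuationSubring L) (h : Extends A B),
    ¬ p ∣ ramificationIndex K B ∧ h.ResidueSeparable ∧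
      Module.finrank K L = ramificationIndex K B * h.inertiaDegree

/-- A valued field of characteristic `p` is deeply ramified if `O_v / (x)` is semi-perfect (its
Frobenius map is surjective) for all `x` with `0 < v x < ∞`. -/
def DeeplyRamified (p : ℕ) (A : ValuationSubring K) : Prop :=
  ∀ x : A, x ≠ 0 → x ∈ maximalIdeal A →
    Function.Surjective fun y : A ⧸ Ideal.span {x} => y ^ p

/-- The valuation ring `O_v[1/t]` of the finest coarsening `v_{t⁺}` of `v` in which `t` is a
unit (for `t ≠ 0`). -/
def coarsening (A : ValuationSubring K) (t : K) : ValuationSubring K :=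
  A.ofLE (A.toSubring ⊔ Subring.closure {t⁻¹}) le_sup_left

/-- Every finite separable extension `(L, w)` of `(K, v)` with `e(w/v) = 1` has a generator
`α ∈ O_w` with `0 ≤ w(δ(α)) ≤ v(t)`. -/
def HasSmallDifferentGenerators (A : ValuationSubring K) (t : K) : Prop :=
  ∀ (L : Type u) [Field L] [Algebra K L] [FiniteDimensional K L] [Algebra.IsSeparable K L]
    (B : ValuationSubring L), Extends A B → ramificationIndex K B = 1 →
    ∃ α : L, α ∈ B ∧ K⟮α⟯ = ⊤ ∧ B.valuation (different K α) ≤ 1 ∧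
      B.valuation (algebraMap K L t) ≤ B.valuation (different K α)

/-- `K` has degree of imperfection `e`: `[K : K^p] = p ^ e`, to be read as `[K : K^p] = ∞` if
`e = ∞`. -/
def HasImperfectionDegree (p : ℕ) [Fact p.Prime] (K : Type u) [Field K] [CharP K p]
    (e : ℕ∞) : Prop :=
  (∀ n : ℕ, e = n → Module.finrank (frobenius K p).fieldRange K = p ^ n) ∧
  (e = ⊤ → ¬ FiniteDimensional (frobenius K p).fieldRange K)

/-- `(K, v, t)` is a pointed deeply ramified henselian valued field of characteristic `p` with
`0 < v t < ∞`. -/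
structure PointedDeeplyRamifiedHenselian (p : ℕ) (A : ValuationSubring K) (t : K) : Prop where
  charP : CharP K p
  henselian : HenselianLocalRing A
  deeplyRamified : DeeplyRamified p A
  ne_zero : t ≠ 0
  lt_one : A.valuation t < 1

/-- The class `C_p`. -/
structure ClassC (p : ℕ) (A : ValuationSubring K) (t : K) : Prop
    extends PointedDeeplyRamifiedHenselian p A t where
  separablyTame : SeparablyTame p (coarsening A t)

/-- The class `C_{p,e}`. -/
structure ClassCe (p : ℕ) [Fact p.Prime] (e : ℕ∞) (A : ValuationSubring K) (t : K) : Prop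
    extends ClassC p A t where
  imperfection : HasImperfectionDegree p K e

end Fields

/-! ### The language of pointed valued fields -/

/-- The constant symbol for the distinguished element. -/
inductive PointFunc : ℕ → Type
  | t : PointFunc 0

/-- The unary predicate symbol for the valuation ring. -/
inductive ValRel : ℕ → Type
  | O : ValRel 1

/-- The language consisting of a unary predicate and a constant. -/
def pointVal : Language := ⟨PointFunc, ValRel⟩

/-- The language of rings with a predicate for the valuation ring and a constant for `t`. -/
abbrev lang : Language := Language.ring.sum pointVal

/-- The pointed valued field `(K, v, t)` as a first-order structure. -/
@[reducible] def toStructure {K : Type u} [Field K] (A : ValuationSubring K) (t : K) :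
    lang.Structure K :=
  letI : Language.ring.Structure K := (Ring.compatibleRingOfRing K).toStructure
  letI : pointVal.Structure K :=
    { funMap := fun {n} (f : PointFunc n) =>
        match n, f with
        | _, .t => fun _ => t
      RelMap := fun {n} (r : ValRel n) =>
        match n, r with
        | _, .O => fun x => x 0 ∈ A }
  Language.sumStructure Language.ring pointVal K

/-- `(K, v, t) ⊨ T`. -/
def Models {K : Type u} [Field K] (A : ValuationSubring K) (t : K) (T : lang.Theory) : Prop :=
  @Language.Theory.Model lang K (toStructure A t) T

/-- A class `C` of pointed valued fields is elementary: there is a first-order theory whose models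
are precisely the structures `(K, v, t)` in `C`. -/
def IsElementary (C : ∀ (K : Type u) [Field K], ValuationSubring K → K → Prop) : Prop :=
  ∃ T : lang.Theory, ∀ (M : Type u) (S : lang.Structure M),
    @Language.Theory.Model lang M S T ↔
      ∃ (_ : Field M) (A : ValuationSubring M) (t : M), S = toStructure A t ∧ C M A t

end PointedVF

namespace PointedVF

open Polynomial

/-! ### Coarsenings of valuation rings and the henselian property -/

section Coarsening

variable {K : Type*} [Field K]

/-! Write `v` for the given valuation and `w` for its coarsening at `t`. Deep ramification says that
`p`-th powers are dense in `K` for `v`. Density passes to every nontrivial coarsening and to finite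
separable extensions, and it makes residue fields perfect and value groups `p`-divisible. Hence over
`w` "separably tame" and "separably defectless" agree (a trivial `w` is checked by hand). So the
class `C_p` is elementary as soon as defectlessness of `w` is equivalent to condition (ii) and (ii)
is first-order.

(i) implies (ii). If `e = 1` and `w` is defectless, then `[L : K]` is the degree of the separable
residue extension of `w`. A lifted residue generator `β` has different of `w`-value zero, which
means `v(δ(β)) ≤ k v(t)` for some `k`. By density choose `α` with `α ^ p ^ m` close to `β`, where `k
≤ p ^ m`. Since `δ` is a product of differences of conjugates, its value is divided by `p ^ m`, and
`v(δ(α)) ≤ v(t)`.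

(ii) implies (iii). An immediate extension for `w` has `e = 1` for `v`. The generator from (ii) has
a different that is a unit for `w`, so its minimal polynomial has a simple root in the unchanged
residue field, and Hensel's lemma makes the degree one.

(iii) implies (i) is the heart. Let `N/K` be finite Galois with ramification group `R`. If `R` is
trivial, independence of characters bounds the inertia group by `e` and its index by `f`, so `N` is
defectless, and so are its subextensions. Suppose `R ≠ 1`, with fixed field `E`. Density shows that
every leading term of `N` comes from `E`, so the ramification group of `E/K` is trivial and `E` has
an integral element of trace one. Additive Hilbert 90 yields `a ∈ E` outside `℘(E) + O_E`, where
`℘(x) = x ^ p - x`. Averaging weighted by the trace-one element yields a finite Galois-stable space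
`Φ` of such parameters meeting `℘(E) + O_E` only in zero. Adjoin all roots of `℘(X) = a` for `a ∈
Φ`. A linear choice `ψ` of roots has a stabiliser `H` which together with the new ramification group
generates the Galois group, but which is not everything. The fixed field of `H` is then a proper
immediate extension of `K`, contradicting maximality (`exists_immediate_subextension`,
`SeparableAlgebraicallyMaximal.ramificationGroup_eq_bot`).

Definability. Over a henselian field the valuation ring of a finite separable `L` is the set of
elements with integral norm. Presenting `L` by companion matrices turns elements into coordinate
vectors and norms into determinants, so (ii) in a fixed degree is a single sentence. -/

theorem mem_coarsening {A : ValuationSubring K} {t : K} (ht : t ∈ A) (ht0 : t ≠ 0) {x : K} :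
    x ∈ coarsening A t ↔ ∃ k : ℕ, t ^ k * x ∈ A := by
  change x ∈ A.toSubring ⊔ Subring.closure {t⁻¹} ↔ _
  constructor
  · intro hx
    let S : Subring K :=
      { carrier := {x | ∃ k : ℕ, t ^ k * x ∈ A}
        mul_mem' := by
          rintro a b ⟨k, hk⟩ ⟨l, hl⟩
          refine ⟨k + l, ?_⟩
          have := mul_mem hk hl
          rwa [mul_mul_mul_comm, ← pow_add] at this
        one_mem' := ⟨0, by simp [one_mem]⟩
        add_mem' := by
          rintro a b ⟨k, hk⟩ ⟨l, hl⟩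
          refine ⟨k + l, ?_⟩
          have h1 := mul_mem (pow_mem ht l) hk
          have h2 := mul_mem (pow_mem ht k) hl
          have := add_mem h1 h2
          convert this using 1
          ring
        zero_mem' := ⟨0, by simp [zero_mem]⟩
        neg_mem' := by
          rintro a ⟨k, hk⟩
          exact ⟨k, by simpa using neg_mem hk⟩ }
    have hS : A.toSubring ⊔ Subring.closure {t⁻¹} ≤ S := by
      refine sup_le (fun a ha => ⟨0, by simpa using ha⟩) ?_
      rw [Subring.closure_le, Set.singleton_subset_iff]
      exact ⟨1, by simp [ht0, one_mem]⟩
    exact hS hx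
  · rintro ⟨k, hk⟩
    have h1 : t ^ k * x ∈ A.toSubring ⊔ Subring.closure {t⁻¹} :=
      (le_sup_left : A.toSubring ≤ _) hk
    have h2 : t⁻¹ ∈ A.toSubring ⊔ Subring.closure {t⁻¹} :=
      (le_sup_right : Subring.closure {t⁻¹} ≤ _) (Subring.subset_closure rfl)
    have := mul_mem (pow_mem h2 k) h1
    rwa [← mul_assoc, ← mul_pow, inv_mul_cancel₀ ht0, one_pow, one_mul] at this

theorem le_coarsening (A : ValuationSubring K) (t : K) : A ≤ coarsening A t :=
  fun _ hx => (le_sup_left : A.toSubring ≤ A.toSubring ⊔ Subring.closure {t⁻¹}) hx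

/-- Overrings of henselian valuation rings are henselian. -/
theorem henselianLocalRing_of_le {A A' : ValuationSubring K} (h : A ≤ A')
    [HenselianLocalRing A] : HenselianLocalRing A' := by
  refine ⟨fun f hf a₀ h0 h1 => ?_⟩
  set c := f.eval a₀ with hc
  by_cases hc0 : c = 0
  · exact ⟨a₀, hc0, by simp⟩
  obtain ⟨d, hd⟩ := h1
  -- Substituting `a₀ + c d⁻¹ y` and dividing by `c` turns `f = 0` into `1 + y + ∑ bᵢ y ^ (i + 2) =
  -- 0`. Each `bᵢ` is a multiple of `c`, so it lies in the maximal ideal of `A'`, which is contained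
  -- in that of `A`.
  set τ := taylor a₀ f with hτ
  have hdeg : f.natDegree ≠ 0 := by
    intro h
    rw [hf.natDegree_eq_zero] at h
    rw [h, eval_one] at hc
    rw [hc] at h0
    exact (Ideal.ne_top_iff_one _).mp (maximalIdeal.isMaximal A').ne_top h0
  obtain ⟨m, hm⟩ := Nat.exists_eq_succ_of_ne_zero hdeg
  have hle : A'.nonunits ≤ A.nonunits := ValuationSubring.nonunits_le_nonunits.mpr h
  -- the coefficients of the rescaled polynomial
  have hb : ∀ i : ℕ, ∃ b : A, b ∈ maximalIdeal A ∧
      (b : K) = τ.coeff (i + 2) * (c : K) ^ (i + 1) * ((↑d⁻¹ : A') : K) ^ (i + 2) := by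
    intro i
    have h2 : τ.coeff (i + 2) * c ^ (i + 1) * (↑d⁻¹ : A') ^ (i + 2) ∈ maximalIdeal A' :=
      Ideal.mul_mem_right _ _ (Ideal.mul_mem_left _ _ (Ideal.pow_mem_of_mem _ h0 _ i.succ_pos))
    have h3 := hle (ValuationSubring.coe_mem_nonunits_iff.mpr h2)
    obtain ⟨ha, hm⟩ := ValuationSubring.mem_nonunits_iff_exists_mem_maximalIdeal.mp h3
    exact ⟨_, hm, by push_cast; rfl⟩
  choose b hbm hb using hb
  let r : A[X] := ∑ i ∈ Finset.range m, C (b i) * X ^ (m - 1 - i)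
  -- The reciprocal equation in `z = y⁻¹` is monic over `A` and reduces to `z ^ m (z + 1)`, with
  -- simple root `-1`.
  let g : A[X] := X ^ m * (X + 1) + r
  have hr : r.degree < (m + 1 : ℕ) := by
    refine lt_of_le_of_lt (degree_sum_le _ _) ?_
    rw [Finset.sup_lt_iff (WithBot.bot_lt_coe _)]
    intro i hi
    refine lt_of_le_of_lt (degree_C_mul_X_pow_le _ _) ?_
    have := Finset.mem_range.mp hi
    exact_mod_cast (by omega : m - 1 - i < m + 1)
  have hX1 : (X + 1 : A[X]).Monic := by simpa using monic_X_add_C (1 : A)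
  have hg0 : (X ^ m * (X + 1) : A[X]).Monic := (monic_X_pow m).mul hX1
  have hg : g.Monic := by
    refine hg0.add_of_left (lt_of_lt_of_le hr ?_)
    rw [degree_mul, degree_X_pow, show (X + 1 : A[X]) = X + C 1 by simp, degree_X_add_C]
    norm_cast
  have hrm : ∀ q : A, r.eval q ∈ maximalIdeal A := fun q => by
    simp only [r, eval_finsetSum, eval_mul, eval_C]
    exact Ideal.sum_mem _ fun i _ => Ideal.mul_mem_right _ _ (hbm i)
  have hrm' : ∀ q : A, r.derivative.eval q ∈ maximalIdeal A := fun q => by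
    simp only [r, derivative_sum, derivative_C_mul, eval_finsetSum, eval_mul, eval_C]
    exact Ideal.sum_mem _ fun i _ => Ideal.mul_mem_right _ _ (hbm i)
  obtain ⟨z, hz, hz1⟩ := HenselianLocalRing.is_henselian g hg (-1) (by simpa [g] using hrm (-1)) (by
    have h1 : g.derivative.eval (-1) = (-1) ^ m + r.derivative.eval (-1) := by
      simp [g, derivative_mul]
    rw [h1]
    by_contra hn
    have h2 : ((-1) ^ m + r.derivative.eval (-1) : A) ∈ maximalIdeal A := hn
    have h3 := (Ideal.add_mem_iff_left _ (hrm' (-1))).mp h2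
    exact ((isUnit_one.neg).pow m) |> fun hu => (mem_maximalIdeal _).mp h3 hu)
  have hzu : IsUnit z := by
    by_contra hn
    have h2 : z ∈ maximalIdeal A := hn
    have := sub_mem h2 hz1
    rw [sub_sub_cancel] at this
    exact (mem_maximalIdeal _).mp this isUnit_one.neg
  obtain ⟨z, rfl⟩ := hzu
  let y : A' := ⟨((↑z⁻¹ : A) : K), h (↑z⁻¹ : A).2⟩
  have hzK : ((z : A) : K) ≠ 0 := by
    intro h; exact z.ne_zero (Subtype.ext h)
  have hzi : ((↑z⁻¹ : A) : K) = ((z : A) : K)⁻¹ := map_units_inv A.subtype z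
  have hdK : ((d : A') : K) ≠ 0 := by
    intro h; exact d.ne_zero (Subtype.ext h)
  have hdi : ((↑d⁻¹ : A') : K) = ((d : A') : K)⁻¹ := map_units_inv A'.subtype d
  refine ⟨a₀ + c * ↑d⁻¹ * y, ?_, ?_⟩
  · have e1 : f.eval (a₀ + c * ↑d⁻¹ * y) = τ.eval (c * ↑d⁻¹ * y) := by
      rw [hτ, taylor_eval, add_comm]
    have hτd : τ.natDegree = m + 1 := by rw [hτ, natDegree_taylor, hm]
    rw [IsRoot.def, e1, eval_eq_sum_range, hτd, Finset.sum_range_succ', Finset.sum_range_succ']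
    have hz' : ((z : A) : K) ^ m * ((z : A) + 1) +
        ∑ i ∈ Finset.range m, (b i : K) * (z : A) ^ (m - 1 - i) = 0 := by
      have := congrArg (Subtype.val : A → K) (show g.eval (z : A) = 0 from hz)
      simpa [g, r, eval_finsetSum] using this
    apply Subtype.ext
    have h00 : τ.coeff 0 = c := by rw [hτ, taylor_coeff_zero]
    have h01 : τ.coeff 1 = d := by rw [hτ, taylor_coeff_one, ← hd]
    simp only [zero_add, h00, h01]
    push_cast
    rw [hdi]
    have hy : (y : K) = ((z : A) : K)⁻¹ := hzi
    rw [hy]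
    have key : ∀ i ∈ Finset.range m, (τ.coeff (i + 1 + 1) : K) *
        ((c : K) * ((d : A') : K)⁻¹ * ((z : A) : K)⁻¹) ^ (i + 1 + 1) =
        c * (((z : A) : K) ^ (m + 1))⁻¹ * ((b i : K) * (z : A) ^ (m - 1 - i)) := by
      intro i hi
      have hi' := Finset.mem_range.mp hi
      rw [hb, hdi]
      obtain ⟨j, rfl⟩ : ∃ j, m = i + 1 + j := ⟨m - (i + 1), by omega⟩
      rw [show i + 1 + j - 1 - i = j by omega]
      have hp : ((z : A) : K)⁻¹ ^ (i + 1 + 1) =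
          (((z : A) : K) ^ (i + 1 + j + 1))⁻¹ * ((z : A) : K) ^ j := by
        rw [inv_pow, eq_comm, inv_mul_eq_iff_eq_mul₀ (pow_ne_zero _ hzK),
          eq_mul_inv_iff_mul_eq₀ (pow_ne_zero _ hzK), ← pow_add]
        congr 1
        omega
      rw [mul_pow, hp]
      ring
    rw [Finset.sum_congr rfl key, ← Finset.mul_sum, eq_neg_of_add_eq_zero_right hz']
    field_simp
    ring
  · rw [add_sub_cancel_left, mul_assoc]
    exact Ideal.mul_mem_right _ _ h0

end Coarsening

/-! ### Henselian invariants force a local ring -/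

section Local

/-- A finite group acting on a domain with henselian local ring of invariants forces the domain to
be local. -/
theorem isLocalRing_of_isInvariant {A S : Type*} (G : Type*) [CommRing A] [CommRing S] [IsDomain S]
    [Algebra A S] [FaithfulSMul A S] [HenselianLocalRing A] [Group G] [Finite G]
    [MulSemiringAction G S] [SMulCommClass G A S] [Algebra.IsInvariant A S G] : IsLocalRing S := by
  classical
  have hint : Algebra.IsIntegral A S := Algebra.IsInvariant.isIntegral A S G
  have hunder : ∀ M : Ideal S, M.IsMaximal → M.under A = maximalIdeal A := fun M hM =>
    eq_maximalIdeal (Ideal.isMaximal_comap_of_isIntegral_of_isMaximal M)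
  obtain ⟨M₁, hM₁⟩ := Ideal.exists_maximal S
  refine IsLocalRing.of_unique_max_ideal ⟨M₁, hM₁, fun M₂ hM₂ => ?_⟩
  by_contra hne
  open scoped Pointwise in
  obtain ⟨g₀, hg₀⟩ := Algebra.IsInvariant.exists_smul_of_under_eq A S G M₁ M₂
    ((hunder M₁ hM₁).trans (hunder M₂ hM₂).symm)
  have := Fintype.ofFinite G
  open scoped Pointwise in
  let T : Finset G := Finset.univ.filter fun g => g • M₁ ≠ M₁
  open scoped Pointwise in
  have hmax : ∀ g : G, (g • M₁).IsMaximal := fun g => by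
    rw [Ideal.pointwise_smul_eq_comap]
    exact Ideal.comap_isMaximal_of_surjective
      (MulSemiringAction.toRingEquiv G S g⁻¹) (MulSemiringAction.toRingEquiv G S g⁻¹).surjective
  -- Chinese remainder: this yields `x ≡ 1` modulo `M₁` lying in every other conjugate of `M₁`.
  open scoped Pointwise in
  have htop : M₁ ⊔ ⨅ g ∈ T, g • M₁ = ⊤ := Ideal.sup_iInf_eq_top fun g hg =>
    Ideal.IsMaximal.coprime_of_ne hM₁ (hmax g) (Ne.symm (Finset.mem_filter.mp hg).2)
  obtain ⟨x', hx', x, hx, hxx⟩ := Submodule.mem_sup.mp ((Ideal.eq_top_iff_one _).mp htop)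
  open scoped Pointwise in
  have hxT : ∀ g : G, g • M₁ ≠ M₁ → x ∈ g • M₁ := fun g hg => by
    simp only [Submodule.mem_iInf] at hx
    exact hx g (Finset.mem_filter.mpr ⟨Finset.mem_univ _, hg⟩)
  have hx1 : x - 1 ∈ M₁ := by
    rw [← hxx]; simpa using hx'
  open scoped Pointwise in
  let D : Finset G := Finset.univ.filter fun g => g • M₁ = M₁
  -- The product over the stabiliser of `M₁` is fixed by that stabiliser, so each conjugate of `y`
  -- is `y` itself or lies in `M₁`.
  let y : S := ∏ g ∈ D, g • x
  open scoped Pointwise in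
  have hy1 : y - 1 ∈ M₁ := by
    rw [← Ideal.Quotient.eq]
    simp only [y, map_prod, map_one]
    refine Finset.prod_eq_one fun g hg => ?_
    rw [← map_one (Ideal.Quotient.mk M₁), Ideal.Quotient.eq]
    have hg' : g • M₁ = M₁ := (Finset.mem_filter.mp hg).2
    have : g • (x - 1) ∈ g • M₁ := Ideal.smul_mem_pointwise_smul g _ _ hx1
    rwa [hg', smul_sub, smul_one] at this
  open scoped Pointwise in
  have hyT : ∀ g : G, g • M₁ ≠ M₁ → y ∈ g • M₁ := fun g hg => by
    have h1 : (1 : G) ∈ D := by simp [D]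
    simp only [y]
    rw [← Finset.mul_prod_erase D _ h1, one_smul]
    exact Ideal.mul_mem_right _ _ (hxT g hg)
  open scoped Pointwise in
  have hyD : ∀ g : G, g • M₁ = M₁ → g • y = y := fun g hg => by
    simp only [y, Finset.smul_prod', smul_smul]
    refine Finset.prod_bij (fun d _ => g * d) ?_ ?_ ?_ ?_
    · intro d hd
      simp only [D, Finset.mem_filter, Finset.mem_univ, true_and] at hd ⊢
      rw [mul_smul, hd, hg]
    · intro a _ b _ hab
      exact mul_left_cancel hab
    · intro d hd
      refine ⟨g⁻¹ * d, ?_, by simp⟩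
      simp only [D, Finset.mem_filter, Finset.mem_univ, true_and] at hd ⊢
      rw [mul_smul, hd, inv_smul_eq_iff, hg]
    · intro d _; rfl
  open scoped Pointwise in
  have horb : ∀ g : G, g • y = y ∨ g • y ∈ M₁ := fun g => by
    by_cases hg : g • M₁ = M₁
    · exact Or.inl (hyD g hg)
    · right
      have h1 : g⁻¹ • M₁ ≠ M₁ := fun h => hg (by rw [inv_smul_eq_iff] at h; exact h.symm)
      have := Ideal.smul_mem_pointwise_smul g _ _ (hyT g⁻¹ h1)
      rwa [smul_inv_smul] at this
  let O : Finset S := Finset.univ.image fun g : G => g • y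
  have hO : ∀ z ∈ O, z = y ∨ z ∈ M₁ := by
    intro z hz
    obtain ⟨g, -, rfl⟩ := Finset.mem_image.mp hz
    exact horb g
  have hyO : y ∈ O := Finset.mem_image.mpr ⟨1, Finset.mem_univ _, one_smul _ _⟩
  -- Distinct conjugates only: modulo `M₁` this is `X - 1` times a power of `X`, so `1` is a simple
  -- root.
  let h : S[X] := ∏ z ∈ O, (X - C z)
  have hh : h.Monic := monic_prod_of_monic _ _ fun z _ => monic_X_sub_C z
  have hinv : ∀ g : G, g • h = h := fun g => by
    simp only [h, Finset.smul_prod', smul_sub, smul_X, smul_C]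
    refine Finset.prod_bij (fun z _ => g • z) ?_ ?_ ?_ ?_
    · intro z hz
      obtain ⟨k, -, rfl⟩ := Finset.mem_image.mp hz
      exact Finset.mem_image.mpr ⟨g * k, Finset.mem_univ _, mul_smul _ _ _⟩
    · intro a _ b _ hab
      exact smul_left_cancel g hab
    · intro z hz
      obtain ⟨k, -, rfl⟩ := Finset.mem_image.mp hz
      exact ⟨(g⁻¹ * k) • y, Finset.mem_image.mpr ⟨_, Finset.mem_univ _, rfl⟩, by
        rw [mul_smul, smul_inv_smul]⟩
    · intro z _; rfl
  have hlift : h ∈ Polynomial.lifts (algebraMap A S) := by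
    rw [Polynomial.lifts_iff_coeff_lifts]
    intro n
    refine Algebra.IsInvariant.isInvariant (G := G) _ fun g => ?_
    rw [← coeff_smul, hinv]
  obtain ⟨f, hfh, -, hf⟩ := Polynomial.lifts_and_natDegree_eq_and_monic hlift hh
  have hmem : ∀ a : A, algebraMap A S a ∈ M₁ ↔ a ∈ maximalIdeal A := fun a => by
    rw [← hunder M₁ hM₁]; rfl
  have hev : ∀ a : A, algebraMap A S (f.eval a) = h.eval (algebraMap A S a) := fun a => by
    rw [← hfh, eval_map_algebraMap, aeval_algebraMap_apply, coe_aeval_eq_eval]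
  have hev' : ∀ a : A, algebraMap A S (f.derivative.eval a) =
      h.derivative.eval (algebraMap A S a) := fun a => by
    rw [← hfh, derivative_map, eval_map_algebraMap, aeval_algebraMap_apply, coe_aeval_eq_eval]
  have hsplit : h = (X - C y) * ∏ z ∈ O.erase y, (X - C z) := (Finset.mul_prod_erase O _ hyO).symm
  have h1y : (1 : S) - y ∈ M₁ := by simpa using M₁.neg_mem hy1
  obtain ⟨a, ha, ha1⟩ := HenselianLocalRing.is_henselian f hf 1
    (by
      rw [← hmem, hev, map_one, hsplit, eval_mul]
      exact Ideal.mul_mem_right _ _ (by simpa using h1y))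
    (by
      by_contra hn
      have h2 : f.derivative.eval 1 ∈ maximalIdeal A := hn
      rw [← hmem, hev', map_one, hsplit, derivative_mul, eval_add, eval_mul, eval_mul] at h2
      have h3 := (Ideal.add_mem_iff_left _ (Ideal.mul_mem_right _ _ (by simpa using h1y))).mp h2
      simp only [derivative_sub, derivative_X, derivative_C, sub_zero, eval_one, one_mul,
        eval_prod] at h3
      obtain ⟨z, hz, hz1⟩ := (Ideal.IsPrime.prod_mem_iff).mp h3
      have hz2 := (hO z (Finset.mem_of_mem_erase hz)).resolve_left (Finset.ne_of_mem_erase hz)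
      simp only [eval_sub, eval_X, eval_C] at hz1
      exact hM₁.ne_top ((Ideal.eq_top_iff_one _).mpr (by simpa using M₁.add_mem hz1 hz2)))
  have hroot : h.eval (algebraMap A S a) = 0 := by
    rw [← hev, show f.eval a = 0 from ha, map_zero]
  simp only [h, eval_prod] at hroot
  -- The lifted root `a ≡ 1` is one of the conjugates. Now `y` lies in `M₂ = g₀ • M₁` and all other
  -- conjugates lie in `M₁`, so either way `a` falls into the maximal ideal of `A`.
  obtain ⟨z, hz, hz0⟩ := Finset.prod_eq_zero_iff.mp hroot
  have hza : algebraMap A S a = z := by simpa [sub_eq_zero] using hz0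
  have hcontra : a ∉ maximalIdeal A := fun h2 => by
    have := sub_mem h2 ha1
    rw [sub_sub_cancel] at this
    exact (Ideal.ne_top_iff_one _).mp (maximalIdeal.isMaximal A).ne_top this
  rcases hO z hz with rfl | hzM
  · open scoped Pointwise in
    have h2 := hyT g₀ (by rw [← hg₀]; exact hne)
    rw [← hg₀, ← hza] at h2
    refine hcontra ?_
    rw [← hunder M₂ hM₂]
    exact h2
  · exact hcontra ((hmem a).mp (hza ▸ hzM))

end Local

theorem eq_one_of_pow_eq_one {Γ : Type*} [LinearOrderedCommGroupWithZero Γ] {g : Γ} {n : ℕ}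
    (hn : n ≠ 0) (h : g ^ n = 1) : g = 1 := by
  rcases lt_trichotomy g 1 with h1 | h1 | h1
  · exact absurd h (pow_lt_one₀ zero_le h1 hn).ne
  · exact h1
  · exact absurd h (one_lt_pow₀ h1 hn).ne'

/-! ### Unique extension of henselian valuations and the norm criterion -/

section Integral

variable {K L : Type*} [Field K] [Field L] [Algebra K L] {A : ValuationSubring K}
  {B : ValuationSubring L}

theorem Extends.algebraMap_mem_iff (h : Extends A B) {x : K} : algebraMap K L x ∈ B ↔ x ∈ A := by
  rw [← ValuationSubring.mem_comap, show B.comap (algebraMap K L) = A from h]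

theorem Extends.algebraMap_mem (h : Extends A B) {x : K} (hx : x ∈ A) : algebraMap K L x ∈ B :=
  h.algebraMap_mem_iff.mpr hx

theorem Extends.mem_of_isIntegral (h : Extends A B) {x : L} (hx : IsIntegral A x) : x ∈ B := by
  have h1 : IsIntegral B x := by
    obtain ⟨f, hf, hfx⟩ := hx
    refine ⟨f.map h.ringMap, hf.map _, ?_⟩
    rw [eval₂_map]
    exact hfx
  obtain ⟨y, hy⟩ := (IsIntegrallyClosed.isIntegral_iff (R := B) (K := L)).mp h1
  rw [← hy]; exact y.2

theorem Extends.valuation_le_iff (h : Extends A B) {x y : K} :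
    B.valuation (algebraMap K L x) ≤ B.valuation (algebraMap K L y) ↔
      A.valuation x ≤ A.valuation y := by
  by_cases hy : y = 0
  · simp [hy]
  have h1 : A.valuation y ≠ 0 := by simpa using hy
  have h2 : B.valuation (algebraMap K L y) ≠ 0 := by simpa using hy
  rw [← div_le_one₀ (zero_lt_iff.mpr h1), ← div_le_one₀ (zero_lt_iff.mpr h2), ← map_div₀,
    ← map_div₀, ← map_div₀, ValuationSubring.valuation_le_one_iff,
    ValuationSubring.valuation_le_one_iff, h.algebraMap_mem_iff]

theorem Extends.valuation_lt_iff (h : Extends A B) {x y : K} :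
    B.valuation (algebraMap K L x) < B.valuation (algebraMap K L y) ↔
      A.valuation x < A.valuation y := by
  rw [← not_le, ← not_le, h.valuation_le_iff]

theorem Extends.valuation_lt_one_iff (h : Extends A B) {x : K} :
    B.valuation (algebraMap K L x) < 1 ↔ A.valuation x < 1 := by
  simpa using h.valuation_lt_iff (x := x) (y := 1)

/-- An integrally closed subring of a field is the intersection of the valuation rings containing
it. -/
theorem isIntegral_of_forall_valuationSubring {x : L}
    (hx : ∀ V : ValuationSubring L, (∀ a ∈ A, algebraMap K L a ∈ V) → x ∈ V) :
    IsIntegral A x := by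
  by_contra hn
  have : IsIntegrallyClosedIn (integralClosure A L).toSubring L :=
    inferInstanceAs (IsIntegrallyClosedIn (integralClosure A L) L)
  obtain ⟨V, hV, hxV⟩ := Subring.exists_le_valuationSubring_of_isIntegrallyClosedIn
    (R := (integralClosure A L).toSubring) (x := x) hn
  exact hxV (hx V fun a ha => hV (isIntegral_algebraMap (R := A) (A := L) (x := ⟨a, ha⟩)))

theorem exists_primitive_relation [Algebra.IsAlgebraic K L] (x : L) :
    ∃ (n : ℕ) (a : ℕ → K), (∀ i, a i ∈ A) ∧ (∃ j < n, a j = 1) ∧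
      ∑ i ∈ Finset.range n, algebraMap K L (a i) * x ^ i = 0 := by
  obtain ⟨f, hf0, hfx⟩ := Algebra.IsAlgebraic.isAlgebraic (R := K) x
  obtain ⟨j, hj, hmax⟩ := Finset.exists_max_image f.support (fun i => A.valuation (f.coeff i))
    (by simpa using hf0)
  have hj0 : f.coeff j ≠ 0 := mem_support_iff.mp hj
  refine ⟨f.natDegree + 1, fun i => f.coeff i / f.coeff j, fun i => ?_,
    ⟨j, Nat.lt_succ_of_le (le_natDegree_of_mem_supp j hj), div_self hj0⟩, ?_⟩
  · rw [← ValuationSubring.valuation_le_one_iff, map_div₀]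
    by_cases hi : i ∈ f.support
    · exact div_le_one_of_le₀ (hmax i hi) zero_le
    · rw [notMem_support_iff.mp hi]; simp
  · rw [aeval_eq_sum_range] at hfx
    simp only [Algebra.smul_def] at hfx
    have : (algebraMap K L (f.coeff j))⁻¹ * 0 = 0 := mul_zero _
    rw [← this, ← hfx, Finset.mul_sum]
    refine Finset.sum_congr rfl fun i _ => ?_
    rw [map_div₀]; ring

/-- With a relation `∑ aᵢ xⁱ = 0` normalised so that `aⱼ = 1`, the tails `c k = ∑ a_{k+i} xⁱ` are
integral, and `c j - x c (j + 1) = 1`. In a local ring one of these two terms is a unit, and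
dividing by it exhibits `x` or `x⁻¹` as integral. -/
theorem isIntegral_or_isIntegral_inv [Algebra.IsAlgebraic K L]
    [IsLocalRing (integralClosure A L)] (x : L) : IsIntegral A x ∨ IsIntegral A x⁻¹ := by
  obtain ⟨n, a, ha, ⟨j, hjn, hj⟩, hx⟩ := exists_primitive_relation (A := A) x
  by_cases hx0 : x = 0
  · left; rw [hx0]; exact isIntegral_zero
  have haint : ∀ i, IsIntegral A (algebraMap K L (a i)) := fun i =>
    isIntegral_algebraMap (R := A) (A := L) (x := ⟨a i, ha i⟩)
  let c : ℕ → L := fun k => ∑ i ∈ Finset.range (n - k), algebraMap K L (a (k + i)) * x ^ i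
  have hc : ∀ k < n, c k = algebraMap K L (a k) + x * c (k + 1) := fun k hk => by
    simp only [c]
    rw [show n - k = (n - (k + 1)) + 1 by omega, Finset.sum_range_succ', add_comm, Finset.mul_sum]
    congr 1
    · simp
    · refine Finset.sum_congr rfl fun i _ => ?_
      rw [show k + 1 + i = k + (i + 1) by ring]; ring
  -- A valuation ring contains `x` or `x⁻¹`. In the second case the relation rewrites `c k` as a
  -- polynomial in `x⁻¹`.
  have hcint : ∀ k ≤ n, IsIntegral A (c k) := fun k hk => by
    refine isIntegral_of_forall_valuationSubring fun V hV => ?_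
    rcases V.mem_or_inv_mem x with hxV | hxV
    · exact sum_mem fun i _ => mul_mem (hV _ (ha _)) (pow_mem hxV _)
    · have h1 : c k = -∑ i ∈ Finset.range k, algebraMap K L (a i) * x⁻¹ ^ (k - i) := by
        have h2 : ∑ i ∈ Finset.range k, algebraMap K L (a i) * x ^ i + x ^ k * c k = 0 := by
          rw [← hx, ← Finset.sum_range_add_sum_Ico _ hk, Finset.sum_Ico_eq_sum_range,
            Finset.mul_sum]
          congr 1
          refine Finset.sum_congr rfl fun i _ => ?_
          rw [pow_add]; ring
        have h3 : x ^ k * c k = - ∑ i ∈ Finset.range k, algebraMap K L (a i) * x ^ i :=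
          eq_neg_of_add_eq_zero_right h2
        have hk0 : x ^ k ≠ 0 := pow_ne_zero _ hx0
        rw [← mul_right_inj' hk0, h3, mul_neg, Finset.mul_sum]
        congr 1
        refine Finset.sum_congr rfl fun i hi => ?_
        have hi' := (Finset.mem_range.mp hi).le
        rw [mul_left_comm, inv_pow, ← div_eq_mul_inv]
        congr 1
        rw [eq_div_iff (pow_ne_zero _ hx0), ← pow_add]
        congr 1; omega
      rw [h1]
      exact neg_mem (sum_mem fun i _ => mul_mem (hV _ (ha _)) (pow_mem hxV _))
  have hxc : ∀ k < n, IsIntegral A (x * c (k + 1)) := fun k hk => by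
    rw [show x * c (k + 1) = c k - algebraMap K L (a k) by rw [hc k hk]; ring]
    exact (hcint k hk.le).sub (haint k)
  have hunit : ∀ (y z : L) (_ : IsIntegral A y), IsIntegral A z → y - z = 1 →
      (∃ i, IsIntegral A i ∧ y * i = 1) ∨ ∃ i, IsIntegral A i ∧ z * i = 1 := fun y z hy hz hyz => by
    have h1 : (⟨y, hy⟩ : integralClosure A L) + (-⟨z, hz⟩) = 1 := by
      rw [← sub_eq_add_neg]; exact Subtype.ext hyz
    have key : ∀ (w : L) (hw : IsIntegral A w), IsUnit (⟨w, hw⟩ : integralClosure A L) →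
        ∃ i, IsIntegral A i ∧ w * i = 1 := fun w hw hu => by
      obtain ⟨i, hi⟩ := hu.exists_right_inv
      exact ⟨i, i.2, congrArg Subtype.val hi⟩
    rcases IsLocalRing.isUnit_or_isUnit_of_add_one h1 with hu | hu
    · exact Or.inl (key _ _ hu)
    · exact Or.inr (key _ _ (by simpa using hu.neg))
  rcases hunit _ _ (hcint j hjn.le) (hxc j hjn) (by rw [hc j hjn, hj]; simp) with
    ⟨i, hi, hi1⟩ | ⟨i, hi, hi1⟩
  · left
    -- For `j = 0` the tail is the whole relation, so it vanishes and is no unit.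
    obtain _ | k := j
    · rw [show c 0 = 0 by simpa [c] using hx, zero_mul] at hi1
      exact absurd hi1 zero_ne_one
    · have := (hxc k (by omega)).mul hi
      rwa [mul_assoc, hi1, mul_one] at this
  · right
    rw [mul_assoc] at hi1
    rw [← eq_inv_of_mul_eq_one_right hi1]
    exact (hcint (j + 1) hjn).mul hi

/-- The maximal ideal of `B` contracts to the only maximal ideal of the integral closure. An
integral `x⁻¹` that is a unit of `B` avoids it, hence is already a unit there. -/
theorem Extends.isIntegral_of_mem [Algebra.IsAlgebraic K L] [IsLocalRing (integralClosure A L)]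
    (h : Extends A B) {x : L} (hx : x ∈ B) : IsIntegral A x := by
  by_cases hx0 : x = 0
  · rw [hx0]; exact isIntegral_zero
  rcases isIntegral_or_isIntegral_inv (A := A) x with h1 | h1
  · exact h1
  by_cases hu : IsUnit (⟨x⁻¹, h1⟩ : integralClosure A L)
  · obtain ⟨i, hi⟩ := hu.exists_right_inv
    have hi' : x⁻¹ * (i : L) = 1 := congrArg Subtype.val hi
    rw [← inv_inv x, ← eq_inv_of_mul_eq_one_right hi']
    exact i.2
  · exfalso
    -- the contraction of the maximal ideal of `B` is the maximal ideal of the integral closure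
    let g : integralClosure A L →+* B :=
      (integralClosure A L).toSubring.subtype.codRestrict B.toSubring
        fun y => h.mem_of_isIntegral y.2
    have hcomap : ((maximalIdeal B).comap g).comap (algebraMap A (integralClosure A L)) =
        maximalIdeal A := by
      ext a
      simp only [Ideal.mem_comap]
      rw [← ValuationSubring.coe_mem_nonunits_iff, ← ValuationSubring.coe_mem_nonunits_iff,
        ValuationSubring.mem_nonunits_iff, ValuationSubring.mem_nonunits_iff]
      exact h.valuation_lt_one_iff
    have hmax : ((maximalIdeal B).comap g).IsMaximal :=
      Ideal.isMaximal_of_isIntegral_of_isMaximal_comap (R := A) _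
        (by rw [hcomap]; exact maximalIdeal.isMaximal A)
    have hmem : (⟨x⁻¹, h1⟩ : integralClosure A L) ∈ (maximalIdeal B).comap g := by
      rw [eq_maximalIdeal hmax]
      exact hu
    have hu' : IsUnit (g ⟨x⁻¹, h1⟩) :=
      IsUnit.of_mul_eq_one ⟨x, hx⟩ (Subtype.ext (inv_mul_cancel₀ hx0))
    exact (mem_maximalIdeal _).mp (Ideal.mem_comap.mp hmem) hu'

theorem isLocalRing_integralClosure_of_isGalois [HenselianLocalRing A] [FiniteDimensional K L]
    [IsGalois K L] : IsLocalRing (integralClosure A L) := by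
  have : IsFractionRing (integralClosure A L) L :=
    integralClosure.isFractionRing_of_finite_extension K L
  let := IsIntegralClosure.MulSemiringAction A K L (integralClosure A L)
  have : Algebra.IsInvariant A (integralClosure A L) Gal(L/K) :=
    Algebra.isInvariant_of_isGalois A K L (integralClosure A L)
  have : SMulCommClass Gal(L/K) A (integralClosure A L) := ⟨fun g a s =>
    map_smul (galRestrict A K L (integralClosure A L) g) a s⟩
  have : FaithfulSMul A (integralClosure A L) := by
    rw [faithfulSMul_iff_algebraMap_injective]
    intro a b hab
    have := congrArg (Subtype.val : _ → L) hab
    exact Subtype.ext ((algebraMap K L).injective this)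
  exact isLocalRing_of_isInvariant (A := A) Gal(L/K)

theorem exists_isGalois_extension.{v, w} (K : Type v) (L : Type w) [Field K] [Field L] [Algebra K L]
    [FiniteDimensional K L] [Algebra.IsSeparable K L] :
    ∃ (N : Type w) (_ : Field N) (_ : Algebra K N) (_ : Algebra L N) (_ : IsScalarTower K L N),
      FiniteDimensional K N ∧ IsGalois K N := by
  have : Algebra.IsSeparable K (SeparableClosure L) := Algebra.IsSeparable.trans K L _
  have : IsSepClosure K (SeparableClosure L) := ⟨inferInstance, inferInstance⟩
  have : IsGalois K (SeparableClosure L) := IsSepClosure.isGalois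
  exact ⟨IntermediateField.normalClosure K L (SeparableClosure L), inferInstance, inferInstance,
    inferInstance, inferInstance, inferInstance, ⟨⟩⟩

/-- Locality descends from the Galois closure, because the inclusion of integral closures reflects
units. -/
theorem isLocalRing_integralClosure [HenselianLocalRing A] [FiniteDimensional K L]
    [Algebra.IsSeparable K L] : IsLocalRing (integralClosure A L) := by
  obtain ⟨N, _, _, _, _, _, _⟩ := exists_isGalois_extension K L
  have := isLocalRing_integralClosure_of_isGalois (A := A) (K := K) (L := N)
  have : IsScalarTower A L N := IsScalarTower.of_algebraMap_eq fun a => by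
    exact IsScalarTower.algebraMap_apply K L N a
  let f : integralClosure A L →+* integralClosure A N :=
    ((algebraMap L N).comp (integralClosure A L).toSubring.subtype).codRestrict
      (integralClosure A N).toSubring fun y =>
        IsIntegral.map (IsScalarTower.toAlgHom A L N) y.2
  have hf : IsLocalHom f := ⟨fun y hy => by
    obtain ⟨i, hi⟩ := hy.exists_right_inv
    have hi' : algebraMap L N y * (i : N) = 1 := congrArg Subtype.val hi
    have hy0 : (y : L) ≠ 0 := by
      intro h0; rw [h0] at hi'; simp at hi'
    have : algebraMap L N ((y : L)⁻¹) = i := by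
      rw [map_inv₀]; exact (eq_inv_of_mul_eq_one_right hi').symm
    have hint : IsIntegral A ((y : L)⁻¹) := by
      rw [← isIntegral_algebraMap_iff (algebraMap L N).injective, this]
      exact i.2
    exact IsUnit.of_mul_eq_one ⟨_, hint⟩ (Subtype.ext (mul_inv_cancel₀ hy0))⟩
  exact RingHom.domain_isLocalRing f

theorem Extends.mem_iff_isIntegral [HenselianLocalRing A] [FiniteDimensional K L]
    [Algebra.IsSeparable K L] (h : Extends A B) {x : L} : x ∈ B ↔ IsIntegral A x :=
  have := isLocalRing_integralClosure (A := A) (L := L)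
  ⟨h.isIntegral_of_mem, h.mem_of_isIntegral⟩

theorem exists_extends [HenselianLocalRing A] [FiniteDimensional K L]
    [Algebra.IsSeparable K L] : ∃ B : ValuationSubring L, Extends A B := by
  have := isLocalRing_integralClosure (A := A) (L := L)
  refine ⟨ValuationSubring.ofSubring (integralClosure A L).toSubring
    isIntegral_or_isIntegral_inv, ?_⟩
  ext x
  change IsIntegral A (algebraMap K L x) ↔ _
  rw [isIntegral_algebraMap_iff (algebraMap K L).injective]
  constructor
  · intro hx
    obtain ⟨y, hy⟩ := (IsIntegrallyClosed.isIntegral_iff (R := A) (K := K)).mp hx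
    rw [← hy]; exact y.2
  · intro hx
    exact isIntegral_algebraMap (R := A) (A := K) (x := ⟨x, hx⟩)

theorem isIntegral_inv_of_coeff_zero {x : L} (hx : IsIntegral A x)
    (hu : A.valuation ((minpoly K x).coeff 0) = 1) : IsIntegral A x⁻¹ := by
  rw [minpoly.isIntegrallyClosed_eq_field_fractions' K hx, coeff_map] at hu
  obtain ⟨i, hi⟩ := ((A.valuation_eq_one_iff _).mpr hu).exists_right_inv
  have h0 : aeval x (minpoly A x) = 0 := minpoly.aeval A x
  rw [← divX_mul_X_add (minpoly A x), map_add, map_mul, aeval_X, aeval_C] at h0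
  have h1 : x * (-(aeval x (minpoly A x).divX * algebraMap A L i)) = 1 := by
    have h2 : algebraMap A L ((minpoly A x).coeff 0) * algebraMap A L i = 1 := by
      rw [← map_mul, hi, map_one]
    linear_combination (-algebraMap A L i) * h0 + h2
  rw [← eq_inv_of_mul_eq_one_right h1]
  refine (IsIntegral.mul ?_ isIntegral_algebraMap).neg
  rw [aeval_eq_sum_range]
  exact IsIntegral.sum _ fun j _ => (hx.pow j).smul _

/-- If `x ∉ B` then `x⁻¹` is integral, and an integral norm of `x` makes the norm of `x⁻¹` a unit.
The constant coefficient of its minimal polynomial is then a unit, so `x` is integral after all.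
This is what makes the extended valuation definable over `K`. -/
theorem Extends.mem_iff_norm_mem [HenselianLocalRing A] [FiniteDimensional K L]
    [Algebra.IsSeparable K L] (h : Extends A B) {x : L} : x ∈ B ↔ Algebra.norm K x ∈ A := by
  have hnorm : ∀ y ∈ B, Algebra.norm K y ∈ A := fun y hy => by
    have := Algebra.isIntegral_norm K (h.mem_iff_isIntegral.mp hy)
    obtain ⟨z, hz⟩ := (IsIntegrallyClosed.isIntegral_iff (R := A) (K := K)).mp this
    rw [← hz]; exact z.2
  refine ⟨hnorm x, fun hx => ?_⟩
  by_contra hxB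
  have hx0 : x ≠ 0 := by rintro rfl; exact hxB B.zero_mem
  have hxi := (B.mem_or_inv_mem x).resolve_left hxB
  have hint := h.mem_iff_isIntegral.mp hxi
  have h1 : A.valuation (Algebra.norm K x⁻¹) = 1 := by
    refine le_antisymm ((A.valuation_le_one_iff _).mpr (hnorm _ hxi)) ?_
    have h2 := (A.valuation_le_one_iff _).mpr hx
    have hn0 : Algebra.norm K x ≠ 0 := Algebra.norm_ne_zero_iff.mpr hx0
    rw [Algebra.norm_inv, map_inv₀]
    exact (one_le_inv₀ (by simpa [zero_lt_iff] using hn0)).mpr h2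
  have h2 := isIntegral_inv_of_coeff_zero hint (by
    rw [Algebra.norm_eq_norm_adjoin, map_pow] at h1
    have hpos : 0 < Module.finrank K⟮x⁻¹⟯ L := Module.finrank_pos
    have h3 := eq_one_of_pow_eq_one hpos.ne' h1
    have hi : IsIntegral K x⁻¹ := Algebra.IsIntegral.isIntegral _
    have h4 := Algebra.PowerBasis.norm_gen_eq_coeff_zero_minpoly (IntermediateField.adjoin.powerBasis hi)
    rw [IntermediateField.adjoin.powerBasis_gen, IntermediateField.minpoly_gen] at h4
    rw [h4, map_mul, map_pow, Valuation.map_neg, map_one, one_pow, one_mul] at h3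
    exact h3)
  rw [inv_inv] at h2
  exact hxB (h.mem_of_isIntegral h2)

theorem Extends.valuation_algEquiv [HenselianLocalRing A] [FiniteDimensional K L]
    [Algebra.IsSeparable K L] (h : Extends A B) (σ : L ≃ₐ[K] L) (x : L) :
    B.valuation (σ x) = B.valuation x := by
  by_cases hx0 : x = 0
  · rw [hx0, map_zero]
  have hv0 : B.valuation x ≠ 0 := by simpa using hx0
  have hs0 : σ x ≠ 0 := by simpa using hx0
  have hn0 : Algebra.norm K x ≠ 0 := Algebra.norm_ne_zero_iff.mpr hx0
  have hq : ∀ y z : L, y ≠ 0 → z ≠ 0 → Algebra.norm K y = Algebra.norm K z →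
      B.valuation y ≤ B.valuation z := fun y z hy hz hyz => by
    rw [← div_le_one₀ (by simpa [zero_lt_iff] using hz), ← map_div₀,
      ValuationSubring.valuation_le_one_iff, h.mem_iff_norm_mem, div_eq_mul_inv, map_mul,
      Algebra.norm_inv, hyz, mul_inv_cancel₀ (Algebra.norm_ne_zero_iff.mpr hz)]
    exact one_mem _
  have hnorm := Algebra.norm_eq_of_algEquiv σ x
  exact le_antisymm (hq _ _ hs0 hx0 hnorm) (hq _ _ hx0 hs0 hnorm.symm)

end Integral

/-! ### The fundamental inequality and multiplicativity of `e` and `f` -/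

section Fundamental

variable {K L N : Type*} [Field K] [Field L] [Field N] [Algebra K L] [Algebra L N] [Algebra K N]
  [IsScalarTower K L N] {A : ValuationSubring K} {B : ValuationSubring L} {C : ValuationSubring N}

theorem Extends.residueMap_residue (h : Extends A B) (a : A) :
    h.residueMap (residue A a) = residue B (h.ringMap a) := rfl

/-- The residue field of `B` as an algebra over that of `A`. -/
noncomputable abbrev Extends.residueAlgebra (h : Extends A B) :
    Algebra (ResidueField A) (ResidueField B) := h.residueMap.toAlgebra

theorem mem_valueSubgroup {g : (B.ValueGroup)ˣ} :
    g ∈ valueSubgroup K B ↔ ∃ c : K, c ≠ 0 ∧ B.valuation (algebraMap K L c) = g := by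
  constructor
  · rintro ⟨c, rfl⟩
    exact ⟨c, c.ne_zero, rfl⟩
  · rintro ⟨c, hc, h⟩
    exact ⟨Units.mk0 c hc, Units.ext h⟩

/-- After division by the coefficient of largest value the sum has nonzero residue, by independence
of the residues of the `y j`. -/
theorem Extends.exists_valuation_sum_eq (h : Extends A B) {κ : Type*} [Fintype κ] (y : κ → B)
    (hy : letI := h.residueAlgebra
      LinearIndependent (ResidueField A) fun j => residue B (y j))
    (c : κ → K) (hc : c ≠ 0) :
    ∃ j, c j ≠ 0 ∧
      B.valuation (∑ j, algebraMap K L (c j) * y j) = B.valuation (algebraMap K L (c j)) := by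
  classical
  obtain ⟨j₁, hj₁⟩ := Function.ne_iff.mp hc
  obtain ⟨j, -, hj⟩ := Finset.exists_max_image Finset.univ (fun j => A.valuation (c j))
    ⟨j₁, Finset.mem_univ _⟩
  have hj0 : c j ≠ 0 := by
    intro h0
    have := hj j₁ (Finset.mem_univ _)
    simp [h0] at this
    exact hj₁ this
  refine ⟨j, hj0, ?_⟩
  have ha : ∀ i, c i / c j ∈ A := fun i => by
    rw [← ValuationSubring.valuation_le_one_iff, map_div₀]
    exact div_le_one_of_le₀ (hj i (Finset.mem_univ _)) zero_le
  let a : κ → A := fun i => ⟨c i / c j, ha i⟩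
  let s : B := ∑ i, h.ringMap (a i) * y i
  have hs : residue B s ≠ 0 := by
    intro h0
    let := h.residueAlgebra
    have h1 : ∑ i, residue A (a i) • residue B (y i) = 0 := by
      rw [← h0]
      simp only [s, map_sum, map_mul, Algebra.smul_def]
      rfl
    have h2 := Fintype.linearIndependent_iff.mp hy _ h1 j
    have h3 : a j = 1 := Subtype.ext (div_self hj0)
    rw [h3, map_one] at h2
    exact one_ne_zero h2
  have hs1 : B.valuation s = 1 :=
    (B.valuation_eq_one_iff s).mp (by rwa [← residue_ne_zero_iff_isUnit])
  have hcj : algebraMap K L (c j) ≠ 0 := by simpa using hj0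
  have h4 : ∑ i, algebraMap K L (c i) * y i = algebraMap K L (c j) * s := by
    have : (s : L) = ∑ i, algebraMap K L (c i / c j) * y i := by
      change B.subtype s = _
      simp only [s, map_sum, map_mul]
      rfl
    rw [this, Finset.mul_sum]
    refine Finset.sum_congr rfl fun i _ => ?_
    rw [map_div₀]; field_simp
  rw [h4, map_mul, hs1, mul_one]

theorem sum_ne_zero_of_valuation_injective {κ : Type*} [Fintype κ] (x : κ → L)
    (hx : ∀ i j, x i ≠ 0 → B.valuation (x i) = B.valuation (x j) → i = j)
    (h0 : ∃ i, x i ≠ 0) : ∑ i, x i ≠ 0 := by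
  classical
  obtain ⟨i₁, hi₁⟩ := h0
  obtain ⟨i, -, hi⟩ := Finset.exists_max_image Finset.univ (fun j => B.valuation (x j))
    ⟨i₁, Finset.mem_univ _⟩
  have hi0 : x i ≠ 0 := by
    intro h0
    have := hi i₁ (Finset.mem_univ _)
    simp [h0] at this
    exact hi₁ this
  intro hsum
  rw [← Finset.add_sum_erase _ _ (Finset.mem_univ i)] at hsum
  have hlt : B.valuation (∑ j ∈ Finset.univ.erase i, x j) < B.valuation (x i) :=
    Valuation.map_sum_lt _ (by simpa using hi0) fun j hj =>
      lt_of_le_of_ne (hi j (Finset.mem_univ _)) fun he =>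
        Finset.ne_of_mem_erase hj (hx i j hi0 he.symm).symm
  rw [eq_neg_of_add_eq_zero_right hsum, Valuation.map_neg] at hlt
  exact lt_irrefl _ hlt

/-- For fixed `i` the inner sum has the value of an element of `K`, so different `i` contribute
values in different cosets and cannot cancel. -/
theorem Extends.linearIndependent_mul (h : Extends A B) {ι κ : Type*} [Fintype ι] [Fintype κ]
    (x : ι → L) (hx0 : ∀ i, x i ≠ 0)
    (hx : ∀ i j, ∀ c : K, c ≠ 0 → B.valuation (x i) = B.valuation (algebraMap K L c * x j) → i = j)
    (y : κ → B)
    (hy : letI := h.residueAlgebra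
      LinearIndependent (ResidueField A) fun j => residue B (y j)) :
    LinearIndependent K fun q : ι × κ => x q.1 * (y q.2 : L) := by
  rw [Fintype.linearIndependent_iff]
  intro c hc
  rw [Fintype.sum_prod_type] at hc
  have h1 : ∀ i, ∑ j, c (i, j) • (x i * (y j : L)) =
      x i * ∑ j, algebraMap K L (c (i, j)) * y j := fun i => by
    rw [Finset.mul_sum]
    refine Finset.sum_congr rfl fun j _ => ?_
    rw [Algebra.smul_def]; ring
  simp only [h1] at hc
  by_contra! hne
  obtain ⟨⟨i₀, j₀⟩, hij⟩ := hne
  have key : ∀ i, x i * ∑ j, algebraMap K L (c (i, j)) * y j ≠ 0 →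
      ∃ d : K, d ≠ 0 ∧ B.valuation (x i * ∑ j, algebraMap K L (c (i, j)) * y j) =
        B.valuation (algebraMap K L d * x i) := fun i hi => by
    have hci : (fun j => c (i, j)) ≠ 0 := by
      intro h0
      apply hi
      have : ∀ j, c (i, j) = 0 := fun j => congrFun h0 j
      simp [this]
    obtain ⟨j, hj, hv⟩ := h.exists_valuation_sum_eq y hy _ hci
    exact ⟨c (i, j), hj, by rw [map_mul, map_mul, hv, mul_comm]⟩
  refine sum_ne_zero_of_valuation_injective (B := B) _ ?_ ⟨i₀, ?_⟩ hc
  · intro i j hi hv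
    obtain ⟨d, hd, h2⟩ := key i hi
    have hj : x j * ∑ k, algebraMap K L (c (j, k)) * y k ≠ 0 := by
      intro h0
      rw [h0, map_zero] at hv
      exact hi ((map_eq_zero _).mp hv)
    obtain ⟨d', hd', h3⟩ := key j hj
    have hd0 : B.valuation (algebraMap K L d) ≠ 0 := by simpa using hd
    refine hx i j (d' / d) (div_ne_zero hd' hd) ?_
    rw [h2, h3, map_mul, map_mul] at hv
    rw [map_mul, map_div₀, map_div₀, div_mul_eq_mul_div, eq_div_iff hd0, mul_comm, hv]
  · have hci : (fun j => c (i₀, j)) ≠ 0 := fun h0 => hij (congrFun h0 j₀)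
    obtain ⟨j, hj, hv⟩ := h.exists_valuation_sum_eq y hy _ hci
    intro h0
    rcases mul_eq_zero.mp h0 with h0 | h0
    · exact hx0 _ h0
    · rw [h0, map_zero] at hv
      exact hj (by simpa using hv.symm)

/-- The fundamental inequality. -/
theorem Extends.fundamental_inequality [FiniteDimensional K L] (h : Extends A B) :
    ramificationIndex K B ≠ 0 ∧
    @FiniteDimensional (ResidueField A) (ResidueField B) _ _ h.residueAlgebra.toModule ∧
    ramificationIndex K B * h.inertiaDegree ≤ Module.finrank K L := by
  classical
  let := h.residueAlgebra
  let Q := (B.ValueGroup)ˣ ⧸ valueSubgroup K B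
  have hx : ∀ q : Q, ∃ x : L, x ≠ 0 ∧ B.valuation x = ((Quotient.out q : (B.ValueGroup)ˣ)) := by
    intro q
    obtain ⟨x, hx⟩ := B.valuation_surjective ((Quotient.out q : (B.ValueGroup)ˣ))
    exact ⟨x, fun h0 => by rw [h0, map_zero] at hx; exact (Units.ne_zero _ hx.symm), hx⟩
  choose x hx0 hx using hx
  have hxx : ∀ i j, ∀ c : K, c ≠ 0 →
      B.valuation (x i) = B.valuation (algebraMap K L c * x j) → i = j := by
    intro i j c hc hv
    rw [map_mul, hx, hx] at hv
    rw [← Quotient.out_eq i, ← Quotient.out_eq j, eq_comm]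
    refine QuotientGroup.eq.mpr (mem_valueSubgroup.mpr ⟨c, hc, ?_⟩)
    rw [Units.val_mul, hv, Units.val_inv_eq_inv_val, mul_comm, mul_assoc,
      mul_inv_cancel₀ (Units.ne_zero _), mul_one]
  -- Stated for finite families, since finiteness of the index and of the residue degree is itself
  -- deduced from this bound.
  have key : ∀ (s : Finset Q) (m : ℕ) (y : Fin m → B),
      (LinearIndependent (ResidueField A) fun j => residue B (y j)) →
      s.card * m ≤ Module.finrank K L := by
    intro s m y hy
    have h1 := h.linearIndependent_mul (fun i : s => x i) (fun i => hx0 i)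
      (fun i j c hc hv => Subtype.ext (hxx i j c hc hv)) y hy
    have := h1.fintype_card_le_finrank
    simpa using this
  have h1 : ∀ s : Finset Q, s.card ≤ Module.finrank K L := fun s => by
    have := key s 1 (fun _ => 1) (by
      rw [linearIndependent_unique_iff]
      simp)
    simpa using this
  have hQ : Finite Q := by
    by_contra hn
    have : Infinite Q := not_finite_iff_infinite.mp hn
    obtain ⟨s, hs⟩ := Infinite.exists_subset_card_eq Q (Module.finrank K L + 1)
    have := h1 s
    omega
  have hfin : FiniteDimensional (ResidueField A) (ResidueField B) := by
    have h2 : Module.rank (ResidueField A) (ResidueField B) ≤ (Module.finrank K L : ℕ) := by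
      refine rank_le fun s hs => ?_
      choose y hy using fun i : Fin s.card => residue_surjective (R := B) (s.equivFin.symm i : _)
      have h3 : LinearIndependent (ResidueField A) fun j => residue B (y j) := by
        simp only [hy]
        exact hs.comp _ s.equivFin.symm.injective
      have := key {QuotientGroup.mk 1} s.card y h3
      simpa using this
    exact Module.rank_lt_aleph0_iff.mp (lt_of_le_of_lt h2 Cardinal.natCast_lt_aleph0)
  refine ⟨?_, hfin, ?_⟩
  · exact Subgroup.index_ne_zero_of_finite
  · have := Fintype.ofFinite Q
    let b := Module.finBasis (ResidueField A) (ResidueField B)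
    choose y hy using fun i => residue_surjective (R := B) (b i)
    have := key Finset.univ _ y (by simp only [hy]; exact b.linearIndependent)
    rw [Finset.card_univ, ← Nat.card_eq_fintype_card] at this
    exact this

/-- All indices are read off from the image of `Kˣ` in `Lˣ`: the two valuations have the same kernel
on `Lˣ`, and that of `B` is onto its value group. -/
theorem ramificationIndex_mul (h' : Extends B C) :
    ramificationIndex K C = ramificationIndex K B * ramificationIndex L C := by
  let R : Subgroup Lˣ := (Units.map (algebraMap K L : K →* L)).range
  let vB : Lˣ →* (B.ValueGroup)ˣ := Units.map (B.valuation.toMonoidWithZeroHom : L →* B.ValueGroup)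
  let vC : Lˣ →* (C.ValueGroup)ˣ :=
    (Units.map (C.valuation.toMonoidWithZeroHom : N →* C.ValueGroup)).comp
      (Units.map (algebraMap L N : L →* N))
  have hB : valueSubgroup K B = R.map vB := (MonoidHom.range_comp _ _)
  have hC : valueSubgroup K C = R.map vC := by
    rw [← MonoidHom.range_comp]
    unfold valueSubgroup
    congr 1
    ext x
    change C.valuation (algebraMap K N x) = C.valuation (algebraMap L N (algebraMap K L x))
    rw [← IsScalarTower.algebraMap_apply]
  have hker : vB.ker = vC.ker := by
    ext x
    rw [MonoidHom.mem_ker, MonoidHom.mem_ker, Units.ext_iff, Units.ext_iff]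
    change B.valuation (x : L) = 1 ↔ C.valuation (algebraMap L N x) = 1
    have h1 := h'.valuation_le_iff (x := (x : L)) (y := 1)
    have h2 := h'.valuation_le_iff (x := 1) (y := (x : L))
    simp only [map_one] at h1 h2
    rw [le_antisymm_iff, le_antisymm_iff, h1, h2]
  have hrange : vB.range = ⊤ := by
    rw [MonoidHom.range_eq_top]
    intro g
    obtain ⟨x, hx⟩ := B.valuation_surjective (g : B.ValueGroup)
    have hx0 : x ≠ 0 := by
      rintro rfl
      rw [map_zero] at hx
      exact g.ne_zero hx.symm
    exact ⟨Units.mk0 x hx0, Units.ext hx⟩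
  change (valueSubgroup K C).index = (valueSubgroup K B).index * vC.range.index
  rw [hB, hC, Subgroup.index_map, Subgroup.index_map, hker, hrange, Subgroup.index_top, mul_one]

theorem inertiaDegree_mul (h : Extends A B) (h' : Extends B C) (h'' : Extends A C) :
    h''.inertiaDegree = h.inertiaDegree * h'.inertiaDegree := by
  let := h.residueAlgebra
  let := h'.residueAlgebra
  let := h''.residueAlgebra
  have : IsScalarTower (ResidueField A) (ResidueField B) (ResidueField C) := by
    refine IsScalarTower.of_algebraMap_eq fun x => ?_
    obtain ⟨a, rfl⟩ := residue_surjective x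
    change residue C (h''.ringMap a) = residue C (h'.ringMap (h.ringMap a))
    congr 1
    exact Subtype.ext (IsScalarTower.algebraMap_apply K L N a)
  exact (Module.finrank_mul_finrank (ResidueField A) (ResidueField B) (ResidueField C)).symm

/-- A subextension of a defectless extension is defectless. -/
theorem Extends.finrank_eq_of_le [FiniteDimensional K N] (h : Extends A B) (h' : Extends B C)
    (h'' : Extends A C) (hle : Module.finrank K N ≤ ramificationIndex K C * h''.inertiaDegree) :
    Module.finrank K L = ramificationIndex K B * h.inertiaDegree := by
  have : FiniteDimensional K L := FiniteDimensional.left K L N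
  have : FiniteDimensional L N := FiniteDimensional.right K L N
  refine le_antisymm ?_ h.fundamental_inequality.2.2
  have h1 := h'.fundamental_inequality.2.2
  rw [ramificationIndex_mul h', inertiaDegree_mul h h' h'', ← Module.finrank_mul_finrank K L N,
    mul_mul_mul_comm] at hle
  have h2 : 0 < Module.finrank L N := Module.finrank_pos
  exact Nat.le_of_mul_le_mul_right (hle.trans (Nat.mul_le_mul_left _ h1)) h2

end Fundamental

/-! ### The ramification group and leading terms -/

section Ramification

variable {K N : Type*} [Field K] [Field N] [Algebra K N] {B : ValuationSubring N}

variable (K) in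
/-- The valuation of `B` is invariant under all `K`-automorphisms. -/
def GaloisInvariant (B : ValuationSubring N) : Prop :=
  ∀ (σ : Gal(N/K)) (x : N), B.valuation (σ x) = B.valuation x

theorem GaloisInvariant.mem_iff (hB : GaloisInvariant K B) (σ : Gal(N/K)) {x : N} :
    σ x ∈ B ↔ x ∈ B := by
  rw [← B.valuation_le_one_iff, hB, B.valuation_le_one_iff]

/-- The group of automorphisms acting trivially on the leading terms `N^× / (1 + 𝔪)`. -/
def ramificationGroup (hB : GaloisInvariant K B) : Subgroup Gal(N/K) where
  carrier := {σ | ∀ x : N, x ≠ 0 → B.valuation (σ x - x) < B.valuation x}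
  mul_mem' := by
    intro σ τ hσ hτ x hx
    have h1 : (σ * τ) x - x = σ (τ x - x) + (σ x - x) := by
      rw [map_sub, AlgEquiv.mul_apply]; ring
    rw [h1]
    refine Valuation.map_add_lt _ ?_ (hσ x hx)
    rw [hB]
    exact hτ x hx
  one_mem' := by
    intro x hx
    rw [AlgEquiv.one_apply, sub_self, map_zero]
    simpa [zero_lt_iff] using hx
  inv_mem' := by
    intro σ hσ x hx
    have h1 : σ⁻¹ x - x = σ⁻¹ (-(σ x - x)) := by
      rw [map_neg, map_sub, ← AlgEquiv.mul_apply, inv_mul_cancel, AlgEquiv.one_apply]; ring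
    rw [h1, hB, Valuation.map_neg]
    exact hσ x hx

instance ramificationGroup_normal (hB : GaloisInvariant K B) : (ramificationGroup hB).Normal := by
  refine ⟨fun σ hσ τ x hx => ?_⟩
  have h1 : (τ * σ * τ⁻¹) x - x = τ (σ (τ⁻¹ x) - τ⁻¹ x) := by
    rw [map_sub, AlgEquiv.mul_apply, AlgEquiv.mul_apply, ← AlgEquiv.mul_apply τ τ⁻¹ x,
      mul_inv_cancel, AlgEquiv.one_apply]
  rw [h1, hB, ← hB τ⁻¹ x]
  exact hσ _ (by simpa using hx)

/-- By Fermat, `n ^ (p - 1) = 1` in characteristic `p`. -/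
theorem valuation_natCast_eq_one (p : ℕ) [Fact p.Prime] [CharP N p] {n : ℕ} (hn : ¬ p ∣ n) :
    B.valuation (n : N) = 1 := by
  have h0 : (n : N) ≠ 0 := fun h => hn ((CharP.cast_eq_zero_iff N p n).mp h)
  have hp : (n : N) ^ (p - 1) = 1 := by
    have h1 : ((n : ZMod p)) ≠ 0 := fun h => hn ((ZMod.natCast_eq_zero_iff n p).mp h)
    have h2 := congrArg (ZMod.castHom (dvd_refl p) N) (ZMod.pow_card_sub_one_eq_one h1)
    simpa using h2
  refine eq_one_of_pow_eq_one (n := p - 1) ?_ (by rw [← map_pow, hp, map_one])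
  have := (Fact.out : p.Prime).two_le
  omega

/-- Let `σ` in the group have prime order `ℓ ≠ p`. The orbit sum of `x = σ z - z` telescopes to
zero, while every `σⁱ x` has the leading term of `x`. So `ℓ x` has smaller valuation than `x`,
although `ℓ` has valuation one. -/
theorem isPGroup_ramificationGroup [FiniteDimensional K N] (p : ℕ) [Fact p.Prime] [CharP N p]
    (hB : GaloisInvariant K B) : ∃ r, Nat.card (ramificationGroup hB) = p ^ r := by
  refine ⟨_, Nat.eq_prime_pow_of_unique_prime_dvd Nat.card_pos.ne' fun {ℓ} hℓ hdvd => ?_⟩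
  have : Fact ℓ.Prime := ⟨hℓ⟩
  obtain ⟨⟨σ, hσ⟩, hord⟩ := exists_prime_orderOf_dvd_card' ℓ hdvd
  rw [Subgroup.orderOf_mk] at hord
  by_contra hne
  have h1 : σ ≠ 1 := by
    rintro rfl
    rw [orderOf_one] at hord
    exact hℓ.one_lt.ne hord
  obtain ⟨z, hz⟩ : ∃ z, σ z ≠ z := by
    by_contra! h
    exact h1 (AlgEquiv.ext h)
  set x := σ z - z with hx
  have hx0 : x ≠ 0 := sub_ne_zero.mpr hz
  have hsum : ∑ i ∈ Finset.range ℓ, (σ ^ i) x = 0 := by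
    have h2 : ∀ i, (σ ^ i) x = (σ ^ (i + 1)) z - (σ ^ i) z := fun i => by
      rw [hx, map_sub, pow_succ, AlgEquiv.mul_apply]
    simp only [h2]
    rw [Finset.sum_range_sub (fun i => (σ ^ i) z), ← hord, pow_orderOf_eq_one]
    simp
  have h3 : (ℓ : N) * x = - ∑ i ∈ Finset.range ℓ, ((σ ^ i) x - x) := by
    rw [Finset.sum_sub_distrib, hsum]
    simp
  have h4 : B.valuation ((ℓ : N) * x) < B.valuation x := by
    rw [h3, Valuation.map_neg]
    exact Valuation.map_sum_lt _ (by simpa using hx0) fun i _ => pow_mem hσ i x hx0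
  rw [map_mul, valuation_natCast_eq_one p, one_mul] at h4
  · exact lt_irrefl _ h4
  · intro h
    exact hne ((Nat.prime_dvd_prime_iff_eq Fact.out hℓ).mp h).symm

/-- Every nonzero element of `N` has the same leading term as an element of `E`. -/
def DenseLeadingTerms (B : ValuationSubring N) (E : Set N) : Prop :=
  ∀ x : N, x ≠ 0 → ∃ e ∈ E, B.valuation (x - e) < B.valuation x

theorem valuation_eq_of_sub_lt {x e : N} (h : B.valuation (x - e) < B.valuation x) :
    B.valuation e = B.valuation x := by
  have := Valuation.map_sub_eq_of_lt_right (v := B.valuation) (x := x - e) (y := x) h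
  rw [sub_sub_cancel_left, Valuation.map_neg] at this
  exact this

theorem valuation_prod_sub_pow_lt {ι : Type*} (s : Finset ι) (f : ι → N) {x : N} (hx : x ≠ 0)
    (h : ∀ i ∈ s, B.valuation (f i - x) < B.valuation x) :
    B.valuation (∏ i ∈ s, f i - x ^ s.card) < B.valuation (x ^ s.card) := by
  classical
  induction s using Finset.induction_on with
  | empty => simp
  | insert a s ha ih =>
    have ih' := ih fun i hi => h i (Finset.mem_insert_of_mem hi)
    have ha' := h a (Finset.mem_insert_self a s)
    rw [Finset.prod_insert ha, Finset.card_insert_of_notMem ha, pow_succ]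
    have h1 : f a * ∏ i ∈ s, f i - x ^ s.card * x =
        f a * (∏ i ∈ s, f i - x ^ s.card) + (f a - x) * x ^ s.card := by ring
    have h2 : B.valuation (f a) = B.valuation x := by
      rw [Valuation.map_sub_swap] at ha'
      exact valuation_eq_of_sub_lt ha'
    have hx0 : 0 < B.valuation x := by simpa [zero_lt_iff] using hx
    rw [h1, map_mul _ (x ^ _), mul_comm (B.valuation (x ^ _))]
    refine Valuation.map_add_lt _ ?_ ?_
    · rw [map_mul, h2]
      exact mul_lt_mul_of_pos_left ih' hx0
    · rw [map_mul]
      exact mul_lt_mul_of_pos_right ha' (by rw [map_pow]; exact pow_pos hx0 _)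

theorem exists_sub_pow_lt (p : ℕ) [Fact p.Prime] [CharP N p] {E : Set N}
    (hE : ∀ y ∈ E, y ≠ 0 → ∃ c ∈ E, B.valuation (y - c ^ p) < B.valuation y) (r : ℕ) :
    ∀ y ∈ E, y ≠ 0 → ∃ c ∈ E, B.valuation (y - c ^ p ^ r) < B.valuation y := by
  induction r with
  | zero =>
    intro y hy hy0
    refine ⟨y, hy, ?_⟩
    simpa [zero_lt_iff] using hy0
  | succ r ih =>
    intro y hy hy0
    obtain ⟨c, hc, h1⟩ := hE y hy hy0
    have hv := valuation_eq_of_sub_lt h1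
    have hp := (Fact.out : p.Prime).ne_zero
    have hc0 : c ≠ 0 := by
      rintro rfl
      rw [zero_pow hp, map_zero] at hv
      exact hy0 ((map_eq_zero _).mp hv.symm)
    obtain ⟨d, hd, h2⟩ := ih c hc hc0
    refine ⟨d, hd, ?_⟩
    have h3 : y - d ^ p ^ (r + 1) = (y - c ^ p) + (c - d ^ p ^ r) ^ p := by
      rw [sub_pow_char, ← pow_mul, ← pow_succ]; ring
    rw [h3]
    refine Valuation.map_add_lt _ h1 ?_
    rw [← hv, map_pow, map_pow]
    exact pow_lt_pow_left₀ h2 zero_le hp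

/-- The product of the conjugates of `x` under the ramification group, of order `p ^ r`, is fixed
and has the leading term of `x ^ p ^ r`. It is also approximated by some `c ^ p ^ r` with `c` fixed.
As Frobenius is additive, `(x - c) ^ p ^ r` is small, hence so is `x - c`. -/
theorem denseLeadingTerms_fixedField [FiniteDimensional K N] (p : ℕ) [Fact p.Prime] [CharP N p]
    (hB : GaloisInvariant K B)
    (hE : ∀ y ∈ IntermediateField.fixedField (ramificationGroup hB), y ≠ 0 →
      ∃ c ∈ IntermediateField.fixedField (ramificationGroup hB),
        B.valuation (y - c ^ p) < B.valuation y) :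
    DenseLeadingTerms B (IntermediateField.fixedField (ramificationGroup hB)) := by
  classical
  intro x hx
  obtain ⟨r, hr⟩ := isPGroup_ramificationGroup p hB
  have := Fintype.ofFinite (ramificationGroup hB)
  set y : N := ∏ σ : ramificationGroup hB, (σ : Gal(N/K)) x with hy
  have hyE : y ∈ IntermediateField.fixedField (ramificationGroup hB) := by
    rintro ⟨τ, hτ⟩
    change τ y = y
    rw [hy, map_prod]
    exact Fintype.prod_equiv (Equiv.mulLeft ⟨τ, hτ⟩) _ _ fun σ => rfl
  have h1 := valuation_prod_sub_pow_lt (B := B) Finset.univ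
    (fun σ : ramificationGroup hB => (σ : Gal(N/K)) x) hx (fun σ _ => σ.2 x hx)
  rw [Finset.card_univ, ← Nat.card_eq_fintype_card, hr, ← hy, Valuation.map_sub_swap] at h1
  have h2 := valuation_eq_of_sub_lt h1
  have hq : p ^ r ≠ 0 := pow_ne_zero _ (Fact.out : p.Prime).ne_zero
  have hy0 : y ≠ 0 := by
    intro h0
    rw [h0, map_zero] at h2
    exact hx ((pow_eq_zero_iff hq).mp ((map_eq_zero _).mp h2.symm))
  obtain ⟨c, hc, h3⟩ := exists_sub_pow_lt (B := B) p
    (E := IntermediateField.fixedField (ramificationGroup hB)) hE r y hyE hy0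
  refine ⟨c, hc, ?_⟩
  rw [h2] at h3
  have h4 := Valuation.map_add_lt _ h1 h3
  rw [sub_add_sub_cancel, ← sub_pow_char_pow, map_pow, map_pow] at h4
  exact lt_of_pow_lt_pow_left₀ _ zero_le h4

end Ramification

/-! ### Galois action on the residue field; integral elements of trace one -/

section ResidueAction

variable {K N : Type*} [Field K] [Field N] [Algebra K N] {B : ValuationSubring N}

/-- The action of an automorphism on an invariant valuation ring. -/
def GaloisInvariant.ringHom (hB : GaloisInvariant K B) (σ : Gal(N/K)) : B →+* B :=
  ((σ : N →+* N).comp B.subtype).codRestrict B.toSubring fun x => (hB.mem_iff σ).mpr x.2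

theorem GaloisInvariant.isLocalHom (hB : GaloisInvariant K B) (σ : Gal(N/K)) :
    IsLocalHom (hB.ringHom σ) := ⟨fun x hx => by
  rw [B.valuation_eq_one_iff] at hx ⊢
  rw [← hx]
  exact (hB σ x).symm⟩

/-- The action of the Galois group on the residue field. -/
noncomputable def GaloisInvariant.residueAction (hB : GaloisInvariant K B) :
    Gal(N/K) →* (ResidueField B →+* ResidueField B) where
  toFun σ := haveI := hB.isLocalHom σ; ResidueField.map (hB.ringHom σ)
  map_one' := by
    ext x
    obtain ⟨b, rfl⟩ := residue_surjective x
    rfl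
  map_mul' σ τ := by
    ext x
    obtain ⟨b, rfl⟩ := residue_surjective x
    rfl

theorem GaloisInvariant.residueAction_residue (hB : GaloisInvariant K B) (σ : Gal(N/K)) (b : B) :
    hB.residueAction σ (residue B b) = residue B (hB.ringHom σ b) := rfl

theorem residue_eq_residue_iff {b c : B} :
    residue B b = residue B c ↔ B.valuation ((b : N) - c) < 1 := by
  rw [← sub_eq_zero, ← map_sub, residue_eq_zero_iff, B.valuation_lt_one_iff]
  rfl

theorem prod_range_div_of_ne_zero {F : Type*} [Field F] (f : ℕ → F) (hf : ∀ i, f i ≠ 0) (n : ℕ) :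
    ∏ i ∈ Finset.range n, f (i + 1) / f i = f n / f 0 := by
  induction n with
  | zero => simp [hf 0]
  | succ n ih =>
    rw [Finset.prod_range_succ, ih, mul_comm, div_mul_div_cancel₀ (hf n)]

/-- For inertial `σ` the quotient `σ x / x` has a `σ`-fixed residue, and its product over the powers
of `σ` telescopes to one. That residue is a `p`-th root of unity in characteristic `p`, hence equals
one. -/
theorem mem_ramificationGroup_of_pow_eq_one (p : ℕ) [Fact p.Prime] [CharP N p]
    (hB : GaloisInvariant K B) {σ : Gal(N/K)} (hσ : σ ∈ hB.residueAction.ker) (hp : σ ^ p = 1) :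
    σ ∈ ramificationGroup hB := by
  intro x hx
  have hx0 : B.valuation x ≠ 0 := by simpa using hx
  have hσx : ∀ i : ℕ, (σ ^ i) x ≠ 0 := fun i =>
    (map_ne_zero_iff _ (σ ^ i).injective).mpr hx
  have hcB : σ x / x ∈ B := by
    rw [← B.valuation_le_one_iff, map_div₀, hB, div_self hx0]
  let c : B := ⟨σ x / x, hcB⟩
  have hker : ∀ i : ℕ, residue B (hB.ringHom (σ ^ i) c) = residue B c := fun i => by
    rw [← hB.residueAction_residue, MonoidHom.mem_ker.mp (pow_mem hσ i)]
    rfl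
  have hprod : ∏ i ∈ Finset.range p, hB.ringHom (σ ^ i) c = 1 := by
    apply Subtype.ext
    change B.subtype _ = 1
    rw [map_prod]
    have h1 : ∀ i, B.subtype (hB.ringHom (σ ^ i) c) = (σ ^ (i + 1)) x / (σ ^ i) x := fun i => by
      change (σ ^ i) (σ x / x) = _
      rw [map_div₀, pow_succ, AlgEquiv.mul_apply]
    simp only [h1]
    rw [prod_range_div_of_ne_zero (fun i => (σ ^ i) x) hσx, hp]
    simp [hx]
  have h2 : residue B c ^ p = 1 := by
    have := congrArg (residue B) hprod
    rw [map_prod, map_one] at this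
    simpa [hker] using this
  have : CharP B p := (CharP.charP_iff_prime_eq_zero Fact.out).mpr (Subtype.ext (by simp))
  have : CharP (ResidueField B) p := (CharP.charP_iff_prime_eq_zero Fact.out).mpr (by
    rw [← map_natCast (residue B), CharP.cast_eq_zero B p, map_zero])
  have h3 : (residue B c - 1) ^ p = 0 := by rw [sub_pow_char, h2, one_pow, sub_self]
  have h4 : residue B c = residue B 1 := by
    rw [map_one]
    exact sub_eq_zero.mp ((pow_eq_zero_iff (Fact.out : p.Prime).ne_zero).mp h3)
  rw [residue_eq_residue_iff] at h4
  have h5 : σ x - x = (σ x / x - 1) * x := by field_simp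
  rw [h5, map_mul]
  exact mul_lt_of_lt_one_left (zero_lt_iff.mpr hx0) h4

/-- The inertia group has order prime to `p`, since an element of order `p` would be wildly
ramified. Each automorphism of the residue field that occurs does so once per inertia element, so by
independence of characters the residual trace is not zero. Lift an element of nonzero trace and
divide by its trace. -/
theorem exists_trace_eq_one [FiniteDimensional K N] (p : ℕ) [Fact p.Prime] [CharP N p]
    (hB : GaloisInvariant K B) (hR : ramificationGroup hB = ⊥) :
    ∃ u ∈ B, ∑ σ : Gal(N/K), σ u = 1 := by
  classical
  let κ := ResidueField B
  have : CharP B p := (CharP.charP_iff_prime_eq_zero Fact.out).mpr (Subtype.ext (by simp))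
  have : CharP κ p := (CharP.charP_iff_prime_eq_zero Fact.out).mpr (by
    rw [← map_natCast (residue B), CharP.cast_eq_zero B p, map_zero])
  have hI : ¬ p ∣ Nat.card hB.residueAction.ker := fun hdvd => by
    obtain ⟨⟨σ, hσ⟩, hord⟩ := exists_prime_orderOf_dvd_card' p hdvd
    rw [Subgroup.orderOf_mk] at hord
    have := mem_ramificationGroup_of_pow_eq_one p hB hσ (hord ▸ pow_orderOf_eq_one σ)
    rw [hR, Subgroup.mem_bot] at this
    rw [this, orderOf_one] at hord
    exact (Fact.out : p.Prime).one_lt.ne hord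
  obtain ⟨x, hx⟩ : ∃ x : κ, ∑ σ : Gal(N/K), hB.residueAction σ x ≠ 0 := by
    by_contra! h
    let g : Gal(N/K) → (κ →* κ) := fun σ => (hB.residueAction σ : κ →* κ)
    have h1 : ∑ f ∈ Finset.univ.image g,
        ((Finset.univ.filter fun σ => g σ = f).card : κ) • (f : κ → κ) = 0 := by
      ext x
      have h2 := Finset.sum_comp (s := Finset.univ) (fun f : κ →* κ => f x) g
      have h3 := h x
      change ∑ σ, g σ x = 0 at h3
      rw [h3] at h2
      simp only [Finset.sum_apply, Pi.smul_apply, smul_eq_mul, Pi.zero_apply]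
      rw [h2]
      exact Finset.sum_congr rfl fun f _ => (nsmul_eq_mul _ _).symm
    have h2 := linearIndependent_iff'.mp (linearIndependent_monoidHom κ κ) _ _ h1 (g 1)
      (Finset.mem_image_of_mem _ (Finset.mem_univ _))
    have h3 : (Finset.univ.filter fun σ => g σ = g 1).card = Nat.card hB.residueAction.ker := by
      rw [Nat.card_eq_fintype_card, Fintype.card_subtype]
      congr 1
      ext σ
      simp only [Finset.mem_filter, Finset.mem_univ, true_and, MonoidHom.mem_ker]
      constructor
      · intro hσ
        rw [← map_one hB.residueAction]
        exact RingHom.ext fun x => DFunLike.congr_fun hσ x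
      · intro hσ
        simp only [g, hσ, map_one]
    rw [h3] at h2
    exact hI ((CharP.cast_eq_zero_iff κ p _).mp h2)
  obtain ⟨b, rfl⟩ := residue_surjective x
  have hs : ∑ σ : Gal(N/K), hB.residueAction σ (residue B b) =
      residue B (∑ σ : Gal(N/K), hB.ringHom σ b) := by
    rw [map_sum]; rfl
  rw [hs, residue_ne_zero_iff_isUnit, B.valuation_eq_one_iff] at hx
  set s : B := ∑ σ : Gal(N/K), hB.ringHom σ b with hsdef
  have hsN : (s : N) = ∑ σ : Gal(N/K), σ (b : N) := by
    change B.subtype s = _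
    rw [hsdef, map_sum]; rfl
  have hs0 : (s : N) ≠ 0 := by
    intro h0; rw [h0, map_zero] at hx; exact zero_ne_one hx
  refine ⟨b / s, ?_, ?_⟩
  · rw [← B.valuation_le_one_iff, map_div₀, hx, div_one, B.valuation_le_one_iff]
    exact b.2
  · have hfix : ∀ τ : Gal(N/K), τ (s : N) = s := fun τ => by
      rw [hsN, map_sum]
      exact Fintype.sum_equiv (Equiv.mulLeft τ) _ _ fun σ => rfl
    simp only [map_div₀, hfix]
    rw [← Finset.sum_div, ← hsN, div_self hs0]

end ResidueAction

/-! ### Trivial ramification group implies defectless -/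

section Defectless

variable {K N : Type*} [Field K] [Field N] [Algebra K N] {A : ValuationSubring K}
  {B : ValuationSubring N}

/-- For inertial `σ` the character `x ↦ σ x / x` modulo the maximal ideal is trivial on `Kˣ` and on
units, so it factors through the quotient of value groups. A trivial ramification group makes these
characters distinct, and independent characters number at most the order of the group on which they
live. -/
theorem card_ker_residueAction_le [FiniteDimensional K N] (h : Extends A B)
    (hB : GaloisInvariant K B) (hR : ramificationGroup hB = ⊥) :
    Nat.card hB.residueAction.ker ≤ ramificationIndex K B := by
  classical
  let κ := ResidueField B
  let Q := (B.ValueGroup)ˣ ⧸ valueSubgroup K B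
  have hQ : Finite Q := 
    (Subgroup.finiteIndex_iff_finite_quotient (H := valueSubgroup K B)).mp
      ⟨h.fundamental_inequality.1⟩
  have := Fintype.ofFinite Q
  let q : Nˣ → Q := fun x =>
    QuotientGroup.mk (Units.map (B.valuation.toMonoidWithZeroHom : N →* B.ValueGroup) x)
  have hmem : ∀ (σ : Gal(N/K)) (x : Nˣ), σ x / x ∈ B := fun σ x => by
    have hx0 : B.valuation (x : N) ≠ 0 := by simp
    rw [← B.valuation_le_one_iff, map_div₀, hB, div_self hx0]
  let χ : Gal(N/K) → (Nˣ →* κ) := fun σ =>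
    { toFun := fun x => residue B ⟨σ x / x, hmem σ x⟩
      map_one' := by
        rw [← map_one (residue B)]
        congr 1
        exact Subtype.ext (by simp)
      map_mul' := fun x y => by
        rw [← map_mul]
        congr 1
        exact Subtype.ext (by simp [mul_div_mul_comm]) }
  have hχ1 : ∀ (σ : Gal(N/K)) (c : K) (x : Nˣ), (x : N) = algebraMap K N c → χ σ x = 1 := by
    intro σ c x hx
    change residue B _ = 1
    rw [← map_one (residue B)]
    congr 1
    refine Subtype.ext ?_
    change σ x / x = 1
    rw [hx, AlgEquiv.commutes, ← hx, div_self x.ne_zero]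
  have hχ2 : ∀ (σ : hB.residueAction.ker) (x : Nˣ), B.valuation (x : N) = 1 → χ σ x = 1 := by
    rintro ⟨σ, hσ⟩ x hx
    change residue B _ = 1
    rw [← map_one (residue B), residue_eq_residue_iff]
    have hxB : (x : N) ∈ B := (B.valuation_le_one_iff _).mp hx.le
    have h1 : residue B (hB.ringHom σ ⟨x, hxB⟩) = residue B ⟨x, hxB⟩ := by
      rw [← hB.residueAction_residue, MonoidHom.mem_ker.mp hσ]; rfl
    rw [residue_eq_residue_iff] at h1
    change B.valuation (σ x - x) < 1 at h1
    change B.valuation (σ x / x - 1) < 1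
    rw [div_sub_one x.ne_zero, map_div₀, hx, div_one]
    exact h1
  have hχq : ∀ (σ : hB.residueAction.ker) (x y : Nˣ), q x = q y → χ σ x = χ σ y := by
    intro σ x y hxy
    obtain ⟨c, hc, hv⟩ := mem_valueSubgroup.mp (QuotientGroup.eq.mp hxy)
    have hcN : algebraMap K N c ≠ 0 := by simpa using hc
    let c' : Nˣ := Units.mk0 _ hcN
    have hu : B.valuation ((x * c' * y⁻¹ : Nˣ) : N) = 1 := by
      simp only [Units.val_mul, map_mul, c', Units.val_mk0, hv]
      simp
    have h1 := hχ2 σ _ hu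
    rw [map_mul, map_mul, hχ1 σ c c' rfl, mul_one] at h1
    calc χ σ x = χ σ x * (χ σ y⁻¹ * χ σ y) := by
          rw [← map_mul, inv_mul_cancel, map_one, mul_one]
      _ = χ σ y := by rw [← mul_assoc, h1, one_mul]
  have hinj : Function.Injective fun σ : hB.residueAction.ker => χ σ := by
    intro σ τ hστ
    have h1 : (τ : Gal(N/K))⁻¹ * σ ∈ ramificationGroup hB := by
      intro x hx
      have h2 := DFunLike.congr_fun hστ (Units.mk0 x hx)
      change residue B _ = residue B _ at h2
      rw [residue_eq_residue_iff] at h2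
      change B.valuation ((σ : Gal(N/K)) x / x - (τ : Gal(N/K)) x / x) < 1 at h2
      have hx0 : 0 < B.valuation x := by simpa [zero_lt_iff] using hx
      rw [← sub_div, map_div₀, div_lt_one₀ hx0] at h2
      rw [← hB (τ : Gal(N/K)), map_sub, AlgEquiv.mul_apply,
        ← AlgEquiv.mul_apply (τ : Gal(N/K)) (τ : Gal(N/K))⁻¹, mul_inv_cancel, AlgEquiv.one_apply]
      exact h2
    rw [hR, Subgroup.mem_bot, inv_mul_eq_one] at h1
    exact Subtype.ext h1.symm
  have hli : LinearIndependent κ fun σ : hB.residueAction.ker => (χ σ : Nˣ → κ) :=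
    (linearIndependent_monoidHom Nˣ κ).comp _ hinj
  -- The default value is harmless: independence is tested after pulling back along `q`.
  let χ' : hB.residueAction.ker → (Q → κ) := fun σ z =>
    if hz : ∃ x, q x = z then χ σ hz.choose else 0
  have hχ' : ∀ σ x, χ' σ (q x) = χ σ x := fun σ x => by
    have hz : ∃ y, q y = q x := ⟨x, rfl⟩
    simp only [χ', dif_pos hz]
    exact hχq σ _ _ hz.choose_spec
  have hli' : LinearIndependent κ χ' := by
    refine LinearIndependent.of_comp (LinearMap.funLeft κ κ q) ?_
    convert hli using 1
    ext σ x
    exact hχ' σ x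
  have := hli'.fintype_card_le_finrank
  rw [Module.finrank_fintype_fun_eq_card] at this
  rw [Nat.card_eq_fintype_card]
  refine this.trans (le_of_eq ?_)
  rw [← Nat.card_eq_fintype_card]
  rfl

theorem index_ker_residueAction_le [FiniteDimensional K N] (h : Extends A B)
    (hB : GaloisInvariant K B) :
    hB.residueAction.ker.index ≤ h.inertiaDegree := by
  classical
  let := h.residueAlgebra
  have : FiniteDimensional (ResidueField A) (ResidueField B) := h.fundamental_inequality.2.1
  let f : Gal(N/K) ⧸ hB.residueAction.ker → (ResidueField B →ₐ[ResidueField A] ResidueField B) :=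
    fun q =>
      { hB.residueAction q.out with
        commutes' := fun r => by
          obtain ⟨a, rfl⟩ := residue_surjective r
          change hB.residueAction q.out (residue B (h.ringMap a)) = residue B (h.ringMap a)
          rw [hB.residueAction_residue]
          congr 1
          exact Subtype.ext (q.out.commutes a) }
  have hf : Function.Injective f := fun q q' hqq' => by
    have h1 : hB.residueAction q.out = hB.residueAction q'.out :=
      RingHom.ext fun x => DFunLike.congr_fun hqq' x
    rw [← q.out_eq', ← q'.out_eq']
    refine QuotientGroup.eq.mpr ?_
    rw [MonoidHom.mem_ker, map_mul, ← h1, ← map_mul, inv_mul_cancel, map_one]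
  exact (Nat.card_le_card_of_injective f hf).trans (card_algHom_le_finrank _ _ _)

theorem finrank_le_of_ramificationGroup_eq_bot [FiniteDimensional K N] [IsGalois K N]
    (h : Extends A B) (hB : GaloisInvariant K B) (hR : ramificationGroup hB = ⊥) :
    Module.finrank K N ≤ ramificationIndex K B * h.inertiaDegree := by
  rw [← IsGalois.card_aut_eq_finrank, ← Subgroup.card_mul_index hB.residueAction.ker]
  exact Nat.mul_le_mul (card_ker_residueAction_le h hB hR) (index_ker_residueAction_le h hB)

end Defectless

/-! ### Artin–Schreier elements produced by wild ramification -/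

section WildStep

variable {K N : Type*} [Field K] [Field N] [Algebra K N] {B : ValuationSubring N}

theorem mem_of_pow_sub_mem {p : ℕ} [Fact p.Prime] {x : N} (hx : x ^ p - x ∈ B) : x ∈ B := by
  by_contra hn
  rw [← B.valuation_le_one_iff, not_le] at hn
  have h1 : B.valuation x < B.valuation (x ^ p) := by
    rw [map_pow]
    exact lt_self_pow₀ hn (Fact.out : p.Prime).one_lt
  rw [← B.valuation_le_one_iff, Valuation.map_sub_eq_of_lt_left _ h1] at hx
  exact absurd (hn.trans h1) (not_lt.mpr hx)

theorem exists_hom_zmod (p : ℕ) [Fact p.Prime] {G : Type*} [Group G] [Finite G] [Nontrivial G]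
    (hG : ∃ r, Nat.card G = p ^ r) :
    ∃ χ : G →* Multiplicative (ZMod p), Function.Surjective χ := by
  obtain ⟨r, hr⟩ := hG
  obtain _ | r := r
  · have := Finite.one_lt_card (α := G)
    rw [hr, pow_zero] at this
    omega
  obtain ⟨H, hH⟩ := Sylow.exists_subgroup_card_pow_prime (G := G) p (n := r)
    (by rw [hr]; exact pow_dvd_pow _ (Nat.le_succ r))
  have hidx : H.index = p := by
    have := Subgroup.card_mul_index H
    rw [hH, hr, pow_succ] at this
    exact Nat.eq_of_mul_eq_mul_left (pow_pos (Fact.out : p.Prime).pos _) this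
  have : H.Normal := Subgroup.normal_of_index_eq_minFac_card (by
    rw [hidx, hr, Nat.pow_minFac (Nat.succ_ne_zero r), (Fact.out : p.Prime).minFac_eq])
  have hQ : Nat.card (G ⧸ H) = p := hidx
  have hZ : Nat.card (Multiplicative (ZMod p)) = p := by
    rw [Nat.card_eq_fintype_card, Fintype.card_multiplicative, ZMod.card]
  exact ⟨(mulEquivOfPrimeCardEq hQ hZ).toMonoidHom.comp (QuotientGroup.mk' H),
    (mulEquivOfPrimeCardEq hQ hZ).surjective.comp (QuotientGroup.mk'_surjective H)⟩

theorem exists_sum_ne_zero (H : Subgroup Gal(N/K)) [Finite H] [Fintype H] :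
    ∃ z : N, ∑ σ : H, (σ : Gal(N/K)) z ≠ 0 := by
  by_contra! h0
  have h1 : ∑ σ : H, (1 : N) • ((((σ : Gal(N/K)) : N →* N)) : N → N) = 0 := by
    ext z
    simpa using h0 z
  have hinj : Function.Injective fun σ : H => (((σ : Gal(N/K)) : N →* N)) := fun σ τ hστ =>
    Subtype.ext (AlgEquiv.ext fun x => DFunLike.congr_fun hστ x)
  exact one_ne_zero (Fintype.linearIndependent_iff.mp
    ((linearIndependent_monoidHom N N).comp _ hinj) (fun _ => 1) h1 1)

/-- A nontrivial `p`-group surjects onto `ℤ/p` by some `χ`, and additive Hilbert 90 gives `θ` with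
`σ θ = θ + χ(σ)`. The element is `a = θ ^ p - θ`. If `a - ℘(y)` were integral, so would be `θ - y`;
but an automorphism with `χ = 1` moves it by `1`, which is too much for the ramification group. -/
theorem exists_wild_element [FiniteDimensional K N] (p : ℕ) [Fact p.Prime] [CharP N p]
    (hB : GaloisInvariant K B) (hR : ramificationGroup hB ≠ ⊥) :
    ∃ a ∈ IntermediateField.fixedField (ramificationGroup hB),
      ∀ y ∈ IntermediateField.fixedField (ramificationGroup hB), a - (y ^ p - y) ∉ B := by
  classical
  have hnt : Nontrivial (ramificationGroup hB) := (Subgroup.nontrivial_iff_ne_bot _).mpr hR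
  have := Fintype.ofFinite (ramificationGroup hB)
  obtain ⟨χ, hχ⟩ := exists_hom_zmod p (isPGroup_ramificationGroup p hB)
  let : Algebra (ZMod p) N := ZMod.algebra N p
  let j : ramificationGroup hB → N := fun σ => algebraMap (ZMod p) N (χ σ).toAdd
  have hj : ∀ (σ : Gal(N/K)) (z : ZMod p), σ (algebraMap (ZMod p) N z) = algebraMap (ZMod p) N z :=
    fun σ z => RingHom.congr_fun
      (Subsingleton.elim ((σ : N →+* N).comp (algebraMap (ZMod p) N)) (algebraMap (ZMod p) N)) z
  have hjmul : ∀ σ τ, j (σ * τ) = j σ + j τ := fun σ τ => by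
    simp only [j, map_mul, toAdd_mul, map_add]
  obtain ⟨z, hz⟩ := exists_sum_ne_zero (ramificationGroup hB)
  set s := ∑ σ : ramificationGroup hB, (σ : Gal(N/K)) z with hs
  have hsfix : ∀ τ : ramificationGroup hB, (τ : Gal(N/K)) s = s := fun τ => by
    rw [hs, map_sum]
    exact Fintype.sum_equiv (Equiv.mulLeft τ) _ _ fun σ => rfl
  -- Hilbert 90: `z / s` has trace one over the fixed field of the ramification group.
  let θ : N := -∑ τ : ramificationGroup hB, (τ : Gal(N/K)) z / s * j τ
  have hθ : ∀ σ : ramificationGroup hB, (σ : Gal(N/K)) θ = θ + j σ := fun σ => by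
    have h1 : (σ : Gal(N/K)) θ = -∑ τ : ramificationGroup hB,
        ((σ * τ : ramificationGroup hB) : Gal(N/K)) z / s * j τ := by
      simp only [θ, map_neg, map_sum, map_mul, map_div₀, hsfix, j, hj]
      rfl
    have h2 : θ = -∑ τ : ramificationGroup hB,
        ((σ * τ : ramificationGroup hB) : Gal(N/K)) z / s * j (σ * τ) := by
      simp only [θ]
      congr 1
      exact (Fintype.sum_equiv (Equiv.mulLeft σ) _ _ fun τ => rfl).symm
    have h3 : ∑ τ : ramificationGroup hB,
        ((σ * τ : ramificationGroup hB) : Gal(N/K)) z / s = 1 := by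
      rw [← Finset.sum_div]
      rw [div_eq_one_iff_eq hz, hs]
      exact Fintype.sum_equiv (Equiv.mulLeft σ) _ _ fun τ => rfl
    rw [h1, h2]
    simp only [hjmul, mul_add, Finset.sum_add_distrib]
    rw [← Finset.sum_mul, h3]
    ring
  have hjp : ∀ σ, j σ ^ p = j σ := fun σ => by
    simp only [j]
    rw [← map_pow, ZMod.pow_card]
  refine ⟨θ ^ p - θ, ?_, fun y hy hmem => ?_⟩
  · intro σ
    change (σ : Gal(N/K)) (θ ^ p - θ) = _
    rw [map_sub, map_pow, hθ, add_pow_char, hjp]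
    ring
  · have h1 : (θ - y) ∈ B := by
      refine mem_of_pow_sub_mem (p := p) ?_
      rw [sub_pow_char]
      convert hmem using 1
      ring
    obtain ⟨σ, hσ⟩ := hχ (Multiplicative.ofAdd 1)
    have h2 : (σ : Gal(N/K)) (θ - y) - (θ - y) = 1 := by
      have hyσ : (σ : Gal(N/K)) y = y := hy σ
      rw [map_sub, hθ, hyσ]
      simp only [j, hσ, toAdd_ofAdd, map_one]
      ring
    have h0 : θ - y ≠ 0 := by
      intro h0
      rw [h0] at h2
      simp at h2
    have h3 := σ.2 _ h0
    rw [h2, map_one] at h3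
    exact absurd h3 (not_lt.mpr ((B.valuation_le_one_iff _).mpr h1))

end WildStep

/-! ### Density of `p`-th powers in separable extensions -/

section Density

variable {K L : Type*} [Field K] [Field L] [Algebra K L] {A : ValuationSubring K}
  {B : ValuationSubring L}

/-- The `p`-th powers are dense. -/
def DensePowers (p : ℕ) (A : ValuationSubring K) : Prop :=
  ∀ a s : K, s ≠ 0 → ∃ b : K, A.valuation (a - b ^ p) < A.valuation s

/-- A denominator `s₀` of `z⁻¹` over `A` satisfies the weak inequality. Multiplying by the inverse
of an element outside `A` makes it strict. -/
theorem Extends.exists_valuation_lt [Algebra.IsAlgebraic K L] (h : Extends A B) (hA : A ≠ ⊤)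
    {z : L} (hz : z ≠ 0) : ∃ s : K, s ≠ 0 ∧ B.valuation (algebraMap K L s) < B.valuation z := by
  have : Algebra.IsAlgebraic A L :=
    (IsFractionRing.comap_isAlgebraic_iff (A := A) (K := K) (C := L)).mpr inferInstance
  have hinj : FaithfulSMul A L := by
    rw [faithfulSMul_iff_algebraMap_injective]
    exact (algebraMap K L).injective.comp Subtype.val_injective
  obtain ⟨⟨s₀, hs₀A⟩, hs₀, hint⟩ :=
    (Algebra.IsAlgebraic.isAlgebraic (R := A) z⁻¹).exists_integral_multiple
  have hmem := h.mem_of_isIntegral hint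
  obtain ⟨d, hd⟩ : ∃ d : K, d ∉ A := by
    by_contra! hd
    exact hA (top_unique fun d _ => hd d)
  have hd0 : d ≠ 0 := by rintro rfl; exact hd A.zero_mem
  have hs0 : s₀ ≠ 0 := fun h0 => hs₀ (Subtype.ext h0)
  refine ⟨s₀ * d⁻¹, mul_ne_zero hs0 (inv_ne_zero hd0), ?_⟩
  have h1 : B.valuation (algebraMap K L s₀) ≤ B.valuation z := by
    have h2 : algebraMap K L s₀ * z⁻¹ ∈ B := by
      rwa [Algebra.smul_def] at hmem
    rw [← B.valuation_le_one_iff, map_mul, map_inv₀] at h2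
    have hz0 : 0 < B.valuation z := by simpa [zero_lt_iff] using hz
    rwa [mul_inv_le_iff₀ hz0, one_mul] at h2
  refine lt_of_lt_of_le ?_ h1
  rw [h.valuation_lt_iff, map_mul]
  refine mul_lt_of_lt_one_right (by simpa [zero_lt_iff] using hs0) ?_
  rw [← A.valuation_le_one_iff, not_le] at hd
  rw [map_inv₀]
  exact inv_lt_one_of_one_lt₀ hd

/-- By separability the `p`-th powers of a `K`-basis of `L` form a basis again. It therefore
suffices to approximate the coordinates by `p`-th powers in `K`. -/
theorem Extends.densePowers [FiniteDimensional K L] [Algebra.IsSeparable K L] (p : ℕ)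
    [Fact p.Prime] [CharP K p] [CharP L p] (h : Extends A B) (hA : A ≠ ⊤) (hd : DensePowers p A) :
    DensePowers p B := by
  intro y z hz
  let e := Module.finBasis K L
  have : ExpChar K p := ExpChar.prime Fact.out
  let e' := e.mapPowExpCharPowOfIsSeparable p 1
  have he' : ∀ i, e' i = e i ^ p := fun i => by
    simp [e', Module.Basis.mapPowExpCharPowOfIsSeparable]
  have hs : ∀ i, ∃ s : K, s ≠ 0 ∧
      B.valuation (algebraMap K L s) * B.valuation (e' i) < B.valuation z := fun i => by
    have hi : e' i ≠ 0 := e'.ne_zero i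
    obtain ⟨s, hs0, hs⟩ := h.exists_valuation_lt hA (z := z / e' i) (div_ne_zero hz hi)
    refine ⟨s, hs0, ?_⟩
    rwa [map_div₀, lt_div_iff₀ (by simpa [zero_lt_iff] using hi)] at hs
  choose s hs0 hs using hs
  choose b hb using fun i => hd (e'.repr y i) (s i) (hs0 i)
  refine ⟨∑ i, algebraMap K L (b i) * e i, ?_⟩
  have h1 : y - (∑ i, algebraMap K L (b i) * e i) ^ p =
      ∑ i, algebraMap K L (e'.repr y i - b i ^ p) * e' i := by
    rw [sum_pow_char]
    nth_rewrite 1 [← e'.sum_repr y]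
    rw [← Finset.sum_sub_distrib]
    refine Finset.sum_congr rfl fun i _ => ?_
    rw [Algebra.smul_def, he', mul_pow, map_sub, map_pow]
    ring
  rw [h1]
  refine Valuation.map_sum_lt _ (by simpa using hz) fun i _ => ?_
  rw [map_mul]
  refine lt_of_le_of_lt ?_ (hs i)
  gcongr
  exact (h.valuation_lt_iff.mpr (hb i)).le

end Density

/-! ### Equivariant complements to Artin–Schreier classes -/

section ArtinSchreier

variable (p : ℕ) [Fact p.Prime] (E : Type*) [Field E] [CharP E p] [Algebra (ZMod p) E]

/-- The additive map `x ↦ x ^ p - x`. -/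
def artinSchreier : E →ₗ[ZMod p] E :=
  AddMonoidHom.toZModLinearMap p ((frobenius E p : E →+ E) - AddMonoidHom.id E)

theorem artinSchreier_apply (x : E) : artinSchreier p E x = x ^ p - x := rfl

variable {E}

/-- A valuation ring as an `𝔽_p`-subspace. -/
def valuationSubspace (B : ValuationSubring E) : Submodule (ZMod p) E :=
  AddSubgroup.toZModSubmodule p B.toSubring.toAddSubgroup

variable {K : Type*} [Field K] [Algebra K E]

/-- An automorphism as an `𝔽_p`-linear map. -/
def galLinear (σ : Gal(E/K)) : E →ₗ[ZMod p] E := AddMonoidHom.toZModLinearMap p (σ : E →+ E)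

omit [CharP E p] in
@[simp]
theorem galLinear_apply (σ : Gal(E/K)) (x : E) : galLinear p σ x = σ x := rfl

/-- The `u`-weighted average of an additive map over the Galois group. -/
noncomputable def weightedAverage [FiniteDimensional K E] (u : E) (f : E →ₗ[ZMod p] E) :
    E →ₗ[ZMod p] E :=
  ∑ σ : Gal(E/K), LinearMap.mulLeft (ZMod p) (σ u) ∘ₗ galLinear p σ ∘ₗ f ∘ₗ galLinear p σ⁻¹

omit [CharP E p] in
theorem weightedAverage_apply [FiniteDimensional K E] (u : E) (f : E →ₗ[ZMod p] E) (x : E) :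
    weightedAverage (K := K) p u f x = ∑ σ : Gal(E/K), σ u * σ (f (σ⁻¹ x)) := by
  simp [weightedAverage]

omit [CharP E p] in
theorem weightedAverage_equivariant [FiniteDimensional K E] (u : E) (f : E →ₗ[ZMod p] E)
    (τ : Gal(E/K)) (x : E) :
    weightedAverage (K := K) p u f (τ x) = τ (weightedAverage (K := K) p u f x) := by
  rw [weightedAverage_apply, weightedAverage_apply, map_sum]
  symm
  refine Fintype.sum_equiv (Equiv.mulLeft τ) _ _ fun σ => ?_
  simp only [Equiv.coe_mulLeft, map_mul, AlgEquiv.mul_apply, mul_inv_rev]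
  rw [← AlgEquiv.mul_apply τ⁻¹ τ, inv_mul_cancel, AlgEquiv.one_apply]

/-- The group order may be divisible by `p`, so averages are weighted by the conjugates of the
trace-one element `u`. Multiplication by these preserves `O` but not `W = ℘(E) + O`, which forces
two stages: an equivariant map sends `W` into `O` by subtracting some `℘(b x)`, and an equivariant
correction with values in `O` then kills `W`. -/
theorem exists_equivariant_projection [FiniteDimensional K E] {B : ValuationSubring E}
    (hB : GaloisInvariant K B) {u : E} (hu : u ∈ B) (htr : ∑ σ : Gal(E/K), σ u = 1) :
    ∃ φ : E →ₗ[ZMod p] E, (∀ (σ : Gal(E/K)) x, φ (σ x) = σ (φ x)) ∧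
      (∀ x ∈ LinearMap.range (artinSchreier p E) ⊔ valuationSubspace p B, φ x = 0) ∧
      ∀ x, x - φ x ∈ LinearMap.range (artinSchreier p E) ⊔ valuationSubspace p B := by
  classical
  set P := artinSchreier p E with hP
  set O := valuationSubspace p B with hO
  set W := LinearMap.range P ⊔ O with hW
  have hPσ : ∀ (σ : Gal(E/K)) x, P (σ x) = σ (P x) := fun σ x => by
    simp [hP, artinSchreier_apply]
  have hOσ : ∀ (σ : Gal(E/K)) x, x ∈ O → σ x ∈ O := fun σ x hx => (hB.mem_iff σ).mpr hx
  have hPO : ∀ x ∈ O, P x ∈ O := fun x hx =>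
    sub_mem (show x ^ p ∈ B from pow_mem (show x ∈ B from hx) p) (show x ∈ B from hx)
  have hPO' : ∀ x, P x ∈ O → x ∈ O := fun x hx => mem_of_pow_sub_mem hx
  have hWσ : ∀ (σ : Gal(E/K)) x, x ∈ W → σ x ∈ W := fun σ x hx => by
    obtain ⟨_, ⟨y, rfl⟩, c, hc, rfl⟩ := Submodule.mem_sup.mp hx
    rw [map_add, ← hPσ]
    exact Submodule.add_mem_sup ⟨_, rfl⟩ (hOσ σ c hc)
  have hσσ : ∀ (σ : Gal(E/K)) x, σ (σ⁻¹ x) = x := fun σ x => by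
    rw [← AlgEquiv.mul_apply, mul_inv_cancel, AlgEquiv.one_apply]
  have hsum : ∀ x : E, x = ∑ σ : Gal(E/K), σ u * x := fun x => by
    rw [← Finset.sum_mul, htr, one_mul]
  -- a linear choice of `y` with `x - P y ∈ O`
  obtain ⟨β, hβ⟩ : ∃ β : E →ₗ[ZMod p] E, ∀ x ∈ W, x - P (β x) ∈ O := by
    let T : (E × O) →ₗ[ZMod p] W := LinearMap.codRestrict W
      (P ∘ₗ LinearMap.fst _ _ _ + O.subtype ∘ₗ LinearMap.snd _ _ _)
      fun x => Submodule.add_mem_sup (LinearMap.mem_range_self P _) x.2.2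
    have hT : LinearMap.range T = ⊤ := by
      rw [LinearMap.range_eq_top]
      rintro ⟨x, hx⟩
      obtain ⟨_, ⟨y, rfl⟩, c, hc, rfl⟩ := Submodule.mem_sup.mp hx
      exact ⟨(y, ⟨c, hc⟩), rfl⟩
    obtain ⟨s, hs⟩ := LinearMap.exists_rightInverse_of_surjective T hT
    obtain ⟨β, hβ⟩ := LinearMap.exists_extend (LinearMap.fst _ _ _ ∘ₗ s)
    refine ⟨β, fun x hx => ?_⟩
    have h1 : β x = (s ⟨x, hx⟩).1 := LinearMap.congr_fun hβ ⟨x, hx⟩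
    have h2 : P (s ⟨x, hx⟩).1 + (s ⟨x, hx⟩).2 = x :=
      congrArg Subtype.val (LinearMap.congr_fun hs ⟨x, hx⟩)
    rw [h1]
    nth_rewrite 1 [← h2]
    rw [add_sub_cancel_left]
    exact (s ⟨x, hx⟩).2.2
  -- On `W` the conjugates of `β` differ from `β` by elements of `O`, because `℘` of the difference
  -- is integral. So averaging changes `β` only within `O`.
  let b := weightedAverage (K := K) p u β
  have hb : ∀ x ∈ W, b x - β x ∈ O := fun x hx => by
    have h1 : b x - β x = ∑ σ : Gal(E/K), σ u * (σ (β (σ⁻¹ x)) - β x) := by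
      simp only [mul_sub]
      rw [Finset.sum_sub_distrib, ← hsum (β x), ← weightedAverage_apply]
    rw [h1]
    refine Submodule.sum_mem _ fun σ _ => mul_mem (S := ValuationSubring E)
      ((hB.mem_iff σ).mpr hu) (hPO' _ ?_)
    have h2 := hOσ σ _ (hβ _ (hWσ σ⁻¹ x hx))
    rw [map_sub, hσσ, ← hPσ] at h2
    rw [map_sub]
    have := O.sub_mem (hβ x hx) h2
    rwa [sub_sub_sub_cancel_left] at this
  let φ₁ : E →ₗ[ZMod p] E := LinearMap.id - P ∘ₗ b
  have hφ₁σ : ∀ (σ : Gal(E/K)) x, φ₁ (σ x) = σ (φ₁ x) := fun σ x => by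
    change σ x - P (b (σ x)) = σ (x - P (b x))
    rw [map_sub, ← hPσ, weightedAverage_equivariant]
  have hφ₁W : ∀ x ∈ W, φ₁ x ∈ O := fun x hx => by
    have h1 : φ₁ x = (x - P (β x)) - P (b x - β x) := by
      change x - P (b x) = _
      rw [map_sub]; ring
    rw [h1]
    exact O.sub_mem (hβ x hx) (hPO _ (hb x hx))
  obtain ⟨π, hπ⟩ := LinearMap.exists_leftInverse_of_injective W.subtype (Submodule.ker_subtype W)
  have hπW : ∀ x (hx : x ∈ W), π x = ⟨x, hx⟩ := fun x hx => LinearMap.congr_fun hπ ⟨x, hx⟩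
  -- Extend `φ₁` from `W` to `E` with values in `O`, then average. On `W` the average is again `φ₁`,
  -- which is equivariant there already.
  let ε₀ : E →ₗ[ZMod p] E := φ₁ ∘ₗ W.subtype ∘ₗ π
  let ε := weightedAverage (K := K) p u ε₀
  have hεO : ∀ x, ε x ∈ O := fun x => by
    simp only [ε]
    rw [weightedAverage_apply]
    exact Submodule.sum_mem _ fun σ _ => mul_mem (S := ValuationSubring E)
      ((hB.mem_iff σ).mpr hu) (hOσ σ _ (hφ₁W _ (π _).2))
  have hεW : ∀ x ∈ W, ε x = φ₁ x := fun x hx => by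
    simp only [ε]
    rw [weightedAverage_apply, hsum (φ₁ x)]
    refine Finset.sum_congr rfl fun σ _ => ?_
    congr 1
    change σ (φ₁ (π (σ⁻¹ x))) = _
    rw [hπW _ (hWσ σ⁻¹ x hx), ← hφ₁σ]
    change φ₁ (σ (σ⁻¹ x)) = _
    rw [hσσ]
  refine ⟨φ₁ - ε, fun σ x => ?_, fun x hx => ?_, fun x => ?_⟩
  · change φ₁ (σ x) - ε (σ x) = σ (φ₁ x - ε x)
    rw [map_sub, hφ₁σ, weightedAverage_equivariant]
  · rw [LinearMap.sub_apply, hεW x hx, sub_self]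
  · have h1 : x - (φ₁ - ε) x = P (b x) + ε x := by
      rw [LinearMap.sub_apply]
      change x - (x - P (b x) - ε x) = _
      ring
    rw [h1]
    exact Submodule.add_mem_sup ⟨_, rfl⟩ (hεO x)

/-- A finite Galois-stable space of Artin–Schreier parameters, none of which becomes integral. -/
theorem exists_stable_subspace [FiniteDimensional K E] {B : ValuationSubring E}
    (hB : GaloisInvariant K B) {u : E} (hu : u ∈ B) (htr : ∑ σ : Gal(E/K), σ u = 1)
    {a : E} (ha : ∀ y, a - (y ^ p - y) ∉ B) :
    ∃ Φ : Submodule (ZMod p) E, FiniteDimensional (ZMod p) Φ ∧ Φ ≠ ⊥ ∧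
      (∀ (σ : Gal(E/K)), ∀ x ∈ Φ, σ x ∈ Φ) ∧ ∀ x ∈ Φ, ∀ y, x - (y ^ p - y) ∈ B → x = 0 := by
  classical
  obtain ⟨φ, hφσ, hφW, hφ⟩ := exists_equivariant_projection p hB hu htr
  have hW : ∀ x, x ∈ LinearMap.range (artinSchreier p E) ⊔ valuationSubspace p B ↔
      ∃ y, x - (y ^ p - y) ∈ B := fun x => by
    constructor
    · intro hx
      obtain ⟨_, ⟨y, rfl⟩, c, hc, rfl⟩ := Submodule.mem_sup.mp hx
      refine ⟨y, ?_⟩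
      rw [artinSchreier_apply, add_sub_cancel_left]
      exact hc
    · rintro ⟨y, hy⟩
      have h1 : x = artinSchreier p E y + (x - (y ^ p - y)) := by
        rw [artinSchreier_apply]; ring
      rw [h1]
      exact Submodule.add_mem_sup ⟨_, rfl⟩ hy
  let Φ₁ : Submodule (ZMod p) E := Submodule.span (ZMod p) (Set.range fun σ : Gal(E/K) => σ a)
  have hΦ₁σ : ∀ (σ : Gal(E/K)), ∀ x ∈ Φ₁, σ x ∈ Φ₁ := fun σ x hx => by
    have h1 : Φ₁ ≤ Φ₁.comap (galLinear p σ) := by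
      refine Submodule.span_le.mpr ?_
      rintro _ ⟨τ, rfl⟩
      exact Submodule.subset_span ⟨σ * τ, rfl⟩
    exact h1 hx
  have hfin : FiniteDimensional (ZMod p) Φ₁ :=
    FiniteDimensional.span_of_finite (ZMod p) (Set.finite_range _)
  have haΦ : a ∈ Φ₁ := Submodule.subset_span ⟨1, rfl⟩
  -- The kernel of `φ` is exactly `W`. Hence the image of the span of the conjugates of `a` is
  -- nonzero, as `a ∉ W`, and meets `W` only in zero.
  refine ⟨Φ₁.map φ, inferInstance, ?_, ?_, ?_⟩
  · intro h0
    have h1 : φ a = 0 := by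
      have : φ a ∈ Φ₁.map φ := Submodule.mem_map_of_mem haΦ
      rwa [h0, Submodule.mem_bot] at this
    have h2 := hφ a
    rw [h1, sub_zero, hW] at h2
    obtain ⟨y, hy⟩ := h2
    exact ha y hy
  · rintro σ _ ⟨x, hx, rfl⟩
    exact ⟨σ x, hΦ₁σ σ x hx, hφσ σ x⟩
  · rintro _ ⟨x, hx, rfl⟩ y hy
    refine hφW x ?_
    have := Submodule.add_mem _ (hφ x) ((hW _).mpr ⟨y, hy⟩)
    rwa [sub_add_cancel] at this

theorem exists_zmod_eq_of_pow_eq {x : E} (hx : x ^ p = x) :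
    ∃ z : ZMod p, algebraMap (ZMod p) E z = x := by
  have h1 : x ∈ (⊥ : Subfield E) := (Subfield.mem_bot_iff_pow_eq_self E p).mpr hx
  rw [← ZMod.fieldRange_castHom_eq_bot p] at h1
  obtain ⟨z, hz⟩ := h1
  exact ⟨z, by rw [← hz]; exact RingHom.congr_fun (Subsingleton.elim _ _) z⟩

theorem exists_dual_of_pow_eq {V : Type*} [AddCommGroup V] [Module (ZMod p) V]
    (D : V →ₗ[ZMod p] E) (hD : ∀ x, D x ^ p = D x) :
    ∃ l : Module.Dual (ZMod p) V, ∀ x, algebraMap (ZMod p) E (l x) = D x := by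
  let F := Algebra.linearMap (ZMod p) E
  have hF : Function.Injective F := (algebraMap (ZMod p) E).injective
  let e := LinearEquiv.ofInjective F hF
  let D' : V →ₗ[ZMod p] LinearMap.range F := D.codRestrict _ fun x => by
    obtain ⟨z, hz⟩ := exists_zmod_eq_of_pow_eq p (hD x)
    exact ⟨z, hz⟩
  refine ⟨e.symm.toLinearMap ∘ₗ D', fun x => ?_⟩
  have : e (e.symm (D' x)) = D' x := e.apply_symm_apply _
  exact congrArg Subtype.val this

end ArtinSchreier

/-! ### Ramification groups in towers -/

section Tower

variable {K E N : Type*} [Field K] [Field E] [Field N] [Algebra K E] [Algebra E N] [Algebra K N]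
  [IsScalarTower K E N] {B : ValuationSubring E} {C : ValuationSubring N}

theorem GaloisInvariant.of_extends [Normal K E] [Normal K N] (h : Extends B C)
    (hC : GaloisInvariant K C) : GaloisInvariant K B := by
  intro σ x
  obtain ⟨τ, rfl⟩ := AlgEquiv.restrictNormalHom_surjective (F := K) (K₁ := E) N σ
  have h1 : C.valuation (algebraMap E N (AlgEquiv.restrictNormalHom E τ x)) =
      C.valuation (algebraMap E N x) := by
    rw [← hC τ (algebraMap E N x)]
    exact congrArg _ (AlgEquiv.restrictNormal_commutes τ E x)
  exact le_antisymm (h.valuation_le_iff.mp h1.le) (h.valuation_le_iff.mp h1.ge)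

variable (E) in
theorem GaloisInvariant.tower_top (hC : GaloisInvariant K C) : GaloisInvariant E C :=
  fun σ x => hC (σ.restrictScalars K) x

theorem algebraMap_eq_of_mem_ramificationGroup [Normal K E] (h : Extends B C)
    {hB : GaloisInvariant K B} {hC : GaloisInvariant K C} (hR : ramificationGroup hB = ⊥)
    {σ : Gal(N/K)} (hσ : σ ∈ ramificationGroup hC) (x : E) :
    σ (algebraMap E N x) = algebraMap E N x := by
  have h1 : σ.restrictNormal E ∈ ramificationGroup hB := fun y hy => by
    rw [← h.valuation_lt_iff, map_sub, AlgEquiv.restrictNormal_commutes]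
    exact hσ _ (by simpa using hy)
  rw [hR, Subgroup.mem_bot] at h1
  rw [← AlgEquiv.restrictNormal_commutes, h1, AlgEquiv.one_apply]

/-- Lift `σ` to `τ` on `N`. Each `x` has the leading term of some `e ∈ E`, on which `τ` acts
trivially up to smaller terms, so `τ` lies in the ramification group of `N` and therefore fixes `E`.
-/
theorem ramificationGroup_eq_bot_of_dense [Normal K E] [Normal K N] (h : Extends B C)
    (hB : GaloisInvariant K B) (hC : GaloisInvariant K C)
    (hfix : ∀ σ ∈ ramificationGroup hC, ∀ x : E, σ (algebraMap E N x) = algebraMap E N x)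
    (hd : DenseLeadingTerms C (Set.range (algebraMap E N))) : ramificationGroup hB = ⊥ := by
  refine (Subgroup.eq_bot_iff_forall _).mpr fun σ hσ => ?_
  obtain ⟨τ, rfl⟩ := AlgEquiv.restrictNormalHom_surjective (F := K) (K₁ := E) N σ
  have hτ : ∀ x : E, algebraMap E N (AlgEquiv.restrictNormalHom E τ x) = τ (algebraMap E N x) :=
    fun x => AlgEquiv.restrictNormal_commutes τ E x
  have hmem : τ ∈ ramificationGroup hC := fun x hx => by
    obtain ⟨_, ⟨e, rfl⟩, he⟩ := hd x hx
    have he' := valuation_eq_of_sub_lt he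
    have he0 : e ≠ 0 := by
      rintro rfl
      rw [map_zero, map_zero] at he'
      exact hx ((map_eq_zero _).mp he'.symm)
    have h1 : τ x - x = τ (x - algebraMap E N e) - (x - algebraMap E N e) +
        algebraMap E N (AlgEquiv.restrictNormalHom E τ e - e) := by
      rw [map_sub, map_sub, hτ]; ring
    rw [h1]
    refine Valuation.map_add_lt _ (Valuation.map_sub_lt _ (by rwa [hC]) he) ?_
    rw [← he', h.valuation_lt_iff]
    exact hσ e he0
  ext x
  exact (algebraMap E N).injective ((hτ x).trans (hfix τ hmem x))

end Tower

/-! ### Descent to `K` by a trace-one element -/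

section TraceOne

variable {K N : Type*} [Field K] [Field N] [Algebra K N] {C : ValuationSubring N}

theorem exists_trace_eq_one_fixedField [FiniteDimensional K N] [IsGalois K N] (p : ℕ)
    [Fact p.Prime] [CharP N p] (hC : GaloisInvariant K C)
    (hd : DenseLeadingTerms C (IntermediateField.fixedField (ramificationGroup hC))) :
    ∃ u : IntermediateField.fixedField (ramificationGroup hC), (u : N) ∈ C ∧
      ∑ σ : Gal(IntermediateField.fixedField (ramificationGroup hC)/K), σ u = 1 := by
  set T := IntermediateField.fixedField (ramificationGroup hC)
  let B : ValuationSubring T := C.comap (algebraMap T N)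
  have h : Extends B C := rfl
  have hB : GaloisInvariant K B := GaloisInvariant.of_extends h hC
  have : CharP T p := (algebraMap T N).charP (algebraMap T N).injective p
  have hR : ramificationGroup hB = ⊥ := by
    refine ramificationGroup_eq_bot_of_dense h hB hC (fun σ hσ x => x.2 ⟨σ, hσ⟩) ?_
    intro x hx
    obtain ⟨e, he, hlt⟩ := hd x hx
    exact ⟨e, ⟨⟨e, he⟩, rfl⟩, hlt⟩
  exact exists_trace_eq_one p hB hR

/-- Take `e` in the fixed field `T` with the leading term of `x`, and `c = Tr(u e)`. Every
automorphism `τ` of `T` lifts to some `g ∈ H`, which fixes `x`. Then `x - c` is the sum of the `τ u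
· g (x - e)`, and each summand is small. -/
theorem exists_sub_algebraMap_lt [FiniteDimensional K N] [IsGalois K N] (p : ℕ)
    [Fact p.Prime] [CharP N p] (hC : GaloisInvariant K C)
    (hd : DenseLeadingTerms C (IntermediateField.fixedField (ramificationGroup hC)))
    (H : Subgroup Gal(N/K)) (hH : ∀ g, ∃ r ∈ ramificationGroup hC, r * g ∈ H)
    {x : N} (hx : x ∈ IntermediateField.fixedField H) (hx0 : x ≠ 0) :
    ∃ c : K, C.valuation (x - algebraMap K N c) < C.valuation x := by
  let T := IntermediateField.fixedField (ramificationGroup hC)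
  obtain ⟨u, huC, htr⟩ : ∃ u : T, (u : N) ∈ C ∧ ∑ σ : Gal(T/K), σ u = 1 :=
    exists_trace_eq_one_fixedField p hC hd
  obtain ⟨e, he, hlt⟩ := hd x hx0
  let e' : T := ⟨e, he⟩
  have hlift : ∀ τ : Gal(T/K), ∃ g ∈ H, ∀ y : T, g (y : N) = τ y := fun τ => by
    obtain ⟨g, rfl⟩ := AlgEquiv.restrictNormalHom_surjective (F := K) (K₁ := T) N τ
    obtain ⟨r, hr, hrg⟩ := hH g
    refine ⟨r * g, hrg, fun y => ?_⟩
    have h1 : g (y : N) = ((AlgEquiv.restrictNormalHom T g y : T) : N) :=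
      (AlgEquiv.restrictNormal_commutes g T y).symm
    rw [AlgEquiv.mul_apply, h1]
    exact (AlgEquiv.restrictNormalHom T g y).2 ⟨r, hr⟩
  refine ⟨Algebra.trace K T (u * e'), ?_⟩
  have h1 : algebraMap K N (Algebra.trace K T (u * e')) =
      ∑ τ : Gal(T/K), ((τ u : T) : N) * (τ e' : T) := by
    rw [IsScalarTower.algebraMap_apply K T N, trace_eq_sum_automorphisms, map_sum]
    simp only [map_mul]
    rfl
  have h2 : x = ∑ τ : Gal(T/K), ((τ u : T) : N) * x := by
    have h3 := congrArg (algebraMap T N) htr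
    rw [map_sum, map_one] at h3
    rw [← Finset.sum_mul]
    change x = (∑ τ : Gal(T/K), algebraMap T N (τ u)) * x
    rw [h3, one_mul]
  have h3 : x - algebraMap K N (Algebra.trace K T (u * e')) =
      ∑ τ : Gal(T/K), ((τ u : T) : N) * (x - (τ e' : T)) := by
    simp only [mul_sub]
    rw [Finset.sum_sub_distrib, ← h1, ← h2]
  rw [h3]
  refine Valuation.map_sum_lt _ (by simpa using hx0) fun τ _ => ?_
  obtain ⟨g, hg, hgτ⟩ := hlift τ
  have hgx : g x = x := hx ⟨g, hg⟩
  rw [map_mul, ← hgτ, ← hgτ]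
  nth_rewrite 1 [← hgx]
  rw [← map_sub, hC, hC]
  exact (mul_le_of_le_one_left' ((C.valuation_le_one_iff _).mpr huC)).trans_lt hlt

/-- Two roots of the same Artin–Schreier equation differ by an integral element, so `θ` and the
weighted trace `c = Tr(u θ)` do as well. Thus an Artin–Schreier class that becomes trivial over `T`
is trivial over `K` modulo integral elements. -/
theorem exists_sub_algebraMap_mem [FiniteDimensional K N] [IsGalois K N] (p : ℕ)
    [Fact p.Prime] [CharP N p] (hC : GaloisInvariant K C)
    (hd : DenseLeadingTerms C (IntermediateField.fixedField (ramificationGroup hC)))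
    {θ : N} (hθ : θ ∈ IntermediateField.fixedField (ramificationGroup hC)) {a : K}
    (ha : θ ^ p - θ = algebraMap K N a) : ∃ c : K, θ - algebraMap K N c ∈ C := by
  let T := IntermediateField.fixedField (ramificationGroup hC)
  obtain ⟨u, huC, htr⟩ : ∃ u : T, (u : N) ∈ C ∧ ∑ σ : Gal(T/K), σ u = 1 :=
    exists_trace_eq_one_fixedField p hC hd
  let e' : T := ⟨θ, hθ⟩
  refine ⟨Algebra.trace K T (u * e'), ?_⟩
  have h1 : algebraMap K N (Algebra.trace K T (u * e')) =
      ∑ τ : Gal(T/K), ((τ u : T) : N) * (τ e' : T) := by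
    rw [IsScalarTower.algebraMap_apply K T N, trace_eq_sum_automorphisms, map_sum]
    simp only [map_mul]
    rfl
  have h2 : θ = ∑ τ : Gal(T/K), ((τ u : T) : N) * θ := by
    have h3 := congrArg (algebraMap T N) htr
    rw [map_sum, map_one] at h3
    rw [← Finset.sum_mul]
    change θ = (∑ τ : Gal(T/K), algebraMap T N (τ u)) * θ
    rw [h3, one_mul]
  have h3 : θ - algebraMap K N (Algebra.trace K T (u * e')) =
      ∑ τ : Gal(T/K), ((τ u : T) : N) * (θ - (τ e' : T)) := by
    simp only [mul_sub]
    rw [Finset.sum_sub_distrib, ← h1, ← h2]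
  rw [h3]
  refine sum_mem fun τ _ => mul_mem ?_ ?_
  · obtain ⟨g, rfl⟩ := AlgEquiv.restrictNormalHom_surjective (F := K) (K₁ := T) N τ
    have h4 : ((AlgEquiv.restrictNormalHom T g u : T) : N) = g u :=
      AlgEquiv.restrictNormal_commutes g T u
    rw [h4, hC.mem_iff]
    exact huC
  · refine mem_of_pow_sub_mem (p := p) ?_
    have h4 : e' ^ p - e' = algebraMap K T a := Subtype.ext ha
    have h5 := congrArg (fun y : T => ((τ y : T) : N)) h4
    simp only [map_sub, map_pow, AlgEquiv.commutes] at h5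
    have h6 : ((τ e' : T) : N) ^ p - (τ e' : T) = algebraMap K N a := h5
    rw [sub_pow_char]
    have h7 : θ ^ p - ((τ e' : T) : N) ^ p - (θ - (τ e' : T)) = 0 := by
      linear_combination ha - h6
    rw [h7]
    exact C.zero_mem

end TraceOne

/-! ### A proper immediate subextension from Artin–Schreier roots -/

section DegreePStep

variable (p : ℕ) [Fact p.Prime] {K E N : Type*} [Field K] [Field E] [Field N] [Algebra K E]
  [Algebra E N] [Algebra K N] [IsScalarTower K E N] {B : ValuationSubring E}
  {C : ValuationSubring N} [CharP N p] [Algebra (ZMod p) E] [Algebra (ZMod p) N]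

theorem exists_linear_artinSchreier_root (Φ : Submodule (ZMod p) E) [FiniteDimensional (ZMod p) Φ]
    (hroot : ∀ a ∈ Φ, ∃ θ : N, θ ^ p - θ = algebraMap E N a) :
    ∃ ψ : Φ →ₗ[ZMod p] N, ∀ a, ψ a ^ p - ψ a = algebraMap E N a := by
  let b := Module.finBasis (ZMod p) Φ
  choose θ hθ using fun i => hroot (b i) (b i).2
  let ψ : Φ →ₗ[ZMod p] N := b.constr (ZMod p) θ
  let ι : E →ₗ[ZMod p] N := AddMonoidHom.toZModLinearMap p (algebraMap E N : E →+ N)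
  have h1 : artinSchreier p N ∘ₗ ψ = ι ∘ₗ Φ.subtype := by
    refine b.ext fun i => ?_
    change ψ (b i) ^ p - ψ (b i) = algebraMap E N (b i)
    simp only [ψ, Module.Basis.constr_basis]
    exact hθ i
  exact ⟨ψ, fun a => LinearMap.congr_fun h1 a⟩

omit [CharP N p] in
theorem algEquiv_algebraMap_zmod (σ : Gal(N/K)) (z : ZMod p) :
    σ (algebraMap (ZMod p) N z) = algebraMap (ZMod p) N z :=
  RingHom.congr_fun
    (Subsingleton.elim ((σ : N →+* N).comp (algebraMap (ZMod p) N)) (algebraMap (ZMod p) N)) z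

/-- If the Artin–Schreier equations of a stable space of non-integral parameters over `E` split in
`N`, then `N` contains a proper extension of `K` all of whose leading terms come from `K`. -/
theorem exists_immediate_subextension [FiniteDimensional K N] [IsGalois K N] [Normal K E]
    (h : Extends B C) {hB : GaloisInvariant K B} (hR : ramificationGroup hB = ⊥)
    (hC : GaloisInvariant K C)
    (hd : DenseLeadingTerms C (IntermediateField.fixedField (ramificationGroup hC)))
    (Φ : Submodule (ZMod p) E) [FiniteDimensional (ZMod p) Φ] (hΦ : Φ ≠ ⊥)
    (hΦσ : ∀ (σ : Gal(E/K)), ∀ x ∈ Φ, σ x ∈ Φ)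
    (hΦB : ∀ x ∈ Φ, ∀ y, x - (y ^ p - y) ∈ B → x = 0)
    (hroot : ∀ a ∈ Φ, ∃ θ : N, θ ^ p - θ = algebraMap E N a) :
    ∃ Q : IntermediateField K N, Q ≠ ⊥ ∧
      ∀ x ∈ Q, x ≠ 0 → ∃ c : K, C.valuation (x - algebraMap K N c) < C.valuation x := by
  obtain ⟨ψ, hψ⟩ := exists_linear_artinSchreier_root p Φ hroot
  set R := ramificationGroup hC
  have hRE : ∀ r ∈ R, ∀ x : E, r (algebraMap E N x) = algebraMap E N x :=
    fun r hr => algebraMap_eq_of_mem_ramificationGroup h hR hr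
  -- `R` separates the points of `Φ`
  have hsep : ∀ a : Φ, (∀ r ∈ R, r (ψ a) = ψ a) → a = 0 := fun a ha => by
    have : FiniteDimensional E N := FiniteDimensional.right K E N
    have : IsGalois E N := IsGalois.tower_top_of_isGalois K E N
    have hC' : GaloisInvariant E C := hC.tower_top E
    have hsub : ∀ x, (∀ r ∈ R, r x = x) → x ∈ IntermediateField.fixedField (ramificationGroup hC') :=
      fun x hx σ => hx ((σ : Gal(N/E)).restrictScalars K) σ.2
    obtain ⟨c, hc⟩ := exists_sub_algebraMap_mem p hC' (fun x hx => by
      obtain ⟨e, he, hlt⟩ := hd x hx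
      exact ⟨e, hsub e fun r hr => he ⟨r, hr⟩, hlt⟩) (hsub _ ha) (hψ a)
    refine Subtype.ext (hΦB a a.2 c ?_)
    rw [← h.algebraMap_mem_iff]
    have h1 : algebraMap E N (a - (c ^ p - c)) =
        (ψ a - algebraMap E N c) ^ p - (ψ a - algebraMap E N c) := by
      rw [sub_pow_char, map_sub, map_sub, map_pow, ← hψ]; ring
    rw [h1]
    exact sub_mem (pow_mem hc p) hc
  -- The functionals `a ↦ r (ψ a) - ψ a` realised by `R`. Since `R` separates points of `Φ`, their
  -- common kernel is zero, so by finite-dimensional duality they exhaust the dual.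
  let S : AddSubgroup (Module.Dual (ZMod p) Φ) :=
    { carrier := {l | ∃ r ∈ R, ∀ a, r (ψ a) - ψ a = algebraMap (ZMod p) N (l a)}
      zero_mem' := ⟨1, one_mem _, fun a => by simp⟩
      add_mem' := by
        rintro l l' ⟨r, hr, hl⟩ ⟨r', hr', hl'⟩
        refine ⟨r * r', mul_mem hr hr', fun a => ?_⟩
        have h1 := congrArg r (hl' a)
        rw [map_sub, algEquiv_algebraMap_zmod] at h1
        rw [AlgEquiv.mul_apply, LinearMap.add_apply, map_add, ← hl, ← h1]
        ring
      neg_mem' := by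
        rintro l ⟨r, hr, hl⟩
        refine ⟨r⁻¹, inv_mem hr, fun a => ?_⟩
        have h1 := congrArg (r⁻¹ : Gal(N/K)) (hl a)
        rw [map_sub, algEquiv_algebraMap_zmod, ← AlgEquiv.mul_apply, inv_mul_cancel,
          AlgEquiv.one_apply] at h1
        rw [LinearMap.neg_apply, map_neg, ← h1]
        ring }
  have hS : ∀ D : Φ →ₗ[ZMod p] N, (∀ a, D a ^ p = D a) → ∃ r ∈ R, ∀ a, r (ψ a) - ψ a = D a := by
    intro D hD
    obtain ⟨l, hl⟩ := exists_dual_of_pow_eq p D hD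
    have htop : AddSubgroup.toZModSubmodule p S = ⊤ := by
      have hbot : (AddSubgroup.toZModSubmodule p S).dualCoannihilator = ⊥ := by
        refine (Submodule.eq_bot_iff _).mpr fun a ha => hsep a fun r hr => ?_
        rw [Submodule.mem_dualCoannihilator] at ha
        obtain ⟨l, hl⟩ := exists_dual_of_pow_eq p (galLinear p r ∘ₗ ψ - ψ) fun a => by
          change (r (ψ a) - ψ a) ^ p = r (ψ a) - ψ a
          have h1 := congrArg r (hψ a)
          rw [map_sub, map_pow, hRE r hr, ← hψ a] at h1
          rw [sub_pow_char]
          linear_combination h1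
        have h2 := ha l ⟨r, hr, fun a => (hl a).symm⟩
        have h3 := hl a
        rw [h2, map_zero] at h3
        exact (sub_eq_zero.mp h3.symm)
      rw [← Subspace.dualCoannihilator_dualAnnihilator_eq (W := AddSubgroup.toZModSubmodule p S),
        hbot, Submodule.dualAnnihilator_bot]
    have hmem : l ∈ AddSubgroup.toZModSubmodule p S := by rw [htop]; trivial
    obtain ⟨r, hr, hrl⟩ := hmem
    exact ⟨r, hr, fun a => (hrl a).trans (hl a)⟩
  let ρ : Gal(N/K) → Φ → Φ := fun g a => ⟨AlgEquiv.restrictNormalHom E g a, hΦσ _ _ a.2⟩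
  have hρ : ∀ g a, algebraMap E N (ρ g a) = g (algebraMap E N a) := fun g a =>
    AlgEquiv.restrictNormal_commutes g E a
  have hρ1 : ∀ a, ρ 1 a = a := fun a => Subtype.ext (by simp [ρ])
  have hρmul : ∀ g g' a, ρ (g * g') a = ρ g (ρ g' a) := fun g g' a => Subtype.ext (by simp [ρ])
  -- The stabiliser of the splitting `ψ`, that is, the automorphisms commuting with it.
  let H : Subgroup Gal(N/K) :=
    { carrier := {g | ∀ a, g (ψ a) = ψ (ρ g a)}
      one_mem' := fun a => by rw [hρ1, AlgEquiv.one_apply]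
      mul_mem' := fun {g g'} hg hg' a => by
        rw [hρmul, AlgEquiv.mul_apply, hg' a, hg]
      inv_mem' := fun {g} hg a => by
        have h1 := hg (ρ g⁻¹ a)
        rw [← hρmul, mul_inv_cancel, hρ1] at h1
        rw [← h1, ← AlgEquiv.mul_apply, inv_mul_cancel, AlgEquiv.one_apply] }
  -- The map `ψ - g ψ g⁻¹` takes values in the prime field, so some `r ∈ R` realises it, and `r g`
  -- then commutes with `ψ`.
  have hRH : ∀ g, ∃ r ∈ R, r * g ∈ H := fun g => by
    let ρ' : Φ →ₗ[ZMod p] Φ := AddMonoidHom.toZModLinearMap p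
      { toFun := ρ g⁻¹
        map_zero' := Subtype.ext (by simp [ρ])
        map_add' := fun a b => Subtype.ext (by simp [ρ]) }
    have hμ : ∀ b, (ψ b - g (ψ (ρ g⁻¹ b))) ^ p = ψ b - g (ψ (ρ g⁻¹ b)) := fun b => by
      have h1 := congrArg g (hψ (ρ g⁻¹ b))
      rw [map_sub, map_pow, ← hρ, ← hρmul, mul_inv_cancel, hρ1, ← hψ b] at h1
      rw [sub_pow_char]
      linear_combination -h1
    obtain ⟨r, hr, hr'⟩ := hS (ψ - galLinear p g ∘ₗ ψ ∘ₗ ρ') hμ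
    refine ⟨r, hr, fun a => ?_⟩
    have h1 : r (ψ (ρ g a)) - ψ (ρ g a) = ψ (ρ g a) - g (ψ (ρ g⁻¹ (ρ g a))) := hr' (ρ g a)
    obtain ⟨z, hz⟩ := exists_zmod_eq_of_pow_eq p (hμ (ρ g a))
    have h2 := algEquiv_algebraMap_zmod p r z
    rw [hz, map_sub] at h2
    rw [← hρmul, inv_mul_cancel, hρ1] at h1 h2
    have h3 : ρ (r * g) a = ρ g a := by
      rw [hρmul]
      exact Subtype.ext ((algebraMap E N).injective ((hρ r _).trans (hRE r hr _)))
    rw [h3, AlgEquiv.mul_apply]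
    linear_combination h1 - h2
  refine ⟨IntermediateField.fixedField H, fun hQ => ?_, fun x hx hx0 =>
    exists_sub_algebraMap_lt p hC hd H hRH hx hx0⟩
  -- If the fixed field were `K`, all of `R` would commute with `ψ`. As `R` fixes `Φ` pointwise it
  -- would fix `ψ`, contradicting separation because `Φ ≠ 0`.
  have hH : H = ⊤ := by
    rw [← IntermediateField.fixingSubgroup_fixedField H, hQ, IntermediateField.fixingSubgroup_bot]
  obtain ⟨a, ha, ha0⟩ := Submodule.exists_mem_ne_zero_of_ne_bot hΦ
  refine ha0 (congrArg Subtype.val (hsep ⟨a, ha⟩ fun r hr => ?_))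
  have h1 : r ∈ H := by rw [hH]; trivial
  rw [h1]
  congr 1
  exact Subtype.ext ((algebraMap E N).injective ((hρ r _).trans (hRE r hr _)))

end DegreePStep

/-! ### Separable-algebraically maximal implies separably defectless -/

section Maximal

theorem Extends.immediate_of_dense {K L : Type*} [Field K] [Field L] [Algebra K L]
    {A : ValuationSubring K} {B : ValuationSubring L} (h : Extends A B)
    (hd : DenseLeadingTerms B (Set.range (algebraMap K L))) : h.Immediate := by
  refine ⟨(Subgroup.eq_top_iff' _).mpr fun g => ?_, fun y => ?_⟩
  · obtain ⟨x, hx⟩ := B.valuation_surjective (g : B.ValueGroup)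
    have hx0 : x ≠ 0 := by
      rintro rfl
      rw [map_zero] at hx
      exact g.ne_zero hx.symm
    obtain ⟨_, ⟨c, rfl⟩, hc⟩ := hd x hx0
    have hv := valuation_eq_of_sub_lt hc
    refine mem_valueSubgroup.mpr ⟨c, ?_, hv.trans hx⟩
    rintro rfl
    rw [map_zero, map_zero, hx] at hv
    exact g.ne_zero hv.symm
  · obtain ⟨b, rfl⟩ := residue_surjective y
    by_cases hb : IsUnit b
    · have hv1 := (B.valuation_eq_one_iff b).mp hb
      obtain ⟨_, ⟨c, rfl⟩, hc⟩ := hd b (by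
        intro h0
        rw [h0, map_zero] at hv1
        exact zero_ne_one hv1)
      have hv := (valuation_eq_of_sub_lt hc).trans hv1
      have hcA : c ∈ A := by
        rw [← h.algebraMap_mem_iff, ← B.valuation_le_one_iff, hv]
      refine ⟨residue A ⟨c, hcA⟩, ?_⟩
      rw [h.residueMap_residue, residue_eq_residue_iff, Valuation.map_sub_swap, ← hv1]
      exact hc
    · refine ⟨0, ?_⟩
      rw [map_zero, eq_comm, residue_eq_zero_iff]
      exact hb

theorem Extends.eq_of_extends {K L : Type*} [Field K] [Field L] [Algebra K L]
    [FiniteDimensional K L] [Algebra.IsSeparable K L] {A : ValuationSubring K}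
    [HenselianLocalRing A] {B B' : ValuationSubring L} (h : Extends A B) (h' : Extends A B') :
    B = B' := by
  ext x
  rw [h.mem_iff_isIntegral, h'.mem_iff_isIntegral]

theorem Extends.galoisInvariant {K L : Type*} [Field K] [Field L] [Algebra K L]
    [FiniteDimensional K L] [Algebra.IsSeparable K L] {A : ValuationSubring K}
    [HenselianLocalRing A] {B : ValuationSubring L} (h : Extends A B) : GaloisInvariant K B :=
  fun σ x => h.valuation_algEquiv σ x

theorem ramificationGroup_eq_bot_of_eq_top {K N : Type*} [Field K] [Field N] [Algebra K N]
    {C : ValuationSubring N} (hC : GaloisInvariant K C) (htop : C = ⊤) :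
    ramificationGroup hC = ⊥ := by
  refine (Subgroup.eq_bot_iff_forall _).mpr fun σ hσ => AlgEquiv.ext fun x => ?_
  by_contra hne
  have hx : x ≠ 0 := by
    rintro rfl
    exact hne (by simp)
  have hy0 : σ x - x ≠ 0 := sub_ne_zero.mpr hne
  have h1 := hσ x hx
  have h2 : C.valuation ((σ x - x)⁻¹ * x) ≤ 1 :=
    (C.valuation_le_one_iff _).mpr (by rw [htop]; trivial)
  rw [map_mul, map_inv₀, inv_mul_le_iff₀ (by simpa [zero_lt_iff] using hy0), mul_one] at h2
  exact absurd h1 (not_lt.mpr h2)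

theorem Extends.denseLeadingTerms {K N : Type*} [Field K] [Field N] [Algebra K N]
    [FiniteDimensional K N] [IsGalois K N] (p : ℕ) [Fact p.Prime] [CharP K p] [CharP N p]
    {A : ValuationSubring K} {C : ValuationSubring N} (h : Extends A C) (hA : A ≠ ⊤)
    (hd : DensePowers p A) (hC : GaloisInvariant K C) :
    DenseLeadingTerms C (IntermediateField.fixedField (ramificationGroup hC)) := by
  let T := IntermediateField.fixedField (ramificationGroup hC)
  let B : ValuationSubring T := C.comap (algebraMap T N)
  have hBC : Extends B C := rfl
  have hAB : Extends A B := h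
  have : CharP T p := (algebraMap T N).charP (algebraMap T N).injective p
  refine denseLeadingTerms_fixedField p hC fun y hy hy0 => ?_
  obtain ⟨b, hb⟩ := hAB.densePowers p hA hd ⟨y, hy⟩ ⟨y, hy⟩ (fun h0 => hy0 (congrArg Subtype.val h0))
  exact ⟨b, b.2, hBC.valuation_lt_iff.mpr hb⟩

theorem exists_finite_separable_roots (p : ℕ) [Fact p.Prime] (E : Type u) [Field E] [CharP E p]
    (s : Set E) (hs : s.Finite) :
    ∃ (L : Type u) (_ : Field L) (_ : Algebra E L), FiniteDimensional E L ∧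
      Algebra.IsSeparable E L ∧ ∀ a ∈ s, ∃ θ : L, θ ^ p - θ = algebraMap E L a := by
  have hp := (Fact.out : p.Prime).one_lt
  have hdeg : ∀ a : E, (X ^ p - X - Polynomial.C a : E[X]).natDegree = p := fun a => by
    rw [natDegree_sub_C, natDegree_sub_eq_left_of_natDegree_lt] <;> simp [hp]
  have hroot : ∀ a : E, ∃ θ : SeparableClosure E, θ ^ p - θ = algebraMap E _ a := fun a => by
    obtain ⟨θ, hθ⟩ := IsSepClosed.exists_aeval_eq_zero (SeparableClosure E)
      (X ^ p - X - Polynomial.C a : E[X]) (by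
        intro h0
        have := natDegree_eq_of_degree_eq_some h0
        rw [hdeg] at this
        exact (Fact.out : p.Prime).ne_zero this) (by
        rw [separable_def]
        have : derivative (X ^ p - X - Polynomial.C a : E[X]) = -1 := by
          simp [derivative_X_pow]
        rw [this]
        exact isCoprime_one_right.neg_right)
    refine ⟨θ, ?_⟩
    simpa [sub_eq_zero] using hθ
  choose θ hθ using hroot
  let L := IntermediateField.adjoin E (θ '' s)
  have : FiniteDimensional E L := by
    have : Finite (θ '' s) := (hs.image θ).to_subtype
    exact IntermediateField.finiteDimensional_adjoin fun x _ => Algebra.IsIntegral.isIntegral x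
  refine ⟨L, inferInstance, inferInstance, this, inferInstance, fun a ha => ?_⟩
  exact ⟨⟨θ a, IntermediateField.subset_adjoin E _ ⟨a, ha, rfl⟩⟩, Subtype.ext (hθ a)⟩

variable (p : ℕ) [Fact p.Prime] {K : Type u} [Field K] [CharP K p] {A : ValuationSubring K}
  [HenselianLocalRing A]

/-- A nontrivial ramification group yields a wild parameter over its fixed field `E`, hence a stable
space of parameters. Splitting these in a larger Galois extension `M` exposes a proper immediate
extension of `K`. -/
theorem SeparableAlgebraicallyMaximal.ramificationGroup_eq_bot
    (hmax : SeparableAlgebraicallyMaximal A) (hd : A ≠ ⊤ → DensePowers p A)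
    {N : Type u} [Field N] [Algebra K N] [FiniteDimensional K N] [IsGalois K N]
    {C : ValuationSubring N} (h : Extends A C) (hC : GaloisInvariant K C) :
    ramificationGroup hC = ⊥ := by
  by_cases hA : A = ⊤
  · refine ramificationGroup_eq_bot_of_eq_top hC (top_unique fun x _ => ?_)
    rw [h.mem_iff_norm_mem, hA]
    trivial
  by_contra hR
  have hchar : ∀ (F : Type u) [Field F] [Algebra K F], CharP F p := fun F _ _ =>
    charP_of_injective_algebraMap (algebraMap K F).injective p
  have := hchar N
  let E := IntermediateField.fixedField (ramificationGroup hC)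
  have := hchar E
  let B : ValuationSubring E := C.comap (algebraMap E N)
  have hBC : Extends B C := rfl
  have hAB : Extends A B := h
  have hB : GaloisInvariant K B := GaloisInvariant.of_extends hBC hC
  have hdC := h.denseLeadingTerms p hA (hd hA) hC
  have hRB : ramificationGroup hB = ⊥ := by
    refine ramificationGroup_eq_bot_of_dense hBC hB hC (fun σ hσ x => x.2 ⟨σ, hσ⟩) ?_
    intro x hx
    obtain ⟨e, he, hlt⟩ := hdC x hx
    exact ⟨e, ⟨⟨e, he⟩, rfl⟩, hlt⟩
  obtain ⟨w, hw, htr⟩ := exists_trace_eq_one p hB hRB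
  obtain ⟨a, ha, hay⟩ := exists_wild_element p hC hR
  let _ : Algebra (ZMod p) E := ZMod.algebra E p
  obtain ⟨Φ, hΦfin, hΦ, hΦσ, hΦB⟩ := exists_stable_subspace p hB hw htr (a := ⟨a, ha⟩)
    fun y hy => hay y y.2 hy
  have hfinite : Finite Φ := Module.finite_of_finite (ZMod p)
  obtain ⟨L, _, _, _, _, hroot⟩ := exists_finite_separable_roots p E Φ (Set.toFinite _)
  let _ : Algebra K L := ((algebraMap E L).comp (algebraMap K E)).toAlgebra
  have : IsScalarTower K E L := IsScalarTower.of_algebraMap_eq fun _ => rfl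
  have : FiniteDimensional K L := FiniteDimensional.trans K E L
  have : Algebra.IsSeparable K L := Algebra.IsSeparable.trans K E L
  obtain ⟨M, _, _, _, _, _, _⟩ := exists_isGalois_extension K L
  have := hchar M
  let _ : Algebra (ZMod p) M := ZMod.algebra M p
  let _ : Algebra E M := ((algebraMap L M).comp (algebraMap E L)).toAlgebra
  have : IsScalarTower K E M := IsScalarTower.of_algebraMap_eq fun x =>
    IsScalarTower.algebraMap_apply K L M x
  obtain ⟨D, hD⟩ := exists_extends (A := A) (L := M)
  have hDinv := hD.galoisInvariant
  -- `B` is the only extension of `A` to `E`, so `D` must restrict to it.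
  have hBD : Extends B D :=
    Extends.eq_of_extends (A := A) (B := D.comap (algebraMap E M)) (B' := B) (by
      ext x
      rw [ValuationSubring.mem_comap, ValuationSubring.mem_comap,
        ← IsScalarTower.algebraMap_apply, hD.algebraMap_mem_iff]) hAB
  obtain ⟨Q, hQ, hQd⟩ := exists_immediate_subextension p hBD hRB hDinv
    (hD.denseLeadingTerms p hA (hd hA) hDinv) Φ hΦ hΦσ hΦB fun a ha => by
      obtain ⟨θ, hθ⟩ := hroot a ha
      exact ⟨algebraMap L M θ, by rw [← map_pow, ← map_sub, hθ]; rfl⟩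
  let F : ValuationSubring Q := D.comap (algebraMap Q M)
  have hFD : Extends F D := rfl
  have hAF : Extends A F := hD
  have hsurj := hmax Q F hAF (hAF.immediate_of_dense fun x hx => by
    obtain ⟨c, hc⟩ := hQd x x.2 (by simpa using hx)
    exact ⟨algebraMap K Q c, ⟨c, rfl⟩, hFD.valuation_lt_iff.mp hc⟩)
  refine hQ (bot_unique fun x hx => ?_)
  obtain ⟨c, hc⟩ := hsurj ⟨x, hx⟩
  exact IntermediateField.mem_bot.mpr ⟨c, congrArg Subtype.val hc⟩

theorem SeparableAlgebraicallyMaximal.separablyDefectless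
    (hmax : SeparableAlgebraicallyMaximal A) (hd : A ≠ ⊤ → DensePowers p A) :
    SeparablyDefectless A := by
  intro L _ _ _ _ B h
  obtain ⟨N, _, _, _, _, _, _⟩ := exists_isGalois_extension K L
  obtain ⟨C, hC⟩ := exists_extends (A := A) (L := N)
  have hBC : Extends B C :=
    Extends.eq_of_extends (A := A) (B := C.comap (algebraMap L N)) (B' := B) (by
      ext x
      rw [ValuationSubring.mem_comap, ValuationSubring.mem_comap,
        ← IsScalarTower.algebraMap_apply, hC.algebraMap_mem_iff]) h
  exact h.finrank_eq_of_le hBC hC (finrank_le_of_ramificationGroup_eq_bot hC hC.galoisInvariant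
    (hmax.ramificationGroup_eq_bot p hd hC hC.galoisInvariant))

end Maximal

/-! ### Deep ramification as density; density and coarsening -/

section Coarsening

variable {K : Type*} [Field K] {A A' : ValuationSubring K}

theorem valuation_le_of_le (hle : A ≤ A') {x y : K} (h : A.valuation x ≤ A.valuation y) :
    A'.valuation x ≤ A'.valuation y := by
  by_cases hy : y = 0
  · rw [hy, map_zero, le_zero_iff, map_eq_zero] at h
    simp [h]
  have h1 : A.valuation y ≠ 0 := by simpa using hy
  have h2 : A'.valuation y ≠ 0 := by simpa using hy
  rw [← div_le_one₀ (zero_lt_iff.mpr h1), ← map_div₀, ValuationSubring.valuation_le_one_iff] at h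
  rw [← div_le_one₀ (zero_lt_iff.mpr h2), ← map_div₀, ValuationSubring.valuation_le_one_iff]
  exact hle h

theorem valuation_lt_of_le (hle : A ≤ A') {x y : K} (h : A'.valuation x < A'.valuation y) :
    A.valuation x < A.valuation y :=
  lt_of_not_ge fun hn => absurd h (not_lt.mpr (valuation_le_of_le hle hn))

theorem DeeplyRamified.densePowers {p : ℕ} [Fact p.Prime] (hA : DeeplyRamified p A) {t : K}
    (ht0 : t ≠ 0) (ht : A.valuation t < 1) : DensePowers p A := by
  have key : ∀ a s : K, a ∈ A → s ≠ 0 → A.valuation s < 1 →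
      ∃ b : K, A.valuation (a - b ^ p) ≤ A.valuation s := fun a s ha hs0 hs => by
    have hsA : s ∈ A := (A.valuation_le_one_iff _).mp hs.le
    obtain ⟨y, hy⟩ := hA ⟨s, hsA⟩ (fun h0 => hs0 (congrArg Subtype.val h0))
      ((A.valuation_lt_one_iff ⟨s, hsA⟩).mpr hs) (Ideal.Quotient.mk _ ⟨a, ha⟩)
    obtain ⟨b, rfl⟩ := Ideal.Quotient.mk_surjective y
    change (Ideal.Quotient.mk _ b) ^ p = _ at hy
    rw [← map_pow, eq_comm, Ideal.Quotient.eq, Ideal.mem_span_singleton'] at hy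
    obtain ⟨c, hc⟩ := hy
    have hc' : (c : K) * s = a - (b : K) ^ p := congrArg Subtype.val hc
    refine ⟨b, ?_⟩
    rw [← hc', map_mul]
    exact mul_le_of_le_one_left' ((A.valuation_le_one_iff _).mpr c.2)
  -- Deep ramification gives only a weak inequality, and only for moduli in the maximal ideal. The
  -- element `t` supplies the strictly smaller modulus.
  have hts : ∀ s : K, s ≠ 0 → ∃ s', s' ≠ 0 ∧ A.valuation s' < 1 ∧
      A.valuation s' < A.valuation s := fun s hs0 => by
    rcases le_or_gt 1 (A.valuation s) with h1 | h1
    · exact ⟨t, ht0, ht, ht.trans_le h1⟩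
    · have h2 : A.valuation (s * t) < A.valuation s := by
        rw [map_mul]
        exact mul_lt_of_lt_one_right (by simpa [zero_lt_iff] using hs0) ht
      exact ⟨s * t, mul_ne_zero hs0 ht0, h2.trans h1, h2⟩
  intro a s hs0
  -- Scaling by a `p`-th power reduces to integral `a` without affecting the question.
  obtain ⟨d, hd0, hda⟩ : ∃ d : K, d ≠ 0 ∧ a * d ^ p ∈ A := by
    by_cases ha : a ∈ A
    · exact ⟨1, one_ne_zero, by simpa using ha⟩
    · have hai := (A.mem_or_inv_mem a).resolve_left ha
      have ha0 : a ≠ 0 := by rintro rfl; exact ha A.zero_mem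
      refine ⟨a⁻¹, inv_ne_zero ha0, ?_⟩
      obtain ⟨k, hk⟩ : ∃ k, p = k + 1 := ⟨p - 1, (Nat.succ_pred_prime Fact.out).symm⟩
      rw [hk, pow_succ', ← mul_assoc, mul_inv_cancel₀ ha0, one_mul]
      exact pow_mem hai k
  have hdp : d ^ p ≠ 0 := pow_ne_zero _ hd0
  obtain ⟨s', hs'0, hs'1, hs's⟩ := hts (s * d ^ p) (mul_ne_zero hs0 hdp)
  obtain ⟨b, hb⟩ := key _ s' hda hs'0 hs'1
  refine ⟨b / d, ?_⟩
  have h1 : a - (b / d) ^ p = (a * d ^ p - b ^ p) / d ^ p := by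
    rw [div_pow]
    field_simp
  have h2 : 0 < A.valuation (d ^ p) := by simpa [zero_lt_iff] using hdp
  rw [h1, map_div₀, div_lt_iff₀ h2, ← map_mul]
  exact hb.trans_lt hs's

theorem DensePowers.of_le {p : ℕ} (hd : DensePowers p A) (hle : A ≤ A') (hA' : A' ≠ ⊤) :
    DensePowers p A' := by
  intro a s hs0
  obtain ⟨d, hdA⟩ : ∃ d : K, d ∉ A' := by
    by_contra! hd
    exact hA' (top_unique fun d _ => hd d)
  have hd0 : d ≠ 0 := by rintro rfl; exact hdA A'.zero_mem
  -- Coarsening preserves only weak inequalities. The factor `d⁻¹`, small for `A'`, restores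
  -- strictness.
  obtain ⟨b, hb⟩ := hd a (s * d⁻¹) (mul_ne_zero hs0 (inv_ne_zero hd0))
  refine ⟨b, (valuation_le_of_le hle hb.le).trans_lt ?_⟩
  rw [map_mul]
  refine mul_lt_of_lt_one_right (by simpa [zero_lt_iff] using hs0) ?_
  rw [← A'.valuation_le_one_iff, not_le] at hdA
  rw [map_inv₀]
  exact inv_lt_one_of_one_lt₀ hdA

theorem DensePowers.pow {p : ℕ} [Fact p.Prime] [CharP K p] (hd : DensePowers p A) (m : ℕ) (a s : K)
    (hs : s ≠ 0) : ∃ b : K, A.valuation (a - b ^ p ^ m) < A.valuation s := by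
  induction m generalizing a s with
  | zero => exact ⟨a, by simpa [zero_lt_iff] using hs⟩
  | succ m ih =>
    obtain ⟨b, hb⟩ := hd a s hs
    have hp := (Fact.out : p.Prime).ne_zero
    obtain ⟨s', hs'0, hs'⟩ : ∃ s' : K, s' ≠ 0 ∧ A.valuation s' ^ p ≤ A.valuation s := by
      rcases le_or_gt 1 (A.valuation s) with h1 | h1
      · exact ⟨1, one_ne_zero, by simpa using h1⟩
      · exact ⟨s, hs, pow_le_of_le_one zero_le h1.le hp⟩
    obtain ⟨c, hc⟩ := ih b s' hs'0
    refine ⟨c, ?_⟩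
    have h3 : a - c ^ p ^ (m + 1) = (a - b ^ p) + (b - c ^ p ^ m) ^ p := by
      rw [sub_pow_char, ← pow_mul, ← pow_succ]; ring
    rw [h3]
    refine Valuation.map_add_lt _ hb (lt_of_lt_of_le ?_ hs')
    rw [map_pow]
    exact pow_lt_pow_left₀ hc zero_le hp

variable {L : Type*} [Field L] [Algebra K L] {B : ValuationSubring L}

theorem Extends.coarsening (h : Extends A B) {t : K} (ht : t ∈ A) (ht0 : t ≠ 0) :
    Extends (coarsening A t) (coarsening B (algebraMap K L t)) := by
  ext x
  rw [ValuationSubring.mem_comap, mem_coarsening (h.algebraMap_mem ht) (by simpa using ht0),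
    mem_coarsening ht ht0]
  simp only [← map_pow, ← map_mul, h.algebraMap_mem_iff]

theorem valuation_coarsening_eq_one {t : K} (ht : t ∈ A) (ht0 : t ≠ 0) :
    (PointedVF.coarsening A t).valuation t = 1 := by
  refine le_antisymm ((ValuationSubring.valuation_le_one_iff _ _).mpr (le_coarsening A t ht)) ?_
  have h1 : t⁻¹ ∈ PointedVF.coarsening A t :=
    (mem_coarsening ht ht0).mpr ⟨1, by simp [ht0, A.one_mem]⟩
  rw [← ValuationSubring.valuation_le_one_iff, map_inv₀] at h1
  exact (inv_le_one₀ (by simpa [zero_lt_iff] using ht0)).mp h1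

theorem Extends.Immediate.denseLeadingTerms (h : Extends A B) (hi : h.Immediate) :
    DenseLeadingTerms B (Set.range (algebraMap K L)) := by
  intro x hx
  obtain ⟨c, hc, hcx⟩ := mem_valueSubgroup.mp
    (show Units.mk0 (B.valuation x) (by simpa using hx) ∈ valueSubgroup K B by
      rw [hi.1]; trivial)
  rw [Units.val_mk0] at hcx
  have hcL : algebraMap K L c ≠ 0 := by simpa using hc
  have hv0 : B.valuation (algebraMap K L c) ≠ 0 := by simpa using hc
  have hmem : x / algebraMap K L c ∈ B := by
    rw [← B.valuation_le_one_iff, map_div₀, hcx, div_self (hcx ▸ hv0)]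
  obtain ⟨y, hy⟩ := hi.2 (residue B ⟨_, hmem⟩)
  obtain ⟨a, rfl⟩ := residue_surjective y
  rw [h.residueMap_residue, eq_comm, residue_eq_residue_iff] at hy
  change B.valuation (x / algebraMap K L c - algebraMap K L a) < 1 at hy
  refine ⟨_, ⟨a * c, rfl⟩, ?_⟩
  have h1 : x - algebraMap K L (a * c) =
      (x / algebraMap K L c - algebraMap K L a) * algebraMap K L c := by
    rw [map_mul]
    field_simp
  rw [h1, map_mul, ← hcx]
  exact mul_lt_of_lt_one_left (zero_lt_iff.mpr hv0) hy

end Coarsening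

/-! ### Small-different generators imply maximality of the coarsening -/

section GeneratorsToMaximal

variable {K : Type u} [Field K] {A : ValuationSubring K} {t : K}

/-- The residue of `α` comes from `K`. A unit different makes it a simple root of the reduced
minimal polynomial, so Hensel's lemma gives that irreducible polynomial a root in `K`. -/
theorem algebraMap_surjective_of_dense [HenselianLocalRing A] {A' : ValuationSubring K}
    (hle : A ≤ A') {L : Type u} [Field L] [Algebra K L] [FiniteDimensional K L]
    [Algebra.IsSeparable K L] {B : ValuationSubring L} (h : Extends A' B)
    (hd : DenseLeadingTerms B (Set.range (algebraMap K L))) {α : L} (hα : α ∈ B)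
    (hgen : K⟮α⟯ = ⊤) (hδ : B.valuation (different K α) = 1) :
    Function.Surjective (algebraMap K L) := by
  have : HenselianLocalRing A' := henselianLocalRing_of_le hle
  have hint : IsIntegral A' α := h.mem_iff_isIntegral.mp hα
  set f := minpoly A' α with hf
  have hfK : minpoly K α = f.map (algebraMap A' K) :=
    minpoly.isIntegrallyClosed_eq_field_fractions' K hint
  have hfL : ∀ g : A'[X], ∀ x : B, ((eval₂ h.ringMap x g : B) : L) =
      eval₂ (algebraMap A' L) (x : L) g := fun g x => by
    change B.subtype _ = _
    rw [hom_eval₂]; rfl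
  obtain ⟨c, hc⟩ : ∃ c : A', B.valuation (α - algebraMap K L c) < 1 := by
    by_cases hv : B.valuation α < 1
    · exact ⟨0, by simpa using hv⟩
    · have hv1 : B.valuation α = 1 :=
        le_antisymm ((B.valuation_le_one_iff _).mpr hα) (not_lt.mp hv)
      obtain ⟨_, ⟨c, rfl⟩, hc⟩ := hd α (by
        rintro rfl
        rw [map_zero] at hv1
        exact zero_ne_one hv1)
      have hcA : c ∈ A' := by
        rw [← h.algebraMap_mem_iff, ← B.valuation_le_one_iff, valuation_eq_of_sub_lt hc, hv1]
      exact ⟨⟨c, hcA⟩, hv1 ▸ hc⟩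
  let α' : B := ⟨α, hα⟩
  have hres : residue B α' = residue B (h.ringMap c) := residue_eq_residue_iff.mpr hc
  have heval : ∀ g : A'[X], residue B (h.ringMap (g.eval c)) =
      residue B (eval₂ h.ringMap α' g) := fun g => by
    rw [hom_eval₂, hres, ← hom_eval₂, eval₂_hom]
  have hunit : ∀ a : A', h.residueMap (residue A' a) = residue B (h.ringMap a) := fun a => rfl
  obtain ⟨a, ha, -⟩ := HenselianLocalRing.is_henselian f (minpoly.monic hint) c
    (by
      rw [← residue_eq_zero_iff, ← map_eq_zero h.residueMap, hunit, heval]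
      have h1 : eval₂ h.ringMap α' f = 0 := Subtype.ext (by
        rw [hfL]
        exact minpoly.aeval A' α)
      rw [h1, map_zero])
    (by
      rw [← residue_ne_zero_iff_isUnit, ← map_ne_zero h.residueMap, hunit, heval,
        residue_ne_zero_iff_isUnit, B.valuation_eq_one_iff, hfL, ← hδ, different, hfK,
        derivative_map]
      congr 1
      rw [aeval_def, eval₂_map]
      rfl)
  have hdeg : (minpoly K α).degree = 1 := by
    refine degree_eq_one_of_irreducible_of_root (minpoly.irreducible (Algebra.IsIntegral.isIntegral α))
      (x := (a : K)) ?_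
    rw [hfK]
    exact ha.map (f := algebraMap A' K)
  have h1 := minpoly.mem_range_of_degree_eq_one K α hdeg
  intro x
  have hx : x ∈ K⟮α⟯ := by rw [hgen]; trivial
  have h2 : K⟮α⟯ = ⊥ := IntermediateField.adjoin_simple_eq_bot_iff.mpr
    (IntermediateField.mem_bot.mpr h1)
  rw [h2] at hx
  exact IntermediateField.mem_bot.mp hx

/-- Strict inequalities pass from the coarse to the fine valuation, so an extension immediate for
the coarsening has `e = 1` for `A`. The bound by `v(t)` then says that the different is a unit of
the coarsening. -/
theorem HasSmallDifferentGenerators.separableAlgebraicallyMaximal [HenselianLocalRing A]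
    (ht0 : t ≠ 0) (ht : A.valuation t < 1) (hg : HasSmallDifferentGenerators A t) :
    SeparableAlgebraicallyMaximal (coarsening A t) := by
  intro L _ _ _ B h hi x
  have htA : t ∈ A := (A.valuation_le_one_iff _).mp ht.le
  have hd := Extends.Immediate.denseLeadingTerms h hi
  let F := K⟮x⟯
  have : FiniteDimensional K F :=
    IntermediateField.adjoin.finiteDimensional (Algebra.IsIntegral.isIntegral x)
  have : Algebra.IsSeparable K F := Algebra.isSeparable_tower_bot_of_isSeparable K F L
  let B' : ValuationSubring F := B.comap (algebraMap F L)
  have hB'B : Extends B' B := rfl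
  have hAB' : Extends (coarsening A t) B' := h
  have hd' : DenseLeadingTerms B' (Set.range (algebraMap K F)) := fun y hy => by
    obtain ⟨_, ⟨c, rfl⟩, hc⟩ := hd y (by simpa using hy)
    exact ⟨_, ⟨c, rfl⟩, hB'B.valuation_lt_iff.mp hc⟩
  have : HenselianLocalRing (coarsening A t) := henselianLocalRing_of_le (le_coarsening A t)
  obtain ⟨C, hC⟩ := exists_extends (A := A) (L := F)
  have hCB : C ≤ B' := fun y hy => by
    rw [hAB'.mem_iff_norm_mem]
    exact le_coarsening A t (hC.mem_iff_norm_mem.mp hy)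
  have he : ramificationIndex K C = 1 := by
    refine Subgroup.index_eq_one.mpr ((Subgroup.eq_top_iff' _).mpr fun g => ?_)
    obtain ⟨y, hy⟩ := C.valuation_surjective (g : C.ValueGroup)
    have hy0 : y ≠ 0 := by
      rintro rfl
      rw [map_zero] at hy
      exact g.ne_zero hy.symm
    obtain ⟨_, ⟨c, rfl⟩, hc⟩ := hd' y hy0
    have hv := valuation_eq_of_sub_lt (valuation_lt_of_le hCB hc)
    refine mem_valueSubgroup.mpr ⟨c, ?_, hv.trans hy⟩
    rintro rfl
    rw [map_zero, map_zero, hy] at hv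
    exact g.ne_zero hv.symm
  obtain ⟨α, hα, hgen, hδ1, hδt⟩ := hg F C hC he
  have hδ : B'.valuation (different K α) = 1 := by
    refine le_antisymm ?_ ?_
    · have := valuation_le_of_le (x := different K α) (y := 1) hCB (by simpa using hδ1)
      simpa using this
    · refine le_trans ?_ (valuation_le_of_le hCB hδt)
      have := hAB'.valuation_le_iff (x := 1) (y := t)
      rw [map_one, map_one] at this
      rw [this, map_one, valuation_coarsening_eq_one htA ht0]
  obtain ⟨c, hc⟩ := algebraMap_surjective_of_dense (le_coarsening A t) hAB' hd' (hCB hα) hgen hδ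
    (IntermediateField.AdjoinSimple.gen K x)
  refine ⟨c, ?_⟩
  have := congrArg (algebraMap F L) hc
  rwa [IntermediateField.AdjoinSimple.algebraMap_gen] at this

end GeneratorsToMaximal

/-! ### Shrinking the different by approximate `p`-power roots -/

section Different

variable {K L N : Type*} [Field K] [Field L] [Field N] [Algebra K L] [Algebra L N] [Algebra K N]
  [IsScalarTower K L N] [FiniteDimensional K L] [Algebra.IsSeparable K L]

omit [FiniteDimensional K L] [Algebra.IsSeparable K L] in
theorem minpoly_map_splits [Normal K N] (x : L) :
    ((minpoly K x).map (algebraMap K N)).Splits := by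
  rw [← minpoly.algebraMap_eq (algebraMap L N).injective x]
  exact Normal.splits inferInstance _

open scoped Classical in
-- For a generator the embeddings correspond to the distinct roots of the minimal polynomial, and
-- the derivative at one root is the product of its differences with the others.
theorem algebraMap_different_eq_prod [Normal K N] {x : L} (hx : K⟮x⟯ = ⊤) :
    algebraMap L N (different K x) =
      ∏ ψ ∈ Finset.univ.erase (IsScalarTower.toAlgHom K L N), (algebraMap L N x - ψ x) := by
  have hA : ∀ x : L, ((minpoly K x).map (algebraMap K N)).Splits := minpoly_map_splits
  set f := (minpoly K x).map (algebraMap K N) with hf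
  set ι := IsScalarTower.toAlgHom K L N
  have hinj := (Field.primitive_element_iff_algHom_eq_of_eval' K N hA x).mp hx
  have hint : IsIntegral K x := Algebra.IsIntegral.isIntegral x
  have hf0 : f ≠ 0 := ((minpoly.monic hint).map _).ne_zero
  have hsep : f.Separable := Separable.map (show (minpoly K x).Separable from Algebra.IsSeparable.isSeparable K x)
  have hroots : f.roots = (Finset.univ : Finset (L →ₐ[K] N)).val.map fun ψ => ψ x := by
    refine (Multiset.Nodup.ext (nodup_roots hsep) (Finset.univ.nodup.map hinj)).mpr fun a => ?_
    have h1 := Set.ext_iff.mp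
      (Algebra.IsAlgebraic.range_eval_eq_rootSet_minpoly_of_splits (F := K) N hA x) a
    rw [mem_rootSet', Set.mem_range] at h1
    rw [mem_roots', Multiset.mem_map, IsRoot, eval_map_algebraMap, ← h1]
    simp only [Finset.mem_val, Finset.mem_univ, true_and]
  have hxr : algebraMap L N x ∈ f.roots := by
    rw [hroots]
    exact Multiset.mem_map.mpr ⟨ι, Finset.mem_univ _, rfl⟩
  have h2 := (hA x).eval_root_derivative ((minpoly.monic hint).map _) hxr
  rw [derivative_map, eval_map_algebraMap, aeval_algebraMap_apply] at h2
  change algebraMap L N (different K x) = _ at h2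
  rw [h2, ← hf, hroots]
  have h3 := Multiset.map_erase (fun ψ : L →ₐ[K] N => ψ x) hinj ι Finset.univ.val
  change _ = (Multiset.map _ _).erase (algebraMap L N x) at h3
  rw [← h3, Multiset.map_map, ← Finset.erase_val]
  rfl

omit [FiniteDimensional K L] [Algebra.IsSeparable K L] in
theorem adjoin_simple_smul_eq_top {c : K} (hc : c ≠ 0) {x : L} (hx : K⟮x⟯ = ⊤) :
    K⟮algebraMap K L c * x⟯ = ⊤ := by
  refine top_unique ?_
  rw [← hx, IntermediateField.adjoin_simple_le_iff]
  have h1 : x = algebraMap K L c⁻¹ * (algebraMap K L c * x) := by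
    rw [← mul_assoc, ← map_mul, inv_mul_cancel₀ hc, map_one, one_mul]
  have h2 := mul_mem (IntermediateField.algebraMap_mem K⟮algebraMap K L c * x⟯ c⁻¹)
    (IntermediateField.mem_adjoin_simple_self K (algebraMap K L c * x))
  rwa [← h1] at h2

variable {A : ValuationSubring K} {C : ValuationSubring L} [HenselianLocalRing A]

/-- Choose `α` with `α ^ p ^ m` closer to `β` than any two conjugates of `β` are to each other. Then
`(α - ψ α) ^ p ^ m` and `β - ψ β` have equal value for every other embedding `ψ`, so `δ(α)` has the
value of `δ(β)` divided by `p ^ m ≥ k`. -/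
theorem Extends.exists_small_different (p : ℕ) [Fact p.Prime] [CharP L p] (h : Extends A C)
    (hd : DensePowers p C) {t : K} (ht0 : t ≠ 0) (ht : A.valuation t < 1) {β : L} (hβ : β ∈ C)
    (hgen : K⟮β⟯ = ⊤) {k : ℕ}
    (hδ : C.valuation (algebraMap K L t ^ k) ≤ C.valuation (different K β)) :
    ∃ α : L, α ∈ C ∧ K⟮α⟯ = ⊤ ∧ C.valuation (different K α) ≤ 1 ∧
      C.valuation (algebraMap K L t) ≤ C.valuation (different K α) := by
  classical
  obtain ⟨N, _, _, _, _, _, _⟩ := exists_isGalois_extension K L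
  obtain ⟨D, hD⟩ := exists_extends (A := A) (L := N)
  have hCD : Extends C D :=
    Extends.eq_of_extends (A := A) (B := D.comap (algebraMap L N)) (B' := C) (by
      ext x
      rw [ValuationSubring.mem_comap, ValuationSubring.mem_comap,
        ← IsScalarTower.algebraMap_apply, hD.algebraMap_mem_iff]) h
  have : CharP N p := charP_of_injective_algebraMap (algebraMap L N).injective p
  have hA : ∀ x : L, ((minpoly K x).map (algebraMap K N)).Splits := minpoly_map_splits
  have hψC : ∀ (ψ : L →ₐ[K] N), ∀ x ∈ C, ψ x ∈ D := fun ψ x hx => by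
    refine hD.mem_of_isIntegral ?_
    exact (h.mem_iff_isIntegral.mp hx).map (ψ.restrictScalars A)
  let ι := IsScalarTower.toAlgHom K L N
  have htK : D.valuation (algebraMap K N t) < 1 := hD.valuation_lt_one_iff.mpr ht
  have htN : algebraMap K N t ≠ 0 := by simpa using ht0
  have htL : algebraMap K L t ≠ 0 := by simpa using ht0
  have hpos : ∀ j, 0 < D.valuation (algebraMap K N t ^ j) := fun j => by
    rw [map_pow]
    exact pow_pos (by simpa [zero_lt_iff] using ht0) j
  obtain ⟨m, hm⟩ : ∃ m, k ≤ p ^ m := ⟨k, (Nat.lt_pow_self (Fact.out : p.Prime).one_lt).le⟩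
  have hq0 : p ^ m ≠ 0 := pow_ne_zero _ (Fact.out : p.Prime).ne_zero
  -- The exponent `k + 1` leaves room: conjugates keep only a weak inequality, and the spare `t`
  -- makes it strict against `t ^ k`.
  obtain ⟨α, hα⟩ := hd.pow m β (algebraMap K L t ^ (k + 1)) (pow_ne_zero _ htL)
  have hψε : ∀ ψ : L →ₐ[K] N, D.valuation (ψ β - ψ α ^ p ^ m) < D.valuation (algebraMap K N t ^ k) :=
    fun ψ => by
      have h1 : (β - α ^ p ^ m) / algebraMap K L t ^ (k + 1) ∈ C := by
        rw [← C.valuation_le_one_iff, map_div₀]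
        exact div_le_one_of_le₀ hα.le zero_le
      have h2 := hψC ψ _ h1
      rw [map_div₀, map_pow, AlgHom.commutes, map_sub, map_pow, ← D.valuation_le_one_iff,
        map_div₀, div_le_one₀ (hpos _)] at h2
      refine h2.trans_lt ?_
      rw [pow_succ, map_mul]
      exact mul_lt_of_lt_one_right (hpos _) htK
  have hψβ : ∀ ψ : L →ₐ[K] N, D.valuation (ι β - ψ β) ≤ 1 := fun ψ =>
    (D.valuation_le_one_iff _).mpr (sub_mem (hψC ι β hβ) (hψC ψ β hβ))
  have hprod := algebraMap_different_eq_prod (N := N) hgen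
  have hδN : D.valuation (algebraMap K N t ^ k) ≤ D.valuation (algebraMap L N (different K β)) := by
    have := hCD.valuation_le_iff.mpr hδ
    rwa [map_pow, ← IsScalarTower.algebraMap_apply] at this
  have hlow : ∀ ψ : L →ₐ[K] N, ψ ≠ ι →
      D.valuation (algebraMap K N t ^ k) ≤ D.valuation (ι β - ψ β) := fun ψ hψ => by
    refine hδN.trans ?_
    rw [hprod, map_prod, ← Finset.mul_prod_erase _ _ (Finset.mem_erase.mpr ⟨hψ, Finset.mem_univ ψ⟩)]
    exact mul_le_of_le_one_right' (Finset.prod_le_one' fun φ _ => hψβ φ)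
  have hval : ∀ ψ : L →ₐ[K] N, ψ ≠ ι →
      D.valuation (ι α - ψ α) ^ p ^ m = D.valuation (ι β - ψ β) := fun ψ hψ => by
    rw [← map_pow, sub_pow_char_pow]
    have h1 : D.valuation (ι α ^ p ^ m - ψ α ^ p ^ m - (ι β - ψ β)) < D.valuation (ι β - ψ β) := by
      refine lt_of_lt_of_le ?_ (hlow ψ hψ)
      have h2 : ι α ^ p ^ m - ψ α ^ p ^ m - (ι β - ψ β) =
          (ψ β - ψ α ^ p ^ m) - (ι β - ι α ^ p ^ m) := by ring
      rw [h2]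
      exact Valuation.map_sub_lt _ (hψε ψ) (hψε ι)
    rw [Valuation.map_sub_swap] at h1
    exact valuation_eq_of_sub_lt h1
  have hαC : α ∈ C := by
    have h1 : α ^ p ^ m = β - (β - α ^ p ^ m) := by ring
    have h2 : C.valuation (α ^ p ^ m) ≤ 1 := by
      rw [h1]
      refine Valuation.map_sub_le _ ((C.valuation_le_one_iff _).mpr hβ) (hα.le.trans ?_)
      rw [map_pow]
      exact pow_le_one₀ zero_le (h.valuation_lt_one_iff.mpr ht).le
    rw [map_pow] at h2
    exact (C.valuation_le_one_iff _).mp ((pow_le_one_iff_of_nonneg zero_le hq0).mp h2)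
  have hgenα : K⟮α⟯ = ⊤ := by
    rw [Field.primitive_element_iff_algHom_eq_of_eval K N hA α ι]
    intro ψ hψ
    by_contra hne
    have h1 := hval ψ (Ne.symm hne)
    rw [hψ, sub_self, map_zero, zero_pow hq0] at h1
    have h2 := hlow ψ (Ne.symm hne)
    rw [← h1, le_zero_iff, map_eq_zero] at h2
    exact pow_ne_zero _ htN h2
  have hprodα := algebraMap_different_eq_prod (N := N) hgenα
  have hpow : D.valuation (algebraMap L N (different K α)) ^ p ^ m =
      D.valuation (algebraMap L N (different K β)) := by
    rw [hprodα, hprod, map_prod, map_prod, ← Finset.prod_pow]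
    exact Finset.prod_congr rfl fun ψ hψ => hval ψ (Finset.ne_of_mem_erase hψ)
  refine ⟨α, hαC, hgenα, ?_, ?_⟩
  · have h1 : D.valuation (algebraMap L N (different K α)) ≤ 1 := by
      rw [hprodα, map_prod]
      exact Finset.prod_le_one' fun ψ _ =>
        (D.valuation_le_one_iff _).mpr (sub_mem (hψC ι α hαC) (hψC ψ α hαC))
    have := hCD.valuation_le_iff (x := different K α) (y := 1)
    rw [map_one, map_one, map_one] at this
    exact this.mp h1
  · rw [← hCD.valuation_le_iff, ← IsScalarTower.algebraMap_apply]
    refine le_of_pow_le_pow_left₀ hq0 zero_le ?_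
    rw [hpow]
    refine le_trans ?_ hδN
    rw [map_pow]
    exact pow_le_pow_of_le_one zero_le htK.le hm

end Different

/-! ### Residue fields, value groups and lifting of residue generators -/

section Residue

variable {K L : Type*} [Field K] [Field L] [Algebra K L] [FiniteDimensional K L]
  [Algebra.IsSeparable K L] {A : ValuationSubring K} {B : ValuationSubring L}

/-- Since `[L : K] = f`, comparing degrees shows that the minimal polynomial of `β` reduces to that
of its residue. Separability of the latter makes the derivative at `β` a unit. -/
theorem Extends.valuation_different_eq_one [HenselianLocalRing A] (h : Extends A B)
    (hf : Module.finrank K L = h.inertiaDegree) (hs : h.ResidueSeparable) (β : B)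
    (hβ : letI := h.residueAlgebra; (ResidueField A)⟮residue B β⟯ = ⊤) :
    K⟮(β : L)⟯ = ⊤ ∧ B.valuation (different K (β : L)) = 1 := by
  let := h.residueAlgebra
  have hfin : FiniteDimensional (ResidueField A) (ResidueField B) := h.fundamental_inequality.2.1
  have hsep : Algebra.IsSeparable (ResidueField A) (ResidueField B) := hs
  have hint : IsIntegral A (β : L) := h.mem_iff_isIntegral.mp β.2
  set f := minpoly A (β : L) with hfdef
  have hfK : minpoly K (β : L) = f.map (algebraMap A K) :=
    minpoly.isIntegrallyClosed_eq_field_fractions' K hint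
  have hmonic : f.Monic := minpoly.monic hint
  have hdegK : (minpoly K (β : L)).natDegree = f.natDegree := by
    rw [hfK, hmonic.natDegree_map]
  have hfL : ∀ g : A[X], ((eval₂ h.ringMap β g : B) : L) = aeval (β : L) g := fun g => by
    change B.subtype _ = _
    rw [hom_eval₂]; rfl
  have heval : ∀ g : A[X], aeval (residue B β) (g.map (residue A)) =
      residue B (eval₂ h.ringMap β g) := fun g => by
    rw [hom_eval₂, aeval_def, eval₂_map]
    rfl
  have hn : (minpoly (ResidueField A) (residue B β)).natDegree = Module.finrank K L := by
    rw [hf]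
    exact (Field.primitive_element_iff_minpoly_natDegree_eq _ _).mp hβ
  have hle : f.natDegree ≤ Module.finrank K L := by
    rw [← hdegK]; exact minpoly.natDegree_le _
  have h0 : aeval (residue B β) (f.map (residue A)) = 0 := by
    rw [heval]
    have h1 : eval₂ h.ringMap β f = 0 := Subtype.ext (by
      rw [hfL]
      exact minpoly.aeval A (β : L))
    rw [h1, map_zero]
  have hmin : f.map (residue A) = minpoly (ResidueField A) (residue B β) :=
    eq_of_monic_of_dvd_of_natDegree_le
      (minpoly.monic (Algebra.IsIntegral.isIntegral _)) (hmonic.map _) (minpoly.dvd _ _ h0)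
      (by rw [hmonic.natDegree_map, hn]; exact hle)
  refine ⟨(Field.primitive_element_iff_minpoly_natDegree_eq _ _).mpr ?_, ?_⟩
  · rw [hdegK, ← hn, ← hmin, hmonic.natDegree_map]
  · have h1 : aeval (residue B β) (derivative (f.map (residue A))) ≠ 0 := by
      rw [hmin]
      exact (Algebra.IsSeparable.isSeparable _ _).aeval_derivative_ne_zero (minpoly.aeval _ _)
    rw [derivative_map, heval, residue_ne_zero_iff_isUnit, B.valuation_eq_one_iff, hfL] at h1
    rw [different, hfK, derivative_map, aeval_map_algebraMap]
    exact h1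

/-- Approximating modulo the maximal ideal makes every residue a `p`-th power. -/
theorem DensePowers.perfectField_residueField {p : ℕ} [Fact p.Prime] [CharP K p]
    (hd : DensePowers p A) : PerfectField (ResidueField A) := by
  have : CharP A p := (CharP.charP_iff_prime_eq_zero Fact.out).mpr (Subtype.ext (by simp))
  have : CharP (ResidueField A) p := (CharP.charP_iff_prime_eq_zero Fact.out).mpr (by
    rw [← map_natCast (residue A), CharP.cast_eq_zero A p, map_zero])
  have : ExpChar (ResidueField A) p := ExpChar.prime Fact.out
  have : PerfectRing (ResidueField A) p := PerfectRing.ofSurjective _ p fun y => by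
    obtain ⟨a, rfl⟩ := residue_surjective y
    obtain ⟨b, hb⟩ := hd a 1 one_ne_zero
    rw [map_one] at hb
    have hbA : b ∈ A := by
      have h1 : A.valuation (b ^ p) ≤ 1 := by
        have h2 : b ^ p = a - (a - b ^ p) := by ring
        rw [h2]
        exact Valuation.map_sub_le _ ((A.valuation_le_one_iff _).mpr a.2) hb.le
      rw [map_pow] at h1
      exact (A.valuation_le_one_iff _).mp
        ((pow_le_one_iff_of_nonneg zero_le (Fact.out : p.Prime).ne_zero).mp h1)
    refine ⟨residue A ⟨b, hbA⟩, ?_⟩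
    rw [frobenius_def, ← map_pow, eq_comm, residue_eq_residue_iff]
    exact hb
  exact PerfectRing.toPerfectField _ p

omit [Algebra.IsSeparable K L] in
theorem Extends.residueSeparable_of_densePowers {p : ℕ} [Fact p.Prime] [CharP K p]
    (h : Extends A B) (hd : DensePowers p A) : h.ResidueSeparable := by
  let := h.residueAlgebra
  have hfin : FiniteDimensional (ResidueField A) (ResidueField B) := h.fundamental_inequality.2.1
  have := hd.perfectField_residueField
  exact Algebra.IsAlgebraic.isSeparable_of_perfectField

/-- For the trivial valuation `K` maps to its own residue field, so separable polynomials over `K`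
transfer. -/
theorem Extends.residueSeparable_of_eq_top (h : Extends A B) (hA : A = ⊤) :
    h.ResidueSeparable := by
  let := h.residueAlgebra
  have hfin : FiniteDimensional (ResidueField A) (ResidueField B) := h.fundamental_inequality.2.1
  let φ : K →+* ResidueField A := (residue A).comp
    ((RingHom.id K).codRestrict A.toSubring fun x => by
      rw [hA]
      exact trivial)
  refine ⟨fun y => ?_⟩
  obtain ⟨b, rfl⟩ := residue_surjective y
  have hsep : (minpoly K (b : L)).Separable := Algebra.IsSeparable.isSeparable K (b : L)
  refine (Separable.map (f := φ) hsep).of_dvd (minpoly.dvd _ _ ?_)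
  have h1 : ∀ g : K[X], ∃ c : B, (c : L) = aeval (b : L) g ∧
      aeval (residue B b) (g.map φ) = residue B c := fun g => by
    let j : K →+* B := h.ringMap.comp ((RingHom.id K).codRestrict A.toSubring fun x => by
      rw [hA]
      exact trivial)
    refine ⟨eval₂ j b g, ?_, ?_⟩
    · change B.subtype _ = _
      rw [hom_eval₂]; rfl
    · rw [hom_eval₂, aeval_def, eval₂_map]
      rfl
  obtain ⟨c, hc, hc'⟩ := h1 (minpoly K (b : L))
  rw [minpoly.aeval] at hc
  rw [hc', show c = 0 from Subtype.ext hc, map_zero]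

omit [FiniteDimensional K L] [Algebra.IsSeparable K L] in
theorem ramificationIndex_eq_one_of_le {B' : ValuationSubring L} (hle : B ≤ B')
    (he : ramificationIndex K B = 1) : ramificationIndex K B' = 1 := by
  refine Subgroup.index_eq_one.mpr ((Subgroup.eq_top_iff' _).mpr fun g => ?_)
  obtain ⟨y, hy⟩ := B'.valuation_surjective (g : B'.ValueGroup)
  have hy0 : y ≠ 0 := by
    rintro rfl
    rw [map_zero] at hy
    exact g.ne_zero hy.symm
  obtain ⟨c, hc, hcy⟩ := mem_valueSubgroup.mp
    (show Units.mk0 (B.valuation y) (by simpa using hy0) ∈ valueSubgroup K B by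
      rw [Subgroup.index_eq_one.mp he]; trivial)
  rw [Units.val_mk0] at hcy
  exact mem_valueSubgroup.mpr ⟨c, hc, (le_antisymm (valuation_le_of_le hle hcy.le)
    (valuation_le_of_le hle hcy.ge)).trans hy⟩

theorem valuation_eq_one_of_eq_top (hB : B = ⊤) {x : L} (hx : x ≠ 0) : B.valuation x = 1 := by
  refine le_antisymm ((B.valuation_le_one_iff _).mpr (by rw [hB]; trivial)) ?_
  have h1 : x⁻¹ ∈ B := by rw [hB]; trivial
  rw [← B.valuation_le_one_iff, map_inv₀] at h1
  exact (inv_le_one₀ (by simpa [zero_lt_iff] using hx)).mp h1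

theorem Extends.eq_top [HenselianLocalRing A] (h : Extends A B) (hA : A = ⊤) : B = ⊤ :=
  top_unique fun x _ => by
    rw [h.mem_iff_norm_mem, hA]
    trivial

/-- Density makes the value group of `K` `p`-divisible. As ordered groups are torsion free, the
quotient of value groups has no element of order `p`, and Cauchy's theorem applies. -/
theorem Extends.not_dvd_ramificationIndex [HenselianLocalRing A] {p : ℕ} [Fact p.Prime]
    (h : Extends A B) (hd : A ≠ ⊤ → DensePowers p A) : ¬ p ∣ ramificationIndex K B := by
  have hp := (Fact.out : p.Prime)
  by_cases hA : A = ⊤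
  · have he : ramificationIndex K B = 1 := by
      refine Subgroup.index_eq_one.mpr ((Subgroup.eq_top_iff' _).mpr fun g => ?_)
      obtain ⟨y, hy⟩ := B.valuation_surjective (g : B.ValueGroup)
      have hy0 : y ≠ 0 := by
        rintro rfl
        rw [map_zero] at hy
        exact g.ne_zero hy.symm
      refine mem_valueSubgroup.mpr ⟨1, one_ne_zero, ?_⟩
      rw [map_one, map_one, ← hy, valuation_eq_one_of_eq_top (h.eq_top hA) hy0]
    rw [he]
    exact hp.one_lt.ne' ∘ Nat.dvd_one.mp
  · intro hdvd
    have hfin : Finite ((B.ValueGroup)ˣ ⧸ valueSubgroup K B) :=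
      (Subgroup.finiteIndex_iff_finite_quotient (H := valueSubgroup K B)).mp
        ⟨h.fundamental_inequality.1⟩
    obtain ⟨q, hq⟩ := exists_prime_orderOf_dvd_card' p hdvd
    obtain ⟨g, rfl⟩ := QuotientGroup.mk_surjective q
    have hgp : g ^ p ∈ valueSubgroup K B := by
      rw [← QuotientGroup.eq_one_iff, QuotientGroup.mk_pow, ← hq, pow_orderOf_eq_one]
    obtain ⟨c, hc, hcg⟩ := mem_valueSubgroup.mp hgp
    obtain ⟨b, hb⟩ := hd hA c c hc
    have hv := valuation_eq_of_sub_lt hb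
    have hb0 : b ≠ 0 := by
      rintro rfl
      rw [zero_pow hp.ne_zero, map_zero] at hv
      exact hc ((map_eq_zero _).mp hv.symm)
    have hg : g ∈ valueSubgroup K B := by
      refine mem_valueSubgroup.mpr ⟨b, hb0, ?_⟩
      have h1 : B.valuation (algebraMap K L b) ^ p = (g : B.ValueGroup) ^ p := by
        rw [← map_pow, ← map_pow, ← Units.val_pow_eq_pow_val, ← hcg]
        exact le_antisymm (h.valuation_le_iff.mpr hv.le) (h.valuation_le_iff.mpr hv.ge)
      exact (pow_left_inj₀ zero_le zero_le hp.ne_zero).mp h1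
    rw [← QuotientGroup.eq_one_iff] at hg
    rw [hg, orderOf_one] at hq
    exact hp.one_lt.ne hq

end Residue

/-! ### The equivalence of the three conditions, and tameness -/

section Equivalences

variable {p : ℕ} [Fact p.Prime] {K : Type u} [Field K] {A : ValuationSubring K} {t : K}

theorem separablyTame_iff [CharP K p] [HenselianLocalRing A] (hd : A ≠ ⊤ → DensePowers p A) :
    SeparablyTame p A ↔ SeparablyDefectless A := by
  constructor
  · intro h L _ _ _ _ B hB
    exact (h.2 L B hB).2.2
  · intro h
    refine ⟨inferInstance, fun L _ _ _ _ B hB => ⟨hB.not_dvd_ramificationIndex hd, ?_, h L B hB⟩⟩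
    by_cases hA : A = ⊤
    · exact hB.residueSeparable_of_eq_top hA
    · exact hB.residueSeparable_of_densePowers (hd hA)

theorem SeparablyDefectless.hasSmallDifferentGenerators [CharP K p] [HenselianLocalRing A]
    (ht0 : t ≠ 0) (ht : A.valuation t < 1) (hd : DensePowers p A)
    (hdef : SeparablyDefectless (coarsening A t)) : HasSmallDifferentGenerators A t := by
  intro L _ _ _ _ C h he
  have htA : t ∈ A := (A.valuation_le_one_iff _).mp ht.le
  have htL : algebraMap K L t ≠ 0 := by simpa using ht0
  have htC := h.algebraMap_mem htA
  have : CharP L p := charP_of_injective_algebraMap (algebraMap K L).injective p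
  have : HenselianLocalRing (coarsening A t) := henselianLocalRing_of_le (le_coarsening A t)
  have hA : A ≠ ⊤ := by
    rintro rfl
    exact ht.ne (valuation_eq_one_of_eq_top rfl ht0)
  have hw := h.coarsening htA ht0
  set B := coarsening C (algebraMap K L t) with hB
  have heB : ramificationIndex K B = 1 := ramificationIndex_eq_one_of_le (le_coarsening C _) he
  have hf := hdef L B hw
  rw [heB, one_mul] at hf
  obtain ⟨β, hβ, hgen, hδ⟩ : ∃ β ∈ C, K⟮β⟯ = ⊤ ∧ B.valuation (different K β) = 1 := by
    -- For a trivial coarsening every nonzero different has value one, so any primitive element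
    -- scaled into `C` will do.
    by_cases hAw : coarsening A t = ⊤
    · obtain ⟨β, hβ⟩ := Field.exists_primitive_element K L
      obtain ⟨s, hs0, hs⟩ : ∃ s : K, s ≠ 0 ∧ algebraMap K L s * β ∈ C := by
        by_cases hβ0 : β = 0
        · exact ⟨1, one_ne_zero, by simp [hβ0, C.zero_mem]⟩
        · obtain ⟨s, hs0, hs⟩ := h.exists_valuation_lt hA (inv_ne_zero hβ0)
          refine ⟨s, hs0, ?_⟩
          have hv : C.valuation β ≠ 0 := by simpa using hβ0
          rw [← C.valuation_le_one_iff, map_mul, ← inv_mul_cancel₀ hv, ← map_inv₀]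
          exact mul_le_mul_left hs.le _
      refine ⟨_, hs, adjoin_simple_smul_eq_top hs0 hβ, ?_⟩
      refine valuation_eq_one_of_eq_top (hw.eq_top hAw) ?_
      exact (Algebra.IsSeparable.isSeparable K _).aeval_derivative_ne_zero (minpoly.aeval _ _)
    · have hs := hw.residueSeparable_of_densePowers (hd.of_le (le_coarsening A t) hAw)
      let := hw.residueAlgebra
      have hfin : FiniteDimensional (ResidueField (coarsening A t)) (ResidueField B) :=
        hw.fundamental_inequality.2.1
      have hsep : Algebra.IsSeparable (ResidueField (coarsening A t)) (ResidueField B) := hs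
      obtain ⟨θ, hθ⟩ := Field.exists_primitive_element (ResidueField (coarsening A t))
        (ResidueField B)
      obtain ⟨b, rfl⟩ := residue_surjective θ
      -- The lift `b` is integral only for the coarsening. Multiplying by `t ^ k`, a unit there,
      -- moves it into `C` without losing the residue generator.
      obtain ⟨k, hk⟩ := (mem_coarsening htC htL).mp b.2
      let a : coarsening A t := ⟨t ^ k, pow_mem (le_coarsening A t htA) k⟩
      have ha : residue (coarsening A t) a ≠ 0 := by
        rw [residue_ne_zero_iff_isUnit, ValuationSubring.valuation_eq_one_iff]
        change (coarsening A t).valuation (t ^ k) = 1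
        rw [map_pow, valuation_coarsening_eq_one htA ht0, one_pow]
      have h1 := adjoin_simple_smul_eq_top ha hθ
      have h2 := hw.valuation_different_eq_one hf hs (hw.ringMap a * b) h1
      have h3 : ((hw.ringMap a * b : B) : L) = algebraMap K L t ^ k * b := by
        rw [← map_pow]; rfl
      rw [h3] at h2
      exact ⟨_, hk, h2⟩
  have hδ0 : different K β ≠ 0 := by
    intro h0
    rw [h0, map_zero] at hδ
    exact zero_ne_one hδ
  have hinv : (different K β)⁻¹ ∈ B := by
    rw [← B.valuation_le_one_iff, map_inv₀, hδ, inv_one]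
  -- Being a unit of `O[1/t]`, the different divides some power of `t`.
  obtain ⟨k, hk⟩ := (mem_coarsening htC htL).mp hinv
  refine h.exists_small_different p (h.densePowers p hA hd) ht0 ht hβ hgen (k := k) ?_
  rw [← C.valuation_le_one_iff, map_mul, map_inv₀, mul_inv_le_iff₀ (by simpa [zero_lt_iff] using hδ0),
    one_mul] at hk
  exact hk

theorem PointedDeeplyRamifiedHenselian.densePowers (h : PointedDeeplyRamifiedHenselian p A t) :
    DensePowers p A :=
  h.deeplyRamified.densePowers h.ne_zero h.lt_one

theorem PointedDeeplyRamifiedHenselian.tfae (h : PointedDeeplyRamifiedHenselian p A t) :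
    List.TFAE [SeparablyDefectless (coarsening A t), HasSmallDifferentGenerators A t,
      SeparableAlgebraicallyMaximal (coarsening A t)] := by
  have := h.charP
  have := h.henselian
  have : HenselianLocalRing (coarsening A t) := henselianLocalRing_of_le (le_coarsening A t)
  tfae_have 1 → 2 := fun hdef => hdef.hasSmallDifferentGenerators h.ne_zero h.lt_one h.densePowers
  tfae_have 2 → 3 := fun hg => hg.separableAlgebraicallyMaximal h.ne_zero h.lt_one
  tfae_have 3 → 1 := fun hmax =>
    hmax.separablyDefectless p (h.densePowers.of_le (le_coarsening A t))
  tfae_finish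

theorem PointedDeeplyRamifiedHenselian.separablyTame_iff (h : PointedDeeplyRamifiedHenselian p A t) :
    SeparablyTame p (coarsening A t) ↔ HasSmallDifferentGenerators A t := by
  have := h.charP
  have := h.henselian
  have : HenselianLocalRing (coarsening A t) := henselianLocalRing_of_le (le_coarsening A t)
  rw [PointedVF.separablyTame_iff (h.densePowers.of_le (le_coarsening A t))]
  exact h.tfae.out 0 1

end Equivalences

/-! ### First-order definability -/

section Definability

open Language

/-- A field with a subset and a distinguished element as a first-order structure. -/
@[reducible] def structureOf {K : Type u} [Field K] (O : Set K) (t : K) : lang.Structure K :=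
  letI : Language.ring.Structure K := (Ring.compatibleRingOfRing K).toStructure
  letI : pointVal.Structure K :=
    { funMap := fun {n} (f : PointFunc n) =>
        match n, f with
        | _, .t => fun _ => t
      RelMap := fun {n} (r : ValRel n) =>
        match n, r with
        | _, .O => fun x => x 0 ∈ O }
  Language.sumStructure Language.ring pointVal K

theorem toStructure_eq {K : Type u} [Field K] (A : ValuationSubring K) (t : K) :
    toStructure A t = structureOf (A : Set K) t := rfl

/-- A symbol of the language of rings. -/
abbrev ringSymbol {n : ℕ} (f : Language.ring.Functions n) : lang.Functions n := Sum.inl f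

/-- The constant symbol. -/
abbrev pointSymbol : lang.Functions 0 := Sum.inr (PointFunc.t : pointVal.Functions 0)

/-- The predicate symbol. -/
abbrev valSymbol : lang.Relations 1 := Sum.inr (ValRel.O : pointVal.Relations 1)

variable {α β : Type}

/-- A family of functions given by a term. -/
def TermDef (f : ∀ (K : Type u) [Field K], Set K → K → (α → K) → K) : Prop :=
  ∃ τ : lang.Term α, ∀ (K : Type u) [Field K] (O : Set K) (t : K) (v : α → K),
    @Term.realize lang K (structureOf O t) α v τ = f K O t v

/-- A family of relations given by a formula. -/
def FormulaDef (P : ∀ (K : Type u) [Field K], Set K → K → (α → K) → Prop) : Prop :=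
  ∃ φ : lang.Formula α, ∀ (K : Type u) [Field K] (O : Set K) (t : K) (v : α → K),
    @Formula.Realize lang K (structureOf O t) α φ v ↔ P K O t v

/-- A property of fields with a subset and a distinguished element given by a theory. -/
def TheoryDef (P : ∀ (K : Type u) [Field K], Set K → K → Prop) : Prop :=
  ∃ T : lang.Theory, ∀ (K : Type u) [Field K] (O : Set K) (t : K),
    @Theory.Model lang K (structureOf O t) T ↔ P K O t

/-- The closure rules from here on build terms and formulas along the shape of a semantic statement,
uniformly in the field, so that no syntax need be written out. -/
theorem TermDef.var (i : α) : TermDef.{u} fun _ _ _ _ v => v i := ⟨Term.var i, fun _ _ _ _ _ => rfl⟩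

theorem TermDef.const : TermDef.{u} (α := α) fun _ _ _ t _ => t :=
  ⟨Constants.term pointSymbol, fun _ _ _ _ _ => rfl⟩

theorem TermDef.zero : TermDef.{u} (α := α) fun _ _ _ _ _ => 0 :=
  ⟨Constants.term (ringSymbol Ring.zeroFunc), fun _ _ _ _ _ => rfl⟩

theorem TermDef.one : TermDef.{u} (α := α) fun _ _ _ _ _ => 1 :=
  ⟨Constants.term (ringSymbol Ring.oneFunc), fun _ _ _ _ _ => rfl⟩

variable {f g : ∀ (K : Type u) [Field K], Set K → K → (α → K) → K}

theorem TermDef.add (hf : TermDef f) (hg : TermDef g) :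
    TermDef fun K _ O t v => f K O t v + g K O t v := by
  obtain ⟨τ, hτ⟩ := hf
  obtain ⟨σ, hσ⟩ := hg
  refine ⟨Functions.apply₂ (ringSymbol Ring.addFunc) τ σ, fun K _ O t v => ?_⟩
  exact Eq.trans (by rfl) (congrArg₂ (· + ·) (hτ K O t v) (hσ K O t v))

theorem TermDef.mul (hf : TermDef f) (hg : TermDef g) :
    TermDef fun K _ O t v => f K O t v * g K O t v := by
  obtain ⟨τ, hτ⟩ := hf
  obtain ⟨σ, hσ⟩ := hg
  refine ⟨Functions.apply₂ (ringSymbol Ring.mulFunc) τ σ, fun K _ O t v => ?_⟩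
  exact Eq.trans (by rfl) (congrArg₂ (· * ·) (hτ K O t v) (hσ K O t v))

theorem TermDef.neg (hf : TermDef f) : TermDef fun K _ O t v => -f K O t v := by
  obtain ⟨τ, hτ⟩ := hf
  refine ⟨Functions.apply₁ (ringSymbol Ring.negFunc) τ, fun K _ O t v => ?_⟩
  exact Eq.trans (by rfl) (congrArg (- ·) (hτ K O t v))

theorem TermDef.sub (hf : TermDef f) (hg : TermDef g) :
    TermDef fun K _ O t v => f K O t v - g K O t v := by
  simpa only [sub_eq_add_neg] using hf.add hg.neg

theorem TermDef.natCast (n : ℕ) : TermDef.{u} (α := α) fun _ _ _ _ _ => (n : _) := by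
  induction n with
  | zero => simpa only [Nat.cast_zero] using TermDef.zero
  | succ n ih => simpa only [Nat.cast_succ] using ih.add TermDef.one

theorem TermDef.intCast (n : ℤ) : TermDef.{u} (α := α) fun _ _ _ _ _ => (n : _) := by
  cases n with
  | ofNat n => simpa only [Int.ofNat_eq_natCast, Int.cast_natCast] using TermDef.natCast n
  | negSucc n => simpa only [Int.cast_negSucc] using (TermDef.natCast (n + 1)).neg

theorem TermDef.pow (hf : TermDef f) (n : ℕ) : TermDef fun K _ O t v => f K O t v ^ n := by
  induction n with
  | zero => simpa only [pow_zero] using TermDef.one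
  | succ n ih => simpa only [pow_succ] using ih.mul hf

theorem TermDef.sum {ι : Type*} (s : Finset ι)
    {f : ι → ∀ (K : Type u) [Field K], Set K → K → (α → K) → K} (hf : ∀ i, TermDef (f i)) :
    TermDef fun K _ O t v => ∑ i ∈ s, f i K O t v := by
  classical
  induction s using Finset.induction_on with
  | empty => simpa only [Finset.sum_empty] using TermDef.zero
  | insert a s ha ih => simpa only [Finset.sum_insert ha] using (hf a).add ih

theorem TermDef.prod {ι : Type*} (s : Finset ι)
    {f : ι → ∀ (K : Type u) [Field K], Set K → K → (α → K) → K} (hf : ∀ i, TermDef (f i)) :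
    TermDef fun K _ O t v => ∏ i ∈ s, f i K O t v := by
  classical
  induction s using Finset.induction_on with
  | empty => simpa only [Finset.prod_empty] using TermDef.one
  | insert a s ha ih => simpa only [Finset.prod_insert ha] using (hf a).mul ih

/-- A family of matrices given by terms. -/
def MatrixDef {n : ℕ}
    (M : ∀ (K : Type u) [Field K], Set K → K → (α → K) → Matrix (Fin n) (Fin n) K) : Prop :=
  ∀ i j, TermDef fun K _ O t v => M K O t v i j

section Matrix

variable {n : ℕ} {M N : ∀ (K : Type u) [Field K], Set K → K → (α → K) → Matrix (Fin n) (Fin n) K}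

theorem MatrixDef.one :
    MatrixDef.{u} (α := α) fun _ _ _ _ _ => (1 : Matrix (Fin n) (Fin n) _) := fun i j => by
  by_cases h : i = j
  · subst h
    simpa only [Matrix.one_apply_eq] using TermDef.one
  · simpa only [Matrix.one_apply_ne h] using TermDef.zero

theorem MatrixDef.mul (hM : MatrixDef M) (hN : MatrixDef N) :
    MatrixDef fun K _ O t v => M K O t v * N K O t v := fun i j => by
  simpa only [Matrix.mul_apply] using TermDef.sum _ fun k => (hM i k).mul (hN k j)

theorem MatrixDef.pow (hM : MatrixDef M) (k : ℕ) : MatrixDef fun K _ O t v => M K O t v ^ k := by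
  induction k with
  | zero => simpa only [pow_zero] using MatrixDef.one
  | succ n ih => simpa only [pow_succ] using ih.mul hM

theorem MatrixDef.add (hM : MatrixDef M) (hN : MatrixDef N) :
    MatrixDef fun K _ O t v => M K O t v + N K O t v := fun i j => by
  simpa only [Matrix.add_apply] using (hM i j).add (hN i j)

theorem MatrixDef.smul (hf : TermDef f) (hM : MatrixDef M) :
    MatrixDef fun K _ O t v => f K O t v • M K O t v := fun i j => by
  simpa only [Matrix.smul_apply, smul_eq_mul] using hf.mul (hM i j)

theorem MatrixDef.sum {ι : Type*} (s : Finset ι)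
    {M : ι → ∀ (K : Type u) [Field K], Set K → K → (α → K) → Matrix (Fin n) (Fin n) K}
    (hM : ∀ i, MatrixDef (M i)) : MatrixDef fun K _ O t v => ∑ i ∈ s, M i K O t v := fun i j => by
  simpa only [Matrix.sum_apply] using TermDef.sum s fun k => hM k i j

theorem MatrixDef.det (hM : MatrixDef M) : TermDef fun K _ O t v => (M K O t v).det := by
  simpa only [Matrix.det_apply'] using TermDef.sum Finset.univ fun σ : Equiv.Perm (Fin n) =>
    (TermDef.intCast (Equiv.Perm.sign σ : ℤ)).mul (TermDef.prod Finset.univ fun i => hM (σ i) i)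

end Matrix

variable {P Q : ∀ (K : Type u) [Field K], Set K → K → (α → K) → Prop}

theorem TermDef.eq (hf : TermDef f) (hg : TermDef g) :
    FormulaDef fun K _ O t v => f K O t v = g K O t v := by
  obtain ⟨τ, hτ⟩ := hf
  obtain ⟨σ, hσ⟩ := hg
  refine ⟨τ.equal σ, fun K _ O t v => ?_⟩
  let := structureOf O t
  rw [Formula.realize_equal, hτ, hσ]

theorem TermDef.mem (hf : TermDef f) : FormulaDef fun K _ O t v => f K O t v ∈ O := by
  obtain ⟨τ, hτ⟩ := hf
  refine ⟨Relations.formula₁ valSymbol τ, fun K _ O t v => ?_⟩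
  let := structureOf O t
  rw [Formula.realize_rel₁, hτ]
  rfl

theorem FormulaDef.not (hP : FormulaDef P) : FormulaDef fun K _ O t v => ¬ P K O t v := by
  obtain ⟨φ, hφ⟩ := hP
  refine ⟨φ.not, fun K _ O t v => ?_⟩
  let := structureOf O t
  rw [Formula.realize_not, hφ]

theorem FormulaDef.and (hP : FormulaDef P) (hQ : FormulaDef Q) :
    FormulaDef fun K _ O t v => P K O t v ∧ Q K O t v := by
  obtain ⟨φ, hφ⟩ := hP
  obtain ⟨ψ, hψ⟩ := hQ
  refine ⟨φ ⊓ ψ, fun K _ O t v => ?_⟩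
  let := structureOf O t
  rw [Formula.realize_inf, hφ, hψ]

theorem FormulaDef.or (hP : FormulaDef P) (hQ : FormulaDef Q) :
    FormulaDef fun K _ O t v => P K O t v ∨ Q K O t v := by
  obtain ⟨φ, hφ⟩ := hP
  obtain ⟨ψ, hψ⟩ := hQ
  refine ⟨φ ⊔ ψ, fun K _ O t v => ?_⟩
  let := structureOf O t
  rw [Formula.realize_sup, hφ, hψ]

theorem FormulaDef.imp (hP : FormulaDef P) (hQ : FormulaDef Q) :
    FormulaDef fun K _ O t v => P K O t v → Q K O t v := by
  obtain ⟨φ, hφ⟩ := hP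
  obtain ⟨ψ, hψ⟩ := hQ
  refine ⟨φ.imp ψ, fun K _ O t v => ?_⟩
  let := structureOf O t
  rw [Formula.realize_imp, hφ, hψ]

theorem FormulaDef.true : FormulaDef.{u} (α := α) fun _ _ _ _ _ => True := by
  simpa only [eq_self_iff_true] using TermDef.zero.eq TermDef.zero

theorem FormulaDef.forall_mem {ι : Type*} (s : Finset ι)
    {P : ι → ∀ (K : Type u) [Field K], Set K → K → (α → K) → Prop} (hP : ∀ i, FormulaDef (P i)) :
    FormulaDef fun K _ O t v => ∀ i ∈ s, P i K O t v := by
  classical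
  induction s using Finset.induction_on with
  | empty => simpa using FormulaDef.true
  | insert a s ha ih => simpa only [Finset.forall_mem_insert] using (hP a).and ih

theorem FormulaDef.finite_forall {ι : Type*} [Fintype ι]
    {P : ι → ∀ (K : Type u) [Field K], Set K → K → (α → K) → Prop} (hP : ∀ i, FormulaDef (P i)) :
    FormulaDef fun K _ O t v => ∀ i, P i K O t v := by
  simpa using FormulaDef.forall_mem Finset.univ hP

theorem MatrixDef.eq {n : ℕ}
    {M N : ∀ (K : Type u) [Field K], Set K → K → (α → K) → Matrix (Fin n) (Fin n) K}
    (hM : MatrixDef M) (hN : MatrixDef N) :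
    FormulaDef fun K _ O t v => M K O t v = N K O t v := by
  simpa only [← Matrix.ext_iff] using FormulaDef.finite_forall fun i =>
    FormulaDef.finite_forall fun j => (hM i j).eq (hN i j)

theorem FormulaDef.exists [Finite β]
    {P : ∀ (K : Type u) [Field K], Set K → K → (α → K) → (β → K) → Prop}
    (hP : FormulaDef fun K _ O t u => P K O t (fun i => u (Sum.inl i)) fun i => u (Sum.inr i)) :
    FormulaDef fun K _ O t v => ∃ w, P K O t v w := by
  obtain ⟨φ, hφ⟩ := hP
  refine ⟨φ.iExs β, fun K _ O t v => ?_⟩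
  let := structureOf O t
  rw [Formula.realize_iExs]
  exact exists_congr fun w => hφ K O t (Sum.elim v w)

theorem FormulaDef.forall [Finite β]
    {P : ∀ (K : Type u) [Field K], Set K → K → (α → K) → (β → K) → Prop}
    (hP : FormulaDef fun K _ O t u => P K O t (fun i => u (Sum.inl i)) fun i => u (Sum.inr i)) :
    FormulaDef fun K _ O t v => ∀ w, P K O t v w := by
  obtain ⟨φ, hφ⟩ := hP
  refine ⟨φ.iAlls β, fun K _ O t v => ?_⟩
  let := structureOf O t
  rw [Formula.realize_iAlls]
  exact forall_congr' fun w => hφ K O t (Sum.elim v w)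

theorem FormulaDef.exists_elem {P : ∀ (K : Type u) [Field K], Set K → K → (α → K) → K → Prop}
    (hP : FormulaDef fun K _ O t (u : α ⊕ Unit → K) =>
      P K O t (fun i => u (Sum.inl i)) (u (Sum.inr ()))) :
    FormulaDef fun K _ O t v => ∃ x, P K O t v x := by
  have h := FormulaDef.exists (β := Unit) (P := fun K _ O t v w => P K O t v (w ())) hP
  convert h using 6 with K _ O t v
  exact ⟨fun ⟨x, hx⟩ => ⟨fun _ => x, hx⟩, fun ⟨w, hw⟩ => ⟨w (), hw⟩⟩

theorem FormulaDef.forall_elem {P : ∀ (K : Type u) [Field K], Set K → K → (α → K) → K → Prop}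
    (hP : FormulaDef fun K _ O t (u : α ⊕ Unit → K) =>
      P K O t (fun i => u (Sum.inl i)) (u (Sum.inr ()))) :
    FormulaDef fun K _ O t v => ∀ x, P K O t v x := by
  have h := FormulaDef.forall (β := Unit) (P := fun K _ O t v w => P K O t v (w ())) hP
  convert h using 6 with K _ O t v
  exact ⟨fun h w => h (w ()), fun h x => h fun _ => x⟩

theorem FormulaDef.theoryDef {P : ∀ (K : Type u) [Field K], Set K → K → Prop}
    (hP : FormulaDef (α := Empty) fun K _ O t _ => P K O t) : TheoryDef P := by
  obtain ⟨φ, hφ⟩ := hP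
  refine ⟨{φ}, fun K _ O t => ?_⟩
  let := structureOf O t
  rw [Theory.model_iff]
  refine Iff.trans ?_ (hφ K O t default)
  simp only [Set.mem_singleton_iff, forall_eq]
  rfl

theorem TheoryDef.and {P Q : ∀ (K : Type u) [Field K], Set K → K → Prop} (hP : TheoryDef P)
    (hQ : TheoryDef Q) : TheoryDef fun K _ O t => P K O t ∧ Q K O t := by
  obtain ⟨T, hT⟩ := hP
  obtain ⟨S, hS⟩ := hQ
  refine ⟨T ∪ S, fun K _ O t => ?_⟩
  refine Iff.trans ?_ (and_congr (hT K O t) (hS K O t))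
  simp only [Theory.model_iff, Set.mem_union, or_imp, forall_and]

theorem TheoryDef.forall {ι : Sort*} {P : ι → ∀ (K : Type u) [Field K], Set K → K → Prop}
    (hP : ∀ i, TheoryDef (P i)) : TheoryDef fun K _ O t => ∀ i, P i K O t := by
  choose T hT using hP
  refine ⟨⋃ i, T i, fun K _ O t => ?_⟩
  simp only [← hT, Theory.model_iff, Set.mem_iUnion, forall_exists_index]
  exact forall_comm

/-- The field axioms recover the field operations, and the remaining two symbols are read off as a
subset and a point. -/
theorem exists_eq_structureOf {M : Type u} (S : lang.Structure M)
    (hS : M ⊨ (LHom.sumInl : Language.ring →ᴸ lang).onTheory Theory.field) :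
    ∃ (_ : Field M) (O : Set M) (t : M), S = structureOf O t := by
  let S₀ : Language.ring.Structure M := (LHom.sumInl : Language.ring →ᴸ lang).reduct M
  have hM : M ⊨ Theory.field := (LHom.onTheory_model _ _).mp hS
  let := FirstOrder.Field.fieldOfModelField M
  let R := FirstOrder.Field.compatibleRingOfModelField M
  refine ⟨inferInstance, {x | S.RelMap valSymbol ![x]},
    S.funMap pointSymbol ![], ?_⟩
  refine Language.Structure.ext ?_ ?_
  · funext n f x
    rcases f with f | f
    · cases f
      · exact R.funMap_add x
      · exact R.funMap_mul x
      · exact R.funMap_neg x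
      · exact R.funMap_zero x
      · exact R.funMap_one x
    · cases f
      exact congrArg _ (Subsingleton.elim _ _)
  · funext n r x
    rcases r with r | r
    · exact r.elim
    · cases r
      refine congrArg _ (funext fun i => ?_)
      rw [Subsingleton.elim i 0]
      rfl

theorem model_field_structureOf {K : Type u} [Field K] (O : Set K) (t : K) :
    @Theory.Model lang K (structureOf O t)
      ((LHom.sumInl : Language.ring →ᴸ lang).onTheory Theory.field) := by
  let := structureOf O t
  let := Ring.compatibleRingOfRing K
  have : (LHom.sumInl : Language.ring →ᴸ lang).IsExpansionOn K :=
    ⟨fun _ _ => rfl, fun _ _ => rfl⟩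
  rw [LHom.onTheory_model]
  infer_instance

/-- Adjoining the field axioms reduces arbitrary structures of the language to fields with a subset
and a point. -/
theorem TheoryDef.isElementary {P : ∀ (K : Type u) [Field K], Set K → K → Prop} (hP : TheoryDef P)
    {C : ∀ (K : Type u) [Field K], ValuationSubring K → K → Prop}
    (hC : ∀ (K : Type u) [Field K] (O : Set K) (t : K),
      P K O t ↔ ∃ A : ValuationSubring K, (A : Set K) = O ∧ C K A t) : IsElementary C := by
  obtain ⟨T, hT⟩ := hP
  refine ⟨(LHom.sumInl : Language.ring →ᴸ lang).onTheory Theory.field ∪ T, fun M S => ?_⟩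
  constructor
  · intro h
    have h1 : M ⊨ (LHom.sumInl : Language.ring →ᴸ lang).onTheory Theory.field :=
      h.mono Set.subset_union_left
    have h2 : M ⊨ T := h.mono Set.subset_union_right
    obtain ⟨_, O, t, rfl⟩ := exists_eq_structureOf S h1
    obtain ⟨A, rfl, hA⟩ := (hC M O t).mp ((hT M O t).mp h2)
    exact ⟨inferInstance, A, t, rfl, hA⟩
  · rintro ⟨_, A, t, rfl, hA⟩
    have h1 := model_field_structureOf (A : Set M) t
    have h2 := (hT M A t).mpr ((hC M A t).mpr ⟨A, rfl, hA⟩)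
    rw [toStructure_eq]
    let := structureOf (A : Set M) t
    exact Theory.model_union_iff.mpr ⟨h1, h2⟩

end Definability

/-! ### Monic polynomials by their coefficient vectors -/

section MonicPolynomial

variable {R : Type*} [CommRing R] {n : ℕ}

/-- The monic polynomial `X ^ n + ∑ aᵢ Xⁱ`. -/
noncomputable def monicPolynomial (a : Fin n → R) : R[X] :=
  X ^ n + ∑ i, Polynomial.C (a i) * X ^ (i : ℕ)

theorem degree_sum_C_mul_X_pow_lt (a : Fin n → R) :
    degree (∑ i, Polynomial.C (a i) * X ^ (i : ℕ) : R[X]) < (n : WithBot ℕ) := degree_sum_fin_lt a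

theorem monic_monicPolynomial (a : Fin n → R) : (monicPolynomial a).Monic :=
  monic_X_pow_add (degree_sum_C_mul_X_pow_lt a)

theorem natDegree_monicPolynomial [Nontrivial R] (a : Fin n → R) :
    (monicPolynomial a).natDegree = n := by
  rw [monicPolynomial, natDegree_add_eq_left_of_degree_lt, natDegree_X_pow]
  rw [degree_X_pow]
  exact degree_sum_C_mul_X_pow_lt a

theorem Monic.eq_monicPolynomial {f : R[X]} (hf : f.Monic) (hn : f.natDegree = n) :
    f = monicPolynomial fun i : Fin n => f.coeff i := by
  subst hn
  nth_rewrite 1 [hf.as_sum]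
  rw [Finset.sum_range]
  rfl

theorem coeff_monicPolynomial (a : Fin n → R) (i : Fin n) : (monicPolynomial a).coeff i = a i := by
  rw [monicPolynomial, coeff_add, coeff_X_pow, if_neg i.2.ne, zero_add, finsetSum_coeff]
  simp only [coeff_C_mul_X_pow]
  rw [Finset.sum_eq_single i]
  · simp
  · intro j _ hj
    exact if_neg fun h => hj (Fin.ext h.symm)
  · simp

variable {S : Type*} [Ring S] [Algebra R S]

theorem aeval_monicPolynomial (a : Fin n → R) (x : S) :
    aeval x (monicPolynomial a) = x ^ n + ∑ i, a i • x ^ (i : ℕ) := by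
  simp [monicPolynomial, Algebra.smul_def]

theorem aeval_derivative_monicPolynomial (a : Fin n → R) (x : S) :
    aeval x (derivative (monicPolynomial a)) =
      (n : R) • x ^ (n - 1) + ∑ i : Fin n, (a i * (i : ℕ)) • x ^ ((i : ℕ) - 1) := by
  simp [monicPolynomial, Algebra.smul_def, derivative_X_pow, mul_assoc]

end MonicPolynomial

/-! ### Axioms for pointed deeply ramified henselian valued fields -/

section Axioms

variable {K : Type u} [Field K]

/-- The set `O` is a valuation ring. -/
def IsValuationSet (O : Set K) : Prop :=
  1 ∈ O ∧ (∀ x y, x ∈ O → y ∈ O → x + y ∈ O ∧ x * y ∈ O) ∧ (∀ x, x ∈ O → -x ∈ O) ∧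
    ∀ x, x ∈ O ∨ ∃ y, y ∈ O ∧ x * y = 1

theorem isValuationSet_iff (O : Set K) :
    IsValuationSet O ↔ ∃ A : ValuationSubring K, (A : Set K) = O := by
  constructor
  · rintro ⟨h1, h2, h3, h4⟩
    have h0 : (0 : K) ∈ O := by
      rw [← add_neg_cancel (1 : K)]
      exact (h2 _ _ h1 (h3 _ h1)).1
    refine ⟨{ carrier := O, mul_mem' := fun hx hy => (h2 _ _ hx hy).2, one_mem' := h1,
              add_mem' := fun hx hy => (h2 _ _ hx hy).1, zero_mem' := h0,
              neg_mem' := fun hx => h3 _ hx, mem_or_inv_mem' := fun x => ?_ }, rfl⟩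
    refine (h4 x).imp_right ?_
    rintro ⟨y, hy, hxy⟩
    rwa [← eq_inv_of_mul_eq_one_right hxy]
  · rintro ⟨A, rfl⟩
    refine ⟨A.one_mem, fun x y hx hy => ⟨A.add_mem x y hx hy, A.mul_mem x y hx hy⟩,
      fun x hx => A.neg_mem x hx, fun x => ?_⟩
    by_cases hx : x ∈ A
    · exact Or.inl hx
    · refine Or.inr ⟨x⁻¹, (A.mem_or_inv_mem x).resolve_left hx, mul_inv_cancel₀ ?_⟩
      rintro rfl
      exact hx A.zero_mem

theorem theoryDef_isValuationSet : TheoryDef.{u} fun _ _ O _ => IsValuationSet O := by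
  refine FormulaDef.theoryDef ?_
  refine TermDef.one.mem.and (.and ?_ (.and ?_ ?_))
  · refine .forall_elem (.forall_elem ?_)
    refine .imp (TermDef.mem (.var _)) (.imp (TermDef.mem (.var _)) ?_)
    exact .and (TermDef.mem (.add (.var _) (.var _))) (TermDef.mem (.mul (.var _) (.var _)))
  · exact .forall_elem (.imp (TermDef.mem (.var _)) (TermDef.mem (.neg (.var _))))
  · exact .forall_elem (.or (TermDef.mem (.var _)) (.exists_elem (.and (TermDef.mem (.var _))
      (TermDef.eq (.mul (.var _) (.var _)) .one))))

/-- `x` is a non-unit. -/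
def IsNonunit (O : Set K) (x : K) : Prop := ∀ w, w ∈ O → x * w ≠ 1

theorem TermDef.isNonunit {α : Type} {f : ∀ (K : Type u) [Field K], Set K → K → (α → K) → K}
    (hf : TermDef f) : FormulaDef fun K _ O t v => IsNonunit O (f K O t v) := by
  obtain ⟨τ, hτ⟩ := hf
  refine .forall_elem (.imp (TermDef.mem (.var _)) (.not (TermDef.eq (.mul ?_ (.var _)) .one)))
  refine ⟨τ.relabel Sum.inl, fun K _ O t v => ?_⟩
  let := structureOf O t
  rw [Language.Term.realize_relabel, hτ]
  rfl

variable {A : ValuationSubring K} {t : K}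

theorem isUnit_iff_exists_mul_eq_one (x : A) : IsUnit x ↔ ∃ w, w ∈ A ∧ (x : K) * w = 1 := by
  rw [isUnit_iff_exists_inv]
  constructor
  · rintro ⟨w, hw⟩
    exact ⟨w, w.2, congrArg Subtype.val hw⟩
  · rintro ⟨w, hw, hxw⟩
    exact ⟨⟨w, hw⟩, Subtype.ext hxw⟩

theorem isNonunit_iff (x : A) : IsNonunit (A : Set K) x ↔ x ∈ maximalIdeal A := by
  rw [mem_maximalIdeal, mem_nonunits_iff, isUnit_iff_exists_mul_eq_one]
  push Not
  rfl

/-- The instance of Hensel's lemma for monic polynomials of degree `n`. -/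
def HenselProperty (n : ℕ) (O : Set K) : Prop :=
  ∀ (a : Fin n → K) (x : K), (∀ i, a i ∈ O) → x ∈ O →
    IsNonunit O (x ^ n + ∑ i, a i * x ^ (i : ℕ)) →
    (∃ w, w ∈ O ∧
      ((n : K) * x ^ (n - 1) + ∑ i : Fin n, a i * (i : ℕ) * x ^ ((i : ℕ) - 1)) * w = 1) →
    ∃ y, y ∈ O ∧ y ^ n + ∑ i, a i * y ^ (i : ℕ) = 0 ∧ IsNonunit O (y - x)

theorem henselianLocalRing_iff : HenselianLocalRing A ↔ ∀ n, HenselProperty n (A : Set K) := by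
  have heval : ∀ {n : ℕ} (a : Fin n → A) (x : A), (((monicPolynomial a).eval x : A) : K) =
      (x : K) ^ n + ∑ i, (a i : K) * (x : K) ^ (i : ℕ) := fun a x => by
    change algebraMap A K _ = _
    rw [← aeval_algebraMap_apply_eq_algebraMap_eval, aeval_monicPolynomial]
    rfl
  have heval' : ∀ {n : ℕ} (a : Fin n → A) (x : A),
      (((derivative (monicPolynomial a)).eval x : A) : K) =
      (n : K) * (x : K) ^ (n - 1) + ∑ i : Fin n, (a i : K) * (i : ℕ) * (x : K) ^ ((i : ℕ) - 1) :=
    fun a x => by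
      change algebraMap A K _ = _
      rw [← aeval_algebraMap_apply_eq_algebraMap_eval, aeval_derivative_monicPolynomial]
      simp only [Algebra.smul_def, map_mul, map_natCast]
      rfl
  constructor
  · intro h n a x ha hx h0 h1
    let a' : Fin n → A := fun i => ⟨a i, ha i⟩
    let x' : A := ⟨x, hx⟩
    obtain ⟨y, hy, hyx⟩ := h.is_henselian (monicPolynomial a') (monic_monicPolynomial a') x'
      ((isNonunit_iff _).mp (by rw [heval]; exact h0))
      ((isUnit_iff_exists_mul_eq_one _).mpr (by rw [heval']; exact h1))
    refine ⟨y, y.2, ?_, ?_⟩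
    · have := congrArg (Subtype.val : A → K) hy
      rw [heval] at this
      exact this
    · exact (isNonunit_iff (y - x')).mpr hyx
  · intro h
    refine ⟨fun f hf x h0 h1 => ?_⟩
    have hf' := Monic.eq_monicPolynomial hf rfl
    set a : Fin f.natDegree → A := fun i => f.coeff i
    rw [hf'] at h0 h1 ⊢
    obtain ⟨y, hy, hy0, hyx⟩ := h f.natDegree (fun i => a i) x (fun i => (a i).2) x.2
      (by rw [← heval]; exact (isNonunit_iff _).mpr h0)
      (by rw [← heval']; exact (isUnit_iff_exists_mul_eq_one _).mp h1)
    refine ⟨⟨y, hy⟩, Subtype.ext ?_, ?_⟩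
    · rw [heval]
      exact hy0
    · exact (isNonunit_iff (⟨y, hy⟩ - x)).mp hyx

theorem theoryDef_henselProperty (n : ℕ) : TheoryDef.{u} fun _ _ O _ => HenselProperty n O := by
  refine FormulaDef.theoryDef ?_
  refine .forall (.forall_elem ?_)
  refine .imp (.finite_forall fun i => TermDef.mem (.var _)) (.imp (TermDef.mem (.var _)) ?_)
  refine .imp (TermDef.isNonunit (.add (.pow (.var _) _) (.sum _ fun i => .mul (.var _) (.pow (.var _) _))))
    ?_
  refine .imp ?_ ?_
  · refine .exists_elem (.and (TermDef.mem (.var _)) (TermDef.eq (.mul (.add ?_ ?_) (.var _)) .one))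
    · exact .mul (.natCast n) (.pow (.var _) _)
    · exact .sum _ fun i => .mul (.mul (.var _) (.natCast _)) (.pow (.var _) _)
  · refine .exists_elem (.and (TermDef.mem (.var _)) (.and ?_ (TermDef.isNonunit (.sub (.var _) (.var _)))))
    exact TermDef.eq (.add (.pow (.var _) _) (.sum _ fun i => .mul (.var _) (.pow (.var _) _))) .zero

/-- The defining property of deeply ramified fields in terms of elements. -/
def DeeplyRamifiedSet (p : ℕ) (O : Set K) : Prop :=
  ∀ x, x ∈ O → x ≠ 0 → IsNonunit O x → ∀ y, y ∈ O → ∃ z, z ∈ O ∧ ∃ w, w ∈ O ∧ y = z ^ p + x * w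

theorem deeplyRamified_iff {p : ℕ} : DeeplyRamified p A ↔ DeeplyRamifiedSet p (A : Set K) := by
  constructor
  · intro h x hx hx0 hxn y hy
    obtain ⟨q, hq⟩ := h ⟨x, hx⟩ (fun h0 => hx0 (congrArg Subtype.val h0)) ((isNonunit_iff _).mp hxn)
      (Ideal.Quotient.mk _ ⟨y, hy⟩)
    obtain ⟨z, rfl⟩ := Ideal.Quotient.mk_surjective q
    change (Ideal.Quotient.mk _ z) ^ p = _ at hq
    rw [← map_pow, eq_comm, Ideal.Quotient.eq, Ideal.mem_span_singleton'] at hq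
    obtain ⟨w, hw⟩ := hq
    have hw' : (w : K) * x = y - (z : K) ^ p := congrArg Subtype.val hw
    refine ⟨z, z.2, w, w.2, ?_⟩
    linear_combination -hw'
  · intro h x hx0 hxm q
    obtain ⟨y, rfl⟩ := Ideal.Quotient.mk_surjective q
    obtain ⟨z, hz, w, hw, hy⟩ := h x x.2 (fun h0 => hx0 (Subtype.ext h0)) ((isNonunit_iff _).mpr hxm)
      y y.2
    refine ⟨Ideal.Quotient.mk _ ⟨z, hz⟩, ?_⟩
    change (Ideal.Quotient.mk _ _) ^ p = _
    rw [← map_pow, eq_comm, Ideal.Quotient.eq, Ideal.mem_span_singleton']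
    refine ⟨⟨w, hw⟩, Subtype.ext ?_⟩
    change w * (x : K) = y - z ^ p
    rw [hy]
    ring

theorem theoryDef_deeplyRamifiedSet (p : ℕ) :
    TheoryDef.{u} fun _ _ O _ => DeeplyRamifiedSet p O := by
  refine FormulaDef.theoryDef ?_
  refine .forall_elem (.imp (TermDef.mem (.var _)) (.imp (.not (TermDef.eq (.var _) .zero))
    (.imp (TermDef.isNonunit (.var _)) ?_)))
  refine .forall_elem (.imp (TermDef.mem (.var _)) (.exists_elem (.and (TermDef.mem (.var _)) ?_)))
  refine .exists_elem (.and (TermDef.mem (.var _)) (TermDef.eq (.var _) ?_))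
  exact .add (.pow (.var _) _) (.mul (.var _) (.var _))

/-- The axioms of pointed deeply ramified henselian valued fields of characteristic `p`. -/
def PointedAxioms (p : ℕ) (O : Set K) (t : K) : Prop :=
  IsValuationSet O ∧ (p : K) = 0 ∧ (∀ n, HenselProperty n O) ∧ DeeplyRamifiedSet p O ∧
    (t ≠ 0 ∧ t ∈ O ∧ IsNonunit O t)

theorem theoryDef_pointedAxioms (p : ℕ) : TheoryDef.{u} fun _ _ O t => PointedAxioms p O t := by
  refine theoryDef_isValuationSet.and (.and (FormulaDef.theoryDef ?_) (.and (.forall theoryDef_henselProperty)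
    (.and (theoryDef_deeplyRamifiedSet p) (FormulaDef.theoryDef ?_))))
  · exact TermDef.eq (.natCast p) .zero
  · exact .and (.not (TermDef.eq .const .zero)) (.and (TermDef.mem .const) (TermDef.isNonunit .const))

theorem pointedAxioms_iff (p : ℕ) [Fact p.Prime] (O : Set K) (t : K) :
    PointedAxioms p O t ↔
      ∃ A : ValuationSubring K, (A : Set K) = O ∧ PointedDeeplyRamifiedHenselian p A t := by
  constructor
  · rintro ⟨h1, h2, h3, h4, h5, h6, h7⟩
    obtain ⟨A, rfl⟩ := (isValuationSet_iff O).mp h1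
    refine ⟨A, rfl, (CharP.charP_iff_prime_eq_zero Fact.out).mpr h2, henselianLocalRing_iff.mpr h3,
      deeplyRamified_iff.mpr h4, h5, ?_⟩
    exact (A.valuation_lt_one_iff ⟨t, h6⟩).mp ((isNonunit_iff ⟨t, h6⟩).mp h7)
  · rintro ⟨A, rfl, h⟩
    have := h.charP
    have htA : t ∈ A := (A.valuation_le_one_iff _).mp h.lt_one.le
    refine ⟨(isValuationSet_iff _).mpr ⟨A, rfl⟩, CharP.cast_eq_zero K p,
      henselianLocalRing_iff.mp h.henselian, deeplyRamified_iff.mp h.deeplyRamified, h.ne_zero, htA,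
      (isNonunit_iff ⟨t, htA⟩).mpr ((A.valuation_lt_one_iff ⟨t, htA⟩).mpr h.lt_one)⟩

end Axioms

/-! ### Axioms for the degree of imperfection -/

section Imperfection

variable {K : Type u} [Field K]

/-- `b` is linearly independent over the field of `p`-th powers. -/
def PowIndependent (p : ℕ) {m : ℕ} (b : Fin m → K) : Prop :=
  ∀ c : Fin m → K, ∑ i, c i ^ p * b i = 0 → ∀ i, c i = 0

theorem linearIndependent_frobenius_iff (p : ℕ) [Fact p.Prime] [CharP K p] {m : ℕ} (b : Fin m → K) :
    LinearIndependent (frobenius K p).fieldRange b ↔ PowIndependent p b := by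
  rw [Fintype.linearIndependent_iff]
  constructor
  · intro h c hc i
    have := h (fun i => ⟨c i ^ p, c i, rfl⟩) hc i
    exact (pow_eq_zero_iff (Fact.out : p.Prime).ne_zero).mp (congrArg Subtype.val this)
  · intro h g hg i
    choose c hc using fun i => (g i).2
    have h1 := h c (by
      rw [← hg]
      refine Finset.sum_congr rfl fun i _ => ?_
      rw [← frobenius_def, hc]
      rfl) i
    refine Subtype.ext ?_
    rw [← hc, h1, map_zero]
    rfl

/-- Scalars from `K ^ p` are quantified through their `p`-th roots. The case `m = 0` is excluded
because rank zero is also the default value in infinite dimension. -/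
theorem finrank_frobenius_eq_iff (p : ℕ) [Fact p.Prime] [CharP K p] {m : ℕ} (hm : m ≠ 0) :
    Module.finrank (frobenius K p).fieldRange K = m ↔
      ∃ b : Fin m → K, (∀ x, ∃ c : Fin m → K, x = ∑ i, c i ^ p * b i) ∧ PowIndependent p b := by
  constructor
  · intro h
    have : FiniteDimensional (frobenius K p).fieldRange K :=
      FiniteDimensional.of_finrank_pos (by omega)
    let b := Module.finBasisOfFinrankEq _ _ h
    refine ⟨b, fun x => ?_, (linearIndependent_frobenius_iff p _).mp b.linearIndependent⟩
    choose c hc using fun i => (b.repr x i).2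
    refine ⟨c, ?_⟩
    nth_rewrite 1 [← b.sum_repr x]
    refine Finset.sum_congr rfl fun i _ => ?_
    rw [← frobenius_def, hc]
    rfl
  · rintro ⟨b, hspan, hind⟩
    let B := Module.Basis.mk ((linearIndependent_frobenius_iff p b).mpr hind) (by
      rintro x -
      obtain ⟨c, rfl⟩ := hspan x
      exact Submodule.sum_mem _ fun i _ => Submodule.smul_mem _
        (⟨c i ^ p, c i, rfl⟩ : (frobenius K p).fieldRange) (Submodule.subset_span ⟨i, rfl⟩))
    rw [Module.finrank_eq_card_basis B, Fintype.card_fin]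

theorem not_finiteDimensional_frobenius_iff (p : ℕ) [Fact p.Prime] [CharP K p] :
    ¬ FiniteDimensional (frobenius K p).fieldRange K ↔
      ∀ m, ∃ b : Fin m → K, PowIndependent p b := by
  constructor
  · intro h m
    have h := mt Module.rank_lt_aleph0_iff.mp h
    rw [not_lt] at h
    obtain ⟨s, hs, hind⟩ := le_rank_iff_exists_linearIndependent_finset.mp
      ((Cardinal.natCast_lt_aleph0 (n := m)).le.trans h)
    refine ⟨fun i => ((s.equivFinOfCardEq hs).symm i : K),
      (linearIndependent_frobenius_iff p _).mp ?_⟩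
    exact hind.comp _ (s.equivFinOfCardEq hs).symm.injective
  · intro h hfin
    obtain ⟨b, hb⟩ := h (Module.finrank (frobenius K p).fieldRange K + 1)
    have := ((linearIndependent_frobenius_iff p b).mpr hb).fintype_card_le_finrank
    rw [Fintype.card_fin] at this
    omega

/-- The axioms for the degree of imperfection. -/
def ImperfectionAxioms (p : ℕ) (e : ℕ∞) (K : Type u) [Field K] : Prop :=
  (∀ n : ℕ, e = n → ∃ b : Fin (p ^ n) → K,
    (∀ x, ∃ c : Fin (p ^ n) → K, x = ∑ i, c i ^ p * b i) ∧ PowIndependent p b) ∧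
  (e = ⊤ → ∀ m, ∃ b : Fin m → K, PowIndependent p b)

theorem hasImperfectionDegree_iff (p : ℕ) [Fact p.Prime] [CharP K p] (e : ℕ∞) :
    HasImperfectionDegree p K e ↔ ImperfectionAxioms p e K := by
  refine and_congr (forall_congr' fun n => imp_congr_right fun _ => ?_)
    (imp_congr_right fun _ => not_finiteDimensional_frobenius_iff p)
  exact finrank_frobenius_eq_iff p (pow_ne_zero _ (Fact.out : p.Prime).ne_zero)

/-- The conditions on `e` are decided outside the language and merely select which sentences enter
the theory. -/
theorem theoryDef_imperfectionAxioms (p : ℕ) (e : ℕ∞) :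
    TheoryDef.{u} fun K _ _ _ => ImperfectionAxioms p e K := by
  have hind : ∀ m, FormulaDef.{u} (α := Empty ⊕ Fin m) fun K _ _ _ v =>
      PowIndependent p fun i => v (Sum.inr i) := fun m => by
    refine .forall (.imp (TermDef.eq (.sum _ fun i => .mul (.pow (.var _) _) (.var _)) .zero) ?_)
    exact .finite_forall fun i => TermDef.eq (.var _) .zero
  refine .and (.forall fun n => .forall fun _ => FormulaDef.theoryDef (.exists (.and ?_ (hind _))))
    (.forall fun _ => .forall fun m => FormulaDef.theoryDef (.exists (hind m)))
  exact .forall_elem (.exists (TermDef.eq (.var _) (.sum _ fun i => .mul (.pow (.var _) _) (.var _))))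

end Imperfection

/-! ### Separable extensions in terms of companion matrices -/

section Companion

variable {K : Type*} [Field K] {n : ℕ}

/-- The companion matrix of `X ^ n + ∑ aᵢ Xⁱ`. -/
def companion (a : Fin n → K) : Matrix (Fin n) (Fin n) K :=
  Matrix.of fun i j => if (j : ℕ) + 1 = n then -a i else if (i : ℕ) = j + 1 then 1 else 0

/-- The element with coordinates `y`, as a matrix. -/
def companionEval (a y : Fin n → K) : Matrix (Fin n) (Fin n) K :=
  ∑ i, y i • companion a ^ (i : ℕ)

section Algebra

variable {S : Type*} [CommRing S] [Algebra K S]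

theorem PowerBasis.dim_of_minpoly_eq (pb : PowerBasis K S) {a : Fin n → K}
    (hmin : minpoly K pb.gen = monicPolynomial a) : pb.dim = n := by
  rw [← pb.natDegree_minpoly, hmin, natDegree_monicPolynomial]

/-- The regular representation in the power basis sends the generator to its companion matrix and
turns norms into determinants. -/
theorem PowerBasis.exists_algHom (pb : PowerBasis K S) {a : Fin n → K}
    (hmin : minpoly K pb.gen = monicPolynomial a) :
    ∃ φ : S →ₐ[K] Matrix (Fin n) (Fin n) K, Function.Injective φ ∧ φ pb.gen = companion a ∧
      ∀ x, (φ x).det = Algebra.norm K x := by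
  obtain rfl := PowerBasis.dim_of_minpoly_eq pb hmin
  refine ⟨Algebra.leftMulMatrix pb.basis, Algebra.leftMulMatrix_injective _, ?_,
    fun x => (Algebra.norm_eq_matrix_det pb.basis x).symm⟩
  rw [PowerBasis.leftMulMatrix, companion, pb.minpolyGen_eq, hmin]
  simp only [coeff_monicPolynomial]

theorem PowerBasis.exists_eq_sum (pb : PowerBasis K S) {a : Fin n → K}
    (hmin : minpoly K pb.gen = monicPolynomial a) (x : S) :
    ∃ y : Fin n → K, ∑ i, y i • pb.gen ^ (i : ℕ) = x := by
  obtain rfl := PowerBasis.dim_of_minpoly_eq pb hmin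
  refine ⟨fun i => pb.basis.repr x i, ?_⟩
  simpa only [pb.basis_eq_pow] using pb.basis.sum_repr x

theorem PowerBasis.eq_zero_of_sum_eq_zero (pb : PowerBasis K S) {a : Fin n → K}
    (hmin : minpoly K pb.gen = monicPolynomial a) {y : Fin n → K}
    (hy : ∑ i, y i • pb.gen ^ (i : ℕ) = 0) : ∀ i, y i = 0 := by
  obtain rfl := PowerBasis.dim_of_minpoly_eq pb hmin
  refine Fintype.linearIndependent_iff.mp pb.basis.linearIndependent y ?_
  simpa only [pb.basis_eq_pow] using hy

theorem map_sum_smul_pow {a y : Fin n → K} (φ : S →ₐ[K] Matrix (Fin n) (Fin n) K) {x : S}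
    (hφ : φ x = companion a) : φ (∑ i, y i • x ^ (i : ℕ)) = companionEval a y := by
  simp only [map_sum, map_smul, map_pow, hφ, companionEval]

end Algebra

theorem minpoly_root_monicPolynomial (a : Fin n → K) :
    minpoly K (AdjoinRoot.root (monicPolynomial a)) = monicPolynomial a := by
  rw [AdjoinRoot.minpoly_root (monic_monicPolynomial a).ne_zero,
    (monic_monicPolynomial a).leadingCoeff]
  simp

/-- If nonzero elements of `K[X]/(f)` act with nonzero determinant, multiplicativity of the
determinant makes the quotient a domain. -/
theorem irreducible_monicPolynomial (hn : n ≠ 0) {a : Fin n → K}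
    (h : ∀ y : Fin n → K, (∀ i, y i = 0) ∨ (companionEval a y).det ≠ 0) :
    Irreducible (monicPolynomial a) := by
  have h0 := (monic_monicPolynomial a).ne_zero
  let pb := AdjoinRoot.powerBasis h0
  have hmin : minpoly K pb.gen = monicPolynomial a := minpoly_root_monicPolynomial a
  obtain ⟨φ, hφ, hgen, -⟩ := PowerBasis.exists_algHom pb hmin
  have hdet : ∀ x : AdjoinRoot (monicPolynomial a), x ≠ 0 → (φ x).det ≠ 0 := fun x hx => by
    obtain ⟨y, rfl⟩ := PowerBasis.exists_eq_sum pb hmin x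
    rw [map_sum_smul_pow φ hgen]
    refine (h y).resolve_left fun hy => hx ?_
    simp [hy]
  have : Nontrivial (AdjoinRoot (monicPolynomial a)) := by
    refine AdjoinRoot.nontrivial _ ?_
    rw [degree_eq_natDegree h0, natDegree_monicPolynomial]
    exact_mod_cast hn
  have : NoZeroDivisors (AdjoinRoot (monicPolynomial a)) := ⟨fun {x y} hxy => by
    by_contra! hne
    have := congrArg (fun z => (φ z).det) hxy
    have hne' : Nonempty (Fin n) := Fin.pos_iff_nonempty.mp (Nat.pos_of_ne_zero hn)
    simp only [map_mul, Matrix.det_mul, map_zero, Matrix.det_zero] at this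
    exact mul_ne_zero (hdet x hne.1) (hdet y hne.2) this⟩
  have : IsDomain (AdjoinRoot (monicPolynomial a)) := NoZeroDivisors.to_isDomain _
  have hprime : (Ideal.span {monicPolynomial a}).IsPrime := Ideal.Quotient.isDomain_iff_prime _ |>.mp this
  exact ((Ideal.span_singleton_prime h0).mp hprime).irreducible

/-- The derivative of `X ^ n + ∑ aᵢ Xⁱ` at a matrix. -/
def derivativeEval (a : Fin n → K) (M : Matrix (Fin n) (Fin n) K) : Matrix (Fin n) (Fin n) K :=
  (n : K) • M ^ (n - 1) + ∑ i : Fin n, (a i * (i : ℕ)) • M ^ ((i : ℕ) - 1)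

end Companion

/-! ### Condition (ii) as an axiom scheme -/

section Schema

variable {K : Type u} [Field K] {n : ℕ}

/-- The axiom scheme for the existence of generators with small different. -/
def GeneratorProperty (n : ℕ) (O : Set K) (t : K) : Prop :=
  ∀ a : Fin n → K, (∀ y : Fin n → K, (∀ i, y i = 0) ∨ (companionEval a y).det ≠ 0) →
    (derivativeEval a (companion a)).det ≠ 0 →
    (∀ y : Fin n → K, (∀ i, y i = 0) ∨ ∃ c, c ≠ 0 ∧ ∃ u, u ∈ O ∧ ∃ w, w ∈ O ∧ u * w = 1 ∧
      (companionEval a y).det = c ^ n * u) →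
    ∃ y h : Fin n → K, (companionEval a y).det ∈ O ∧
      (companionEval a y ^ n + ∑ i, h i • companionEval a y ^ (i : ℕ) = 0) ∧
      (∀ g : Fin n → K, ∑ i, g i • companionEval a y ^ (i : ℕ) = 0 → ∀ i, g i = 0) ∧
      (derivativeEval h (companionEval a y)).det ∈ O ∧
      ∃ u, u ∈ O ∧ t ^ n = u * (derivativeEval h (companionEval a y)).det

variable {L : Type u} [Field L] [Algebra K L] {A : ValuationSubring K} {B : ValuationSubring L}
  {t : K}

theorem finrank_of_minpoly_eq (pb : PowerBasis K L) {a : Fin n → K}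
    (hmin : minpoly K pb.gen = monicPolynomial a) : Module.finrank K L = n := by
  rw [pb.finrank, PowerBasis.dim_of_minpoly_eq pb hmin]

variable [FiniteDimensional K L]

theorem norm_div_eq (x y : L) :
    Algebra.norm K (x / y) = Algebra.norm K x / Algebra.norm K y := by
  by_cases hy : y = 0
  · simp [hy]
  · rw [eq_div_iff (Algebra.norm_ne_zero_iff.mpr hy), ← map_mul, div_mul_cancel₀ _ hy]

variable [Algebra.IsSeparable K L]

/-- Elements `x` and `c` have equal value exactly when `x / c` is a unit, which by the norm
criterion means that `N(x) / c ^ n` is a unit of `A`. -/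
theorem Extends.ramificationIndex_eq_one_iff_norm [HenselianLocalRing A] (hB : Extends A B) :
    ramificationIndex K B = 1 ↔ ∀ x : L, x ≠ 0 → ∃ c, c ≠ 0 ∧ ∃ u, u ∈ A ∧ ∃ w, w ∈ A ∧
      u * w = 1 ∧ Algebra.norm K x = c ^ Module.finrank K L * u := by
  constructor
  · intro h x hx
    have hx' : B.valuation x ≠ 0 := (Valuation.ne_zero_iff _).mpr hx
    have htop := (Subgroup.eq_top_iff' _).mp (Subgroup.index_eq_one.mp h) (Units.mk0 _ hx')
    obtain ⟨c, hc, hcx⟩ := mem_valueSubgroup.mp htop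
    rw [Units.val_mk0] at hcx
    have hc' : algebraMap K L c ≠ 0 := by simpa using hc
    have h1 : Algebra.norm K (x / algebraMap K L c) ∈ A := by
      rw [← hB.mem_iff_norm_mem, ← B.valuation_le_one_iff, map_div₀, hcx, div_self hx']
    have h2 : Algebra.norm K (algebraMap K L c / x) ∈ A := by
      rw [← hB.mem_iff_norm_mem, ← B.valuation_le_one_iff, map_div₀, hcx, div_self hx']
    refine ⟨c, hc, _, h1, _, h2, ?_, ?_⟩
    · rw [← map_mul, div_mul_div_cancel₀ hc', div_self hx, map_one]
    · rw [← Algebra.norm_algebraMap, ← map_mul, mul_div_cancel₀ _ hc']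
  · intro h
    refine Subgroup.index_eq_one.mpr ((Subgroup.eq_top_iff' _).mpr fun g => ?_)
    obtain ⟨x, hx⟩ := B.valuation_surjective (g : B.ValueGroup)
    have hx0 : x ≠ 0 := by
      rintro rfl
      rw [map_zero] at hx
      exact g.ne_zero hx.symm
    obtain ⟨c, hc, u, hu, w, hw, huw, hn⟩ := h x hx0
    refine mem_valueSubgroup.mpr ⟨c, hc, ?_⟩
    have hc' : algebraMap K L c ≠ 0 := by simpa using hc
    have hcn : c ^ Module.finrank K L ≠ 0 := pow_ne_zero _ hc
    have hu0 : u ≠ 0 := left_ne_zero_of_mul_eq_one huw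
    have hv0 : B.valuation x ≠ 0 := (Valuation.ne_zero_iff _).mpr hx0
    have hvc : B.valuation (algebraMap K L c) ≠ 0 := (Valuation.ne_zero_iff _).mpr hc'
    rw [← hx]
    refine le_antisymm ?_ ?_
    · rw [← div_le_one₀ (zero_lt_iff.mpr hv0), ← map_div₀, B.valuation_le_one_iff,
        hB.mem_iff_norm_mem, norm_div_eq, Algebra.norm_algebraMap, hn]
      rw [div_mul_cancel_left₀ hcn, ← eq_inv_of_mul_eq_one_right huw]
      exact hw
    · rw [← div_le_one₀ (zero_lt_iff.mpr hvc), ← map_div₀, B.valuation_le_one_iff,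
        hB.mem_iff_norm_mem, norm_div_eq, Algebra.norm_algebraMap, hn]
      rwa [mul_div_cancel_left₀ _ hcn]

omit [Algebra.IsSeparable K L] in
theorem adjoin_eq_top_iff_forall_sum (hn : Module.finrank K L = n) (α : L) :
    K⟮α⟯ = ⊤ ↔ ∀ g : Fin n → K, ∑ i, g i • α ^ (i : ℕ) = 0 → ∀ i, g i = 0 := by
  constructor
  · intro h
    have hd := (Field.primitive_element_iff_minpoly_natDegree_eq K α).mp h
    rw [hn] at hd
    subst hd
    exact Fintype.linearIndependent_iff.mp (linearIndependent_pow α)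
  · intro h
    have hind : LinearIndependent K fun i : Fin n => α ^ (i : ℕ) :=
      Fintype.linearIndependent_iff.mpr h
    have hspan := hind.span_eq_top_of_card_eq_finrank' (by rw [Fintype.card_fin, hn])
    refine eq_top_iff.mpr fun x _ => ?_
    have hx : x ∈ Submodule.span K (Set.range fun i : Fin n => α ^ (i : ℕ)) := hspan ▸ trivial
    refine (Submodule.span_le (p := Subalgebra.toSubmodule K⟮α⟯.toSubalgebra)).mpr ?_ hx
    rintro _ ⟨i, rfl⟩
    exact pow_mem (IntermediateField.mem_adjoin_simple_self K α) _

theorem minpoly_eq_monicPolynomial_iff (hn : Module.finrank K L = n) {α : L} (h : K⟮α⟯ = ⊤)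
    (b : Fin n → K) : minpoly K α = monicPolynomial b ↔ α ^ n + ∑ i, b i • α ^ (i : ℕ) = 0 := by
  rw [← aeval_monicPolynomial]
  have hd := (Field.primitive_element_iff_minpoly_natDegree_eq K α).mp h
  constructor
  · intro h
    rw [← h, minpoly.aeval]
  · intro h0
    refine (eq_of_monic_of_dvd_of_natDegree_le (minpoly.monic (Algebra.IsIntegral.isIntegral α))
      (monic_monicPolynomial b) (minpoly.dvd K α h0) ?_).symm
    rw [natDegree_monicPolynomial, hd, hn]

/-- The norm criterion is applied to `t / δ`, using `N(t) = t ^ n`. For `δ = 0` both sides fail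
because `t ≠ 0`. -/
theorem valuation_different_iff [HenselianLocalRing A] (hB : Extends A B) (ht : t ≠ 0) {δ : L} :
    B.valuation (algebraMap K L t) ≤ B.valuation δ ↔
      ∃ u, u ∈ A ∧ t ^ Module.finrank K L = u * Algebra.norm K δ := by
  have ht' : algebraMap K L t ≠ 0 := by simpa using ht
  have hvt : B.valuation (algebraMap K L t) ≠ 0 := (Valuation.ne_zero_iff _).mpr ht'
  by_cases hδ : δ = 0
  · subst hδ
    simp [hvt, ht]
  have hvδ : B.valuation δ ≠ 0 := (Valuation.ne_zero_iff _).mpr hδ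
  have hNδ : Algebra.norm K δ ≠ 0 := Algebra.norm_ne_zero_iff.mpr hδ
  rw [← div_le_one₀ (zero_lt_iff.mpr hvδ), ← map_div₀, B.valuation_le_one_iff,
    hB.mem_iff_norm_mem, norm_div_eq, Algebra.norm_algebraMap]
  constructor
  · intro h
    exact ⟨_, h, (div_mul_cancel₀ _ hNδ).symm⟩
  · rintro ⟨u, hu, h⟩
    rwa [h, mul_div_cancel_right₀ _ hNδ]

/-- The dictionary for the conclusion of the scheme: `y` holds the coordinates of `α` and `h` the
coefficients of its minimal polynomial, independence of the powers says that `α` generates, and the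
determinants are the norms of `α` and `δ(α)`. -/
theorem Extends.exists_generator_iff [HenselianLocalRing A] (hB : Extends A B) (ht : t ≠ 0)
    (pb : PowerBasis K L) {a : Fin n → K} (hmin : minpoly K pb.gen = monicPolynomial a) :
    (∃ α : L, α ∈ B ∧ K⟮α⟯ = ⊤ ∧ B.valuation (different K α) ≤ 1 ∧
      B.valuation (algebraMap K L t) ≤ B.valuation (different K α)) ↔
    ∃ y h : Fin n → K, (companionEval a y).det ∈ A ∧
      (companionEval a y ^ n + ∑ i, h i • companionEval a y ^ (i : ℕ) = 0) ∧
      (∀ g : Fin n → K, ∑ i, g i • companionEval a y ^ (i : ℕ) = 0 → ∀ i, g i = 0) ∧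
      (derivativeEval h (companionEval a y)).det ∈ A ∧
      ∃ u, u ∈ A ∧ t ^ n = u * (derivativeEval h (companionEval a y)).det := by
  obtain ⟨φ, hφ, hgen, hdet⟩ := PowerBasis.exists_algHom pb hmin
  have hn := finrank_of_minpoly_eq pb hmin
  have key : ∀ y : Fin n → K, ∃ α, φ α = companionEval a y := fun y =>
    ⟨_, map_sum_smul_pow φ hgen⟩
  have hsum : ∀ (g : Fin n → K) (α : L),
      ∑ i, g i • φ α ^ (i : ℕ) = φ (∑ i, g i • α ^ (i : ℕ)) := fun g α => by
    simp only [map_sum, map_smul, map_pow]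
  have hsum' : ∀ (g : Fin n → K) (α : L), ∑ i, g i • φ α ^ (i : ℕ) = 0 ↔
      ∑ i, g i • α ^ (i : ℕ) = 0 := fun g α => by
    rw [hsum, map_eq_zero_iff φ hφ]
  have hmon : ∀ (g : Fin n → K) (α : L), φ α ^ n + ∑ i, g i • φ α ^ (i : ℕ) = 0 ↔
      α ^ n + ∑ i, g i • α ^ (i : ℕ) = 0 := fun g α => by
    rw [hsum, ← map_pow, ← map_add, map_eq_zero_iff φ hφ]
  have hder : ∀ (g : Fin n → K) (α : L), minpoly K α = monicPolynomial g →
      derivativeEval g (φ α) = φ (different K α) := fun g α hg => by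
    rw [different, hg, aeval_derivative_monicPolynomial, derivativeEval]
    simp only [map_sum, map_smul, map_pow, map_add]
  constructor
  · rintro ⟨α, hα, htop, h1, h2⟩
    obtain ⟨y, rfl⟩ := PowerBasis.exists_eq_sum pb hmin α
    set α := ∑ i, y i • pb.gen ^ (i : ℕ)
    have hy : φ α = companionEval a y := map_sum_smul_pow φ hgen
    have hα0 : minpoly K α = monicPolynomial fun i : Fin n => (minpoly K α).coeff i :=
      Monic.eq_monicPolynomial (minpoly.monic (Algebra.IsIntegral.isIntegral α))
        (hn ▸ (Field.primitive_element_iff_minpoly_natDegree_eq K α).mp htop)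
    refine ⟨y, fun i => (minpoly K α).coeff i, ?_⟩
    rw [← hy, hder _ _ hα0, hdet, hdet]
    refine ⟨hB.mem_iff_norm_mem.mp hα, (hmon _ _).mpr ?_, fun g hg => ?_, ?_, ?_⟩
    · exact (minpoly_eq_monicPolynomial_iff hn htop _).mp hα0
    · exact (adjoin_eq_top_iff_forall_sum hn α).mp htop g ((hsum' _ _).mp hg)
    · exact hB.mem_iff_norm_mem.mp ((B.valuation_le_one_iff _).mp h1)
    · rw [← hn]
      exact (valuation_different_iff hB ht).mp h2
  · rintro ⟨y, g, h1, h2, h3, h4, h5⟩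
    obtain ⟨α, hy⟩ := key y
    rw [← hy] at h1 h2 h3 h4 h5
    have htop : K⟮α⟯ = ⊤ := (adjoin_eq_top_iff_forall_sum hn α).mpr fun g hg =>
      h3 g ((hsum' _ _).mpr hg)
    have hα0 := (minpoly_eq_monicPolynomial_iff hn htop g).mpr ((hmon _ _).mp h2)
    rw [hder _ _ hα0, hdet] at h4 h5
    rw [hdet] at h1
    rw [← hn] at h5
    exact ⟨α, hB.mem_iff_norm_mem.mpr h1, htop,
      (B.valuation_le_one_iff _).mpr (hB.mem_iff_norm_mem.mpr h4),
      (valuation_different_iff hB ht).mpr h5⟩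

theorem Extends.ramificationIndex_eq_one_iff_companion [HenselianLocalRing A] (hB : Extends A B)
    (pb : PowerBasis K L) {a : Fin n → K} (hmin : minpoly K pb.gen = monicPolynomial a) :
    ramificationIndex K B = 1 ↔
      ∀ y : Fin n → K, (∀ i, y i = 0) ∨ ∃ c, c ≠ 0 ∧ ∃ u, u ∈ A ∧ ∃ w, w ∈ A ∧ u * w = 1 ∧
        (companionEval a y).det = c ^ n * u := by
  obtain ⟨φ, hφ, hgen, hdet⟩ := PowerBasis.exists_algHom pb hmin
  rw [hB.ramificationIndex_eq_one_iff_norm, finrank_of_minpoly_eq pb hmin]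
  constructor
  · intro h y
    rw [← map_sum_smul_pow φ hgen, hdet]
    refine or_iff_not_imp_left.mpr fun hy => h _ fun h0 => hy ?_
    exact PowerBasis.eq_zero_of_sum_eq_zero pb hmin h0
  · intro h x hx
    obtain ⟨y, rfl⟩ := PowerBasis.exists_eq_sum pb hmin x
    rw [← hdet, map_sum_smul_pow φ hgen]
    refine (h y).resolve_left fun hy => hx ?_
    simp [hy]

omit [FiniteDimensional K L] [Algebra.IsSeparable K L] in
theorem isSeparable_gen_iff (pb : PowerBasis K L) {a : Fin n → K}
    (hmin : minpoly K pb.gen = monicPolynomial a) :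
    IsSeparable K pb.gen ↔ (derivativeEval a (companion a)).det ≠ 0 := by
  obtain ⟨φ, hφ, hgen, hdet⟩ := PowerBasis.exists_algHom pb hmin
  have : FiniteDimensional K L := pb.finite
  have hd : derivativeEval a (companion a) = φ (aeval pb.gen (derivative (minpoly K pb.gen))) := by
    rw [hmin, aeval_derivative_monicPolynomial, derivativeEval]
    simp only [map_sum, map_smul, map_pow, map_add, hgen]
  rw [hd, hdet, Algebra.norm_ne_zero_iff]
  constructor
  · exact fun h => h.aeval_derivative_ne_zero (minpoly.aeval K _)
  · intro h
    refine (separable_iff_derivative_ne_zero (minpoly.irreducible pb.isIntegral_gen)).mpr ?_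
    intro h0
    rw [h0, map_zero] at h
    exact h rfl

omit [FiniteDimensional K L] in
theorem companionEval_det_ne_zero (pb : PowerBasis K L) {a : Fin n → K}
    (hmin : minpoly K pb.gen = monicPolynomial a) (y : Fin n → K) :
    (∀ i, y i = 0) ∨ (companionEval a y).det ≠ 0 := by
  obtain ⟨φ, hφ, hgen, hdet⟩ := PowerBasis.exists_algHom pb hmin
  have : FiniteDimensional K L := pb.finite
  rw [← map_sum_smul_pow φ hgen, hdet, Algebra.norm_ne_zero_iff]
  exact or_iff_not_imp_left.mpr fun hy h0 => hy (PowerBasis.eq_zero_of_sum_eq_zero pb hmin h0)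

omit [FiniteDimensional K L] [Algebra.IsSeparable K L] in
-- By the primitive element theorem every finite separable extension is presented by some
-- coefficient vector. Conversely, the determinant hypotheses of the scheme say that a vector
-- presents a separable field extension with `e = 1`. Degree zero is left out, since it presents no
-- field.
theorem hasSmallDifferentGenerators_iff (hA : HenselianLocalRing A) (ht : t ≠ 0) :
    HasSmallDifferentGenerators A t ↔ ∀ n, GeneratorProperty (n + 1) (A : Set K) t := by
  constructor
  · intro h n a hirr hsep he
    have : Fact (Irreducible (monicPolynomial a)) :=
      ⟨irreducible_monicPolynomial n.succ_ne_zero hirr⟩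
    let pb := AdjoinRoot.powerBasis (monic_monicPolynomial a).ne_zero
    have hmin : minpoly K pb.gen = monicPolynomial a := minpoly_root_monicPolynomial a
    have : FiniteDimensional K (AdjoinRoot (monicPolynomial a)) := pb.finite
    have : Algebra.IsSeparable K (AdjoinRoot (monicPolynomial a)) := by
      have h1 := (isSeparable_gen_iff pb hmin).mpr hsep
      have h2 := (IntermediateField.isSeparable_adjoin_simple_iff_isSeparable (F := K) (E := _)).mpr h1
      have h3 : K⟮pb.gen⟯ = ⊤ := by
        refine IntermediateField.toSubalgebra_injective (top_unique ?_)
        rw [← pb.adjoin_gen_eq_top]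
        exact IntermediateField.algebra_adjoin_le_adjoin K {pb.gen}
      rw [h3] at h2
      exact Algebra.IsSeparable.of_algHom K _ (IntermediateField.topEquiv (F := K)).symm.toAlgHom
    obtain ⟨B, hB⟩ := exists_extends (A := A) (L := AdjoinRoot (monicPolynomial a))
    exact (hB.exists_generator_iff ht pb hmin).mp
      (h _ B hB ((hB.ramificationIndex_eq_one_iff_companion pb hmin).mpr he))
  · intro h L _ _ _ _ B hB he
    let pb := Field.powerBasisOfFiniteOfSeparable K L
    -- The degree is written as a successor to match the indexing of the scheme.
    have hmin := Monic.eq_monicPolynomial (n := pb.dim - 1 + 1) (minpoly.monic pb.isIntegral_gen)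
      (by rw [pb.natDegree_minpoly, Nat.sub_add_cancel pb.dim_pos])
    exact (hB.exists_generator_iff ht pb hmin).mpr (h _ _ (companionEval_det_ne_zero pb hmin)
      ((isSeparable_gen_iff pb hmin).mp (Algebra.IsSeparable.isSeparable K pb.gen))
      ((hB.ramificationIndex_eq_one_iff_companion pb hmin).mp he))

end Schema

/-! ### First-order expressibility of the scheme -/

section SchemaDefinability

variable {α : Type} {n : ℕ}

theorem MatrixDef.companion
    {a : Fin n → ∀ (K : Type u) [Field K], Set K → K → (α → K) → K} (ha : ∀ i, TermDef (a i)) :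
    MatrixDef fun K _ O t v => companion fun i => a i K O t v := fun i j => by
  by_cases h1 : (j : ℕ) + 1 = n
  · simpa [PointedVF.companion, h1] using (ha i).neg
  · by_cases h2 : (i : ℕ) = j + 1
    · simpa [PointedVF.companion, h1, h2] using TermDef.one
    · simpa [PointedVF.companion, h1, h2] using TermDef.zero

theorem MatrixDef.companionEval
    {a y : Fin n → ∀ (K : Type u) [Field K], Set K → K → (α → K) → K} (ha : ∀ i, TermDef (a i))
    (hy : ∀ i, TermDef (y i)) :
    MatrixDef fun K _ O t v => companionEval (fun i => a i K O t v) fun i => y i K O t v :=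
  MatrixDef.sum _ fun i => (MatrixDef.companion ha).pow _ |>.smul (hy i)

theorem MatrixDef.derivativeEval
    {a : Fin n → ∀ (K : Type u) [Field K], Set K → K → (α → K) → K} (ha : ∀ i, TermDef (a i))
    {M : ∀ (K : Type u) [Field K], Set K → K → (α → K) → Matrix (Fin n) (Fin n) K}
    (hM : MatrixDef M) :
    MatrixDef fun K _ O t v => derivativeEval (fun i => a i K O t v) (M K O t v) :=
  .add (.smul (.natCast n) (.pow hM _))
    (.sum _ fun i => .smul (.mul (ha i) (.natCast _)) (.pow hM _))

theorem MatrixDef.zero :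
    MatrixDef.{u} (α := α) fun _ _ _ _ _ => (0 : Matrix (Fin n) (Fin n) _) :=
  fun _ _ => TermDef.zero

theorem theoryDef_generatorProperty (n : ℕ) :
    TheoryDef.{u} fun _ _ O t => GeneratorProperty n O t := by
  refine FormulaDef.theoryDef ?_
  refine .forall (.imp (.forall (.or ?_ ?_)) (.imp ?_ (.imp (.forall (.or ?_ ?_)) ?_)))
  · exact .finite_forall fun i => TermDef.eq (.var _) .zero
  · exact .not (TermDef.eq (MatrixDef.det (.companionEval (fun _ => .var _) fun _ => .var _)) .zero)
  · exact .not (TermDef.eq (MatrixDef.det (.derivativeEval (fun _ => .var _) (.companion fun _ => .var _)))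
      .zero)
  · exact .finite_forall fun i => TermDef.eq (.var _) .zero
  · refine .exists_elem (.and (.not (TermDef.eq (.var _) .zero)) ?_)
    refine .exists_elem (.and (TermDef.mem (.var _)) (.exists_elem (.and (TermDef.mem (.var _)) ?_)))
    refine .and (TermDef.eq (.mul (.var _) (.var _)) .one) ?_
    exact TermDef.eq (MatrixDef.det (.companionEval (fun _ => .var _) fun _ => .var _))
      (.mul (.pow (.var _) _) (.var _))
  · refine .exists (.exists ?_)
    refine .and (TermDef.mem (MatrixDef.det (.companionEval (fun _ => .var _) fun _ => .var _))) ?_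
    refine .and (MatrixDef.eq (.add (.pow (.companionEval (fun _ => .var _) fun _ => .var _) _)
      (.sum _ fun i => .smul (.var _) (.pow (.companionEval (fun _ => .var _) fun _ => .var _) _)))
      .zero) ?_
    refine .and (.forall (.imp (MatrixDef.eq (.sum _ fun i => .smul (.var _)
      (.pow (.companionEval (fun _ => .var _) fun _ => .var _) _)) .zero)
      (.finite_forall fun i => TermDef.eq (.var _) .zero))) ?_
    refine .and (TermDef.mem (MatrixDef.det (.derivativeEval (fun _ => .var _)
      (.companionEval (fun _ => .var _) fun _ => .var _)))) ?_
    refine .exists_elem (.and (TermDef.mem (.var _)) ?_)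
    exact TermDef.eq (.pow .const _) (.mul (.var _) (MatrixDef.det (.derivativeEval (fun _ => .var _)
      (.companionEval (fun _ => .var _) fun _ => .var _))))

end SchemaDefinability

/-! ### Elementarity of the classes -/

section Main

/-- Under the pointed axioms, tameness of the coarsening is equivalent to condition (ii), so the
generator scheme axiomatises it. -/
theorem isElementary_classC (p : ℕ) [Fact p.Prime] :
    IsElementary.{u} fun _ _ A t => ClassC p A t := by
  refine ((theoryDef_pointedAxioms p).and
    (.forall fun n => theoryDef_generatorProperty (n + 1))).isElementary fun K _ O t => ?_
  rw [pointedAxioms_iff]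
  constructor
  · rintro ⟨⟨A, rfl, h⟩, hg⟩
    exact ⟨A, rfl, h, h.separablyTame_iff.mpr
      ((hasSmallDifferentGenerators_iff h.henselian h.ne_zero).mpr hg)⟩
  · rintro ⟨A, rfl, h⟩
    have h' := h.toPointedDeeplyRamifiedHenselian
    exact ⟨⟨A, rfl, h'⟩, (hasSmallDifferentGenerators_iff h'.henselian h'.ne_zero).mp
      (h'.separablyTame_iff.mp h.separablyTame)⟩

theorem isElementary_classCe (p : ℕ) [Fact p.Prime] (e : ℕ∞) :
    IsElementary.{u} fun _ _ A t => ClassCe p e A t := by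
  refine (((theoryDef_pointedAxioms p).and
    (.forall fun n => theoryDef_generatorProperty (n + 1))).and
    (theoryDef_imperfectionAxioms p e)).isElementary fun K _ O t => ?_
  rw [pointedAxioms_iff]
  constructor
  · rintro ⟨⟨⟨A, rfl, h⟩, hg⟩, hi⟩
    have hC : ClassC p A t := ⟨h, h.separablyTame_iff.mpr
      ((hasSmallDifferentGenerators_iff h.henselian h.ne_zero).mpr hg)⟩
    have := h.charP
    exact ⟨A, rfl, hC, (hasImperfectionDegree_iff p e).mpr hi⟩
  · rintro ⟨A, rfl, h⟩
    have h' := h.toPointedDeeplyRamifiedHenselian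
    have := h'.charP
    exact ⟨⟨⟨A, rfl, h'⟩, (hasSmallDifferentGenerators_iff h'.henselian h'.ne_zero).mp
      (h'.separablyTame_iff.mp h.separablyTame)⟩, (hasImperfectionDegree_iff p e).mp h.imperfection⟩

theorem exists_theory_hasSmallDifferentGenerators (p : ℕ) :
    ∃ T : lang.Theory, ∀ (K : Type u) [Field K] (A : ValuationSubring K) (t : K),
      PointedDeeplyRamifiedHenselian p A t →
      (Models A t T ↔ HasSmallDifferentGenerators A t) := by
  obtain ⟨T, hT⟩ := TheoryDef.forall fun n => theoryDef_generatorProperty.{u} (n + 1)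
  refine ⟨T, fun K _ A t h => ?_⟩
  rw [hasSmallDifferentGenerators_iff h.henselian h.ne_zero]
  exact hT K A t

end Main

end PointedVF

theorem mainTheorem2 (p : ℕ) [Fact p.Prime] :
    PointedVF.IsElementary.{u} (fun _ _ A t => PointedVF.ClassC p A t) ∧
    (∀ e : ℕ∞, PointedVF.IsElementary.{u} (fun _ _ A t => PointedVF.ClassCe p e A t)) ∧
    (∀ (K : Type u) [Field K] (A : ValuationSubring K) (t : K),
      PointedVF.PointedDeeplyRamifiedHenselian p A t →
      List.TFAE
        [PointedVF.SeparablyDefectless (PointedVF.coarsening A t),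
         PointedVF.HasSmallDifferentGenerators A t,
         PointedVF.SeparableAlgebraicallyMaximal (PointedVF.coarsening A t)]) ∧
    (∃ T : PointedVF.lang.Theory,
      ∀ (K : Type u) [Field K] (A : ValuationSubring K) (t : K),
        PointedVF.PointedDeeplyRamifiedHenselian p A t →
        (PointedVF.Models A t T ↔ PointedVF.HasSmallDifferentGenerators A t)) := by
  exact ⟨PointedVF.isElementary_classC p, PointedVF.isElementary_classCe p,
    fun _ _ _ _ h => h.tfae, PointedVF.exists_theory_hasSmallDifferentGenerators p⟩
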